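/- **Setting.** Let $T,\kappa,\gamma,\rho,\lambda,\phi,\varrho,y>0$, and let $(\Omega,\mathcal F,(\mathcal F_t)_{0\le t\le T},\mathbb P)$ be a filtered probability space satisfying the usual conditions; write $E_t=E[\,\cdot\mid\mathcal F_t]$. Let $P=L+A$ on $[0,T]$, where $L$ is a càdlàg local martingale and $A$ is a predictable càdlàg process of finite variation with $A_0=0$, such that $$E[L_0^2]+E[\langle L\rangle_T]+E\Big[\Big(\int_0^T|dA_s|\Big)^2\Big]<\infty .$$ Let $\mathcal A$ be the set of progressively measurable processes $v$ with $E[\int_0^Tv_s^2\,ds]<\infty$. Let $(x^i)_{i\in\mathbb N}\subset\mathbb R$ be such that $\tilde x=\lim_{N\to\infty}\frac1N\sum_{i=1}^Nx^i$ exists in $\mathbb R$. For $v,\nu\in\mathcal A$ and $i\in\mathbb N$ put $$X^{v,i}_t=x^i-\int_0^tv_s\,ds,\qquad Y^\nu_t=e^{-\rho t}y+\gamma\int_0^te^{-\rho(t-s)}\nu_s\,ds,\qquad S^\nu_t=P_t-\kappa Y^\nu_t,$$ $$J^{i}(v;\nu)=E\Big[\int_0^TS^\nu_tv_t\,dt-\lambda\int_0^Tv_t^2\,dt-\phi\int_0^T(X^{v,i}_t)^2dt+X^{v,i}_T\big(P_T-\varrho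 X^{v,i}_T\big)\Big].$$ A family $(\hat v^i)_{i\in\mathbb N}\subset\mathcal A$ is a *Nash equilibrium of the infinite player mean field game* if there is $\hat\nu\in\mathcal A$ such that $J^i(\hat v^i;\hat\nu)=\max_{w\in\mathcal A}J^i(w;\hat\nu)$ for every $i\in\mathbb N$ and $\hat\nu_t=\lim_{N\to\infty}\frac1N\sum_{i=1}^N\hat v^i_t$ $d\mathbb P\otimes dt$-a.e. on $\Omega\times[0,T]$. Consider the aggregated FBSDE for $(\tilde X,\tilde Y,\tilde\nu)$ with $\tilde\nu\in\mathcal A$: $$d\tilde X_t=-\tilde\nu_t\,dt,\quad \tilde X_0=\tilde x,\qquad d\tilde Y_t=-\rho\tilde Y_t\,dt+\gamma\tilde\nu_t\,dt,\quad \tilde Y_0=y,$$ $$d\tilde\nu_t=\frac{dP_t}{2\lambda}+\frac{\kappa\rho}{2\lambda}\tilde Y_t\,dt-\frac{\kappa\gamma}{2\lambda}\tilde\nu_t\,dt-\frac{\phi}{\lambda}\tilde X_t\,dt+d\tilde L_t,\qquad \tilde\nu_T=\frac{\varrho}{\lambda}\tilde X_T-\frac{\kappa}{2\lambda}\tilde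 Y_T,$$ for some square integrable martingale $\tilde L$, where the equation for $\tilde\nu$ is required, in integrated form, almost surely for each $t\in[0,T]$. Let $$R(t)=\sqrt{\phi/\lambda}\,\cosh\big(\sqrt{\phi/\lambda}\,t\big)+\frac{\varrho}{\lambda}\sinh\big(\sqrt{\phi/\lambda}\,t\big)\qquad(t\ge0).$$ **Theorem.** The aggregated FBSDE has a solution $(\tilde X,\tilde Y,\tilde\nu)$, and only one ($\tilde X,\tilde Y$ are unique up to indistinguishability, and $\tilde\nu_t$ is almost surely unique for each $t\in[0,T]$). The mean field game has a Nash equilibrium $(\hat v^i)_{i\in\mathbb N}\subset\mathcal A$, unique up to $d\mathbb P\otimes dt$-null sets on $\Omega\times[0,T]$, and (for a suitable version of $\hat v^i$) for all $i\in\mathbb N$ and all $t\in(0,T)$, almost surely, $$\hat v^i_t=\frac{R'(T-t)}{R(T-t)}X^{\hat v^i,i}_t-\frac1{2\lambda}E_t\Big[\int_t^T\frac{R(T-s)}{R(T-t)}\big(dA_s-\kappa\,d\tilde Y_s\big)+\sqrt{\frac{\phi}{\lambda}}\,\frac{\kappa}{R(T-t)}\tilde Y_T\Big],$$ where the random variable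 inside $E_t$ is integrable. -/

import Mathlib

open MeasureTheory ProbabilityTheory Filter Topology Set
open scoped NNReal ENNReal

/-- The (positive) constants of the model: time horizon `T`, impact parameters `κ`, `γ`, resilience
rate `ρ`, slippage cost `lam`, inventory penalties `φ` (running) and `ϱ` (terminal), and the initial
price distortion `y`. -/
structure ImpactParams where
  T : ℝ
  κ : ℝ
  γ : ℝ
  ρ : ℝ
  lam : ℝ
  φ : ℝ
  ϱ : ℝ
  y : ℝ
  T_pos : 0 < T
  κ_pos : 0 < κ
  γ_pos : 0 < γ
  ρ_pos : 0 < ρ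
  lam_pos : 0 < lam
  φ_pos : 0 < φ
  ϱ_pos : 0 < ϱ
  y_pos : 0 < y

/-! A process is a function `X : ℝ → Ω → ℝ`, of which only the times `t ≥ 0` are used; the
filtration is indexed by `ℝ≥0`. A process or a filtration on `[0, T]` is regarded as one on
`[0, ∞)` by freezing it at time `T`; nothing below depends on what happens after `T`. -/

/-- The restriction of a process to the time set `[0, ∞)` of the filtration. -/
abbrev onNonneg {Ω : Type*} (X : ℝ → Ω → ℝ) : ℝ≥0 → Ω → ℝ := fun t => X (t : ℝ)

/-- Right-continuous with left limits on `[0, ∞)`. -/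
def IsCadlagPath (f : ℝ → ℝ) : Prop :=
  ∀ t, 0 ≤ t → ContinuousWithinAt f (Ici t) t ∧ (0 < t → ∃ l, Tendsto f (𝓝[<] t) (𝓝 l))

/-- `Q` is the predictable quadratic variation `⟨L⟩` of the local martingale `L`: `Q` is predictable,
nondecreasing, càdlàg, null at zero, and `L` and `L² - Q` are local martingales. -/
structure IsPredictableBracket {Ω : Type*} [mΩ : MeasurableSpace Ω] (μ : Measure Ω)
    (𝓕 : Filtration ℝ≥0 mΩ) (L Q : ℝ → Ω → ℝ) : Prop where
  predictable : IsStronglyPredictable 𝓕 (onNonneg Q)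
  zero : ∀ ω, Q 0 ω = 0
  cadlag : ∀ ω, IsCadlagPath (fun t => Q t ω)
  mono : ∀ ω, MonotoneOn (fun t => Q t ω) (Ici 0)
  localMartingale : ∃ τ : ℕ → Ω → WithTop ℝ≥0, IsLocalizingSequence 𝓕 τ μ ∧
    ∀ n, Martingale (stoppedProcess (onNonneg L) (τ n)) 𝓕 μ ∧
      Martingale (stoppedProcess (onNonneg fun t ω => L t ω ^ 2 - Q t ω) (τ n)) 𝓕 μ

/-- `P = L + A` on `[0, T]` is the canonical decomposition of a semimartingale of class `H²`: `L` is
a càdlàg local martingale and `A` a predictable càdlàg finite variation process, null at zero, such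
that `E[L₀²] + E[⟨L⟩_T] + E[(∫₀ᵀ |dA_s|)²] < ∞`. -/
structure IsH2Semimartingale {Ω : Type*} [mΩ : MeasurableSpace Ω] (μ : Measure Ω)
    (𝓕 : Filtration ℝ≥0 mΩ) (T : ℝ) (P L A : ℝ → Ω → ℝ) : Prop where
  decomp : ∀ t ∈ Icc 0 T, ∀ ω, P t ω = L t ω + A t ω
  adapted_L : StronglyAdapted 𝓕 (onNonneg L)
  cadlag_L : ∀ ω, IsCadlagPath (fun t => L t ω)
  memLp_L_zero : MemLp (L 0) 2 μ
  bracket_L : ∃ Q : ℝ → Ω → ℝ, IsPredictableBracket μ 𝓕 L Q ∧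
    ∫⁻ ω, ENNReal.ofReal (Q T ω) ∂μ < ∞
  predictable_A : IsStronglyPredictable 𝓕 (onNonneg A)
  cadlag_A : ∀ ω, IsCadlagPath (fun t => A t ω)
  A_zero : ∀ ω, A 0 ω = 0
  variation_A : ∫⁻ ω, (eVariationOn (fun t => A t ω) (Icc 0 T)) ^ 2 ∂μ < ∞

open scoped Classical in
/-- The pathwise Lebesgue–Stieltjes integral `∫_{(a, b]} g(s) df(s)` of `g` against a right-continuous
function `f` of bounded variation on `[a, b]`: the integral against the Stieltjes measure of `f`
stopped outside `[a, b]` (and `0` if `f` has infinite variation on `[a, b]`). -/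
noncomputable def stieltjesIntegral (g f : ℝ → ℝ) (a b : ℝ) : ℝ :=
  if h : BoundedVariationOn (fun s => f (max a (min s b))) univ then
    ∫ᵛ s in Ioc a b, g s ∂•h.vectorMeasure
  else 0

/-- Admissible trading rates: progressively measurable with `E[∫₀ᵀ v_s² ds] < ∞`. -/
structure IsAdmissible {Ω : Type*} [mΩ : MeasurableSpace Ω] (μ : Measure Ω)
    (𝓕 : Filtration ℝ≥0 mΩ) (T : ℝ) (v : ℝ → Ω → ℝ) : Prop where
  progressive : IsStronglyProgressive 𝓕 (onNonneg v)
  sq_integrable : ∫⁻ ω, ∫⁻ s in Icc 0 T, ENNReal.ofReal (v s ω ^ 2) ∂volume ∂μ < ∞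

/-- The inventory `X^v_t = x - ∫₀ᵗ v_s ds`. -/
noncomputable def inventory {Ω : Type*} (x : ℝ) (v : ℝ → Ω → ℝ) : ℝ → Ω → ℝ :=
  fun t ω => x - ∫ s in (0 : ℝ)..t, v s ω

/-- The transient price distortion `Y^ν_t = e^{-ρt} y + γ ∫₀ᵗ e^{-ρ(t-s)} ν_s ds`. -/
noncomputable def distortion {Ω : Type*} (p : ImpactParams) (ν : ℝ → Ω → ℝ) : ℝ → Ω → ℝ :=
  fun t ω => Real.exp (-p.ρ * t) * p.y +
    p.γ * ∫ s in (0 : ℝ)..t, Real.exp (-p.ρ * (t - s)) * ν s ω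

/-- The execution price `S^ν = P - κ Y^ν`. -/
noncomputable def executionPrice {Ω : Type*} (p : ImpactParams) (P ν : ℝ → Ω → ℝ) : ℝ → Ω → ℝ :=
  fun t ω => P t ω - p.κ * distortion p ν t ω

/-- The performance functional `J(v; ν)` of an agent with initial position `x` and selling rate `v`,
given the net trading flow `ν`. -/
noncomputable def performance {Ω : Type*} [MeasurableSpace Ω] (μ : Measure Ω) (p : ImpactParams)
    (P : ℝ → Ω → ℝ) (x : ℝ) (v ν : ℝ → Ω → ℝ) : ℝ :=
  ∫ ω, ((∫ t in (0 : ℝ)..p.T, executionPrice p P ν t ω * v t ω)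
    - p.lam * (∫ t in (0 : ℝ)..p.T, v t ω ^ 2)
    - p.φ * (∫ t in (0 : ℝ)..p.T, inventory x v t ω ^ 2)
    + inventory x v p.T ω * (P p.T ω - p.ϱ * inventory x v p.T ω)) ∂μ

/-- The measure `dt ⊗ dℙ` on `[0, T] × Ω`. -/
noncomputable def timeProd {Ω : Type*} [MeasurableSpace Ω] (μ : Measure Ω) (T : ℝ) :
    Measure (ℝ × Ω) :=
  (volume.restrict (Icc 0 T)).prod μ

/-- Nash equilibria of the infinite player mean field game, the agent with index `i` starting from
the position `x i`. -/
structure IsMeanFieldNash {Ω : Type*} [mΩ : MeasurableSpace Ω] (μ : Measure Ω)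
    (𝓕 : Filtration ℝ≥0 mΩ) (p : ImpactParams) (P : ℝ → Ω → ℝ) (x : ℕ → ℝ)
    (v : ℕ → ℝ → Ω → ℝ) : Prop where
  admissible : ∀ i, IsAdmissible μ 𝓕 p.T (v i)
  equilibrium : ∃ ν : ℝ → Ω → ℝ, IsAdmissible μ 𝓕 p.T ν ∧
    (∀ i, ∀ w, IsAdmissible μ 𝓕 p.T w →
      performance μ p P (x i) w ν ≤ performance μ p P (x i) (v i) ν) ∧
    ∀ᵐ z ∂(timeProd μ p.T),
      Tendsto (fun N : ℕ => (∑ i ∈ Finset.range N, v i z.1 z.2) / N) atTop (𝓝 (ν z.1 z.2))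

/-- `(X, Y, ν)` with `ν` admissible solves the aggregated mean field FBSDE
`dX = -ν dt`, `X₀ = xbar`, `dY = (-ρ Y + γ ν) dt`, `Y₀ = y`,
`dν = dP/(2λ) + (κρ/(2λ) Y - κγ/(2λ) ν - φ/λ X) dt + dM`, `ν_T = (ϱ/λ) X_T - κ/(2λ) Y_T`,
for some square integrable martingale `M`. -/
structure IsAggregatedSolution {Ω : Type*} [mΩ : MeasurableSpace Ω] (μ : Measure Ω)
    (𝓕 : Filtration ℝ≥0 mΩ) (p : ImpactParams) (P : ℝ → Ω → ℝ) (xbar : ℝ)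
    (X Y ν : ℝ → Ω → ℝ) : Prop where
  admissible : IsAdmissible μ 𝓕 p.T ν
  forward_X : ∀ᵐ ω ∂μ, ∀ t ∈ Icc 0 p.T, X t ω = xbar - ∫ s in (0 : ℝ)..t, ν s ω
  forward_Y : ∀ᵐ ω ∂μ, ∀ t ∈ Icc 0 p.T,
    Y t ω = p.y + ∫ s in (0 : ℝ)..t, (-p.ρ * Y s ω + p.γ * ν s ω)
  backward : ∃ M : ℝ → Ω → ℝ, Martingale (onNonneg M) 𝓕 μ ∧ (∀ t, 0 ≤ t → MemLp (M t) 2 μ) ∧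
    ∀ t ∈ Icc 0 p.T, ∀ᵐ ω ∂μ,
      ν t ω = ν 0 ω + (P t ω - P 0 ω) / (2 * p.lam)
        + (∫ s in (0 : ℝ)..t, (p.κ * p.ρ / (2 * p.lam) * Y s ω
            - p.κ * p.γ / (2 * p.lam) * ν s ω - p.φ / p.lam * X s ω))
        + (M t ω - M 0 ω)
  terminal : ∀ᵐ ω ∂μ, ν p.T ω = p.ϱ / p.lam * X p.T ω - p.κ / (2 * p.lam) * Y p.T ω

/-- `R(t) = √(φ/λ) cosh(√(φ/λ) t) + (ϱ/λ) sinh(√(φ/λ) t)`. -/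
noncomputable def feedbackR (p : ImpactParams) (t : ℝ) : ℝ :=
  √(p.φ / p.lam) * Real.cosh (√(p.φ / p.lam) * t)
    + p.ϱ / p.lam * Real.sinh (√(p.φ / p.lam) * t)

/-- The random variable
`∫_{(t,T]} R(T-s)/R(T-t) (dA_s - κ dY_s) + √(φ/λ) κ/R(T-t) Y_T`. -/
noncomputable def feedbackTerm {Ω : Type*} (p : ImpactParams) (A Y : ℝ → Ω → ℝ) (t : ℝ) : Ω → ℝ :=
  fun ω => stieltjesIntegral (fun s => feedbackR p (p.T - s) / feedbackR p (p.T - t))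
      (fun s => A s ω - p.κ * Y s ω) t p.T
    + √(p.φ / p.lam) * (p.κ / feedbackR p (p.T - t)) * Y p.T ω

/-! Fix the net flow `ν`. The expected payoff of an agent is a strictly concave quadratic function
of the rate `v`, and its derivative is represented by the process B_t = S_t - 2λ v_t + 2φ ∫_t^T X_s
ds - P_T + 2ϱ X_T (`marginal`). Since the expansion in `performance_add` is exact, `v` is optimal if
and only if B is orthogonal in L²(dt ⊗ dℙ) to all admissible rates (`isOptimal_iff_isStationary`).
The condition E_t[B_t] = 0 for every t implies this orthogonality. The aggregated FBSDE is the
first-order condition of an agent who starts from the mean position and responds to the flow that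
this same rate generates: eliminating the drift and the terminal condition turns the backward
equation into B_t = 2λ (M_T - M_t) (`exists_martingale`, `isAggregatedSolution_of_martingale`).

Well-posedness is monotonicity. B is affine in the rate, and its linear part paired with a rate w is
at most -2λ ‖w‖² (`integral_mul_marginalPath_self_le`). The inventory penalties only help, and so
does transient impact: if D' = -ρD + γw and D_0 = 0, then γ ∫ w D = D_T²/2 + ρ ∫ D² ≥ 0. This gives
uniqueness (`ae_eq_of_isStationary`) and, by Lax–Milgram on the closed subspace of progressive
processes, a weak solution (`exists_isStationaryRate`). The weak solution is known only up to null
sets of dt ⊗ dℙ. Solving E_t[B_t] = 0 for the rate at time t gives a version for which the backward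
equation holds at each fixed time. This needs a progressive version of a closed martingale, obtained
from Lévy's downward theorem and the right-continuity of the filtration.

The passage to individual agents is explicit. The deterministic rate R'(T-t)/R(T) liquidates a unit
position with zero marginal when there are no prices. Adding k times this rate therefore moves the
initial position by k and leaves B unchanged. Hence `ν` shifted by x^i - x̃ is an equilibrium whose
averages converge to `ν`. Conversely, in any equilibrium the uniqueness of best responses makes all
rates shifts of one another, so the limiting flow is itself a rate that responds optimally to itself
and must be `ν`.

The feedback formula comes from testing E_s[B_s] = 0 with R'(T-s) on [t, T]. Since R'' = (φ/λ) R and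
R'(0) = (ϱ/λ) R(0), all terms with the future rate cancel. The martingale part L has zero
conditional mean, and a Stieltjes integration by parts puts what remains into the form of
`feedbackTerm`. -/

set_option linter.unusedSectionVars false

/-! ### Lévy's downward theorem in L². -/

section ReverseMartingale

variable {Ω : Type*} {mΩ : MeasurableSpace Ω} {μ : Measure Ω}

/-- Nonnegativity of the variance of |f|. -/
lemma sq_integral_abs_le [IsProbabilityMeasure μ] {f : Ω → ℝ} (hf : MemLp f 2 μ) :
    (∫ ω, |f ω| ∂μ) ^ 2 ≤ ∫ ω, f ω ^ 2 ∂μ := by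
  have h := variance_nonneg |f| μ
  rw [variance_eq_sub hf.abs] at h
  simpa using h

/-- Integrating a product of two square integrable functions, one of them measurable for a smaller
σ-algebra, only sees the conditional expectation of the other. -/
lemma integral_mul_condExp_eq [IsFiniteMeasure μ] {m : MeasurableSpace Ω} (hm : m ≤ mΩ)
    {w f : Ω → ℝ} (hw : StronglyMeasurable[m] w) (hw2 : MemLp w 2 μ) (hf : MemLp f 2 μ) :
    ∫ ω, w ω * f ω ∂μ = ∫ ω, w ω * (μ[f|m]) ω ∂μ := by
  have h := condExp_mul_of_stronglyMeasurable_left (μ := μ) (m := m) hw (hw2.integrable_mul hf)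
    (hf.integrable one_le_two)
  rw [← integral_condExp hm (f := fun ω => w ω * f ω)]
  exact integral_congr_ae h

/-- Pythagoras: by the tower property the coarser conditional expectation is the orthogonal
projection of the finer one, so squared distances are differences of energies. -/
lemma integral_sq_condExp_sub [IsFiniteMeasure μ] {m₁ m₂ : MeasurableSpace Ω} (h₁₂ : m₂ ≤ m₁)
    (h₁ : m₁ ≤ mΩ) {K : Ω → ℝ} (hK : MemLp K 2 μ) :
    ∫ ω, ((μ[K|m₁]) ω - (μ[K|m₂]) ω) ^ 2 ∂μ
      = ∫ ω, (μ[K|m₁]) ω ^ 2 ∂μ - ∫ ω, (μ[K|m₂]) ω ^ 2 ∂μ := by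
  have hX : MemLp (μ[K|m₁]) 2 μ := hK.condExp one_le_two
  have hY : MemLp (μ[K|m₂]) 2 μ := hK.condExp one_le_two
  have hXY : ∫ ω, (μ[K|m₂]) ω * (μ[K|m₁]) ω ∂μ = ∫ ω, (μ[K|m₂]) ω ^ 2 ∂μ := by
    rw [integral_mul_condExp_eq (h₁₂.trans h₁) stronglyMeasurable_condExp hY hX]
    refine integral_congr_ae ?_
    filter_upwards [condExp_condExp_of_le (μ := μ) (f := K) h₁₂ h₁] with ω hω
    rw [hω, sq]
  have e : (fun ω => ((μ[K|m₁]) ω - (μ[K|m₂]) ω) ^ 2)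
      = fun ω => ((μ[K|m₁]) ω ^ 2 - 2 * ((μ[K|m₂]) ω * (μ[K|m₁]) ω)) + (μ[K|m₂]) ω ^ 2 := by
    ext ω; ring
  have hi : Integrable (fun ω => 2 * ((μ[K|m₂]) ω * (μ[K|m₁]) ω)) μ :=
    (hY.integrable_mul hX).const_mul 2
  have hs : Integrable (fun ω => (μ[K|m₁]) ω ^ 2 - 2 * ((μ[K|m₂]) ω * (μ[K|m₁]) ω)) μ :=
    hX.integrable_sq.sub hi
  rw [e, integral_add hs hY.integrable_sq, integral_sub hX.integrable_sq hi,
    integral_const_mul, hXY]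
  ring

/-- Doob's maximal inequality for a reverse martingale closed in `L²`. -/
lemma measure_exists_le_abs_condExp_sub [IsProbabilityMeasure μ] {G : ℕ → MeasurableSpace Ω}
    (hG : Antitone G) (hle : ∀ n, G n ≤ mΩ) {K : Ω → ℝ} (hK : MemLp K 2 μ) {ε : ℝ≥0}
    (n N : ℕ) :
    ε * μ {ω | ∃ k ∈ Finset.Icc n (n + N), (ε : ℝ) ≤ |(μ[K|G k]) ω - (μ[K|G (n + N)]) ω|}
      ≤ ENNReal.ofReal
        (√(∫ ω, (μ[K|G n]) ω ^ 2 ∂μ - ∫ ω, (μ[K|G (n + N)]) ω ^ 2 ∂μ)) := by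
  -- Reversing time on the window [n, n+N] makes a filtration out of the decreasing family, so that
  -- the forward maximal inequality applies. Truncated subtraction freezes it at `G 0` beyond the
  -- window.
  let 𝒢 : Filtration ℕ mΩ :=
    { seq := fun j => G (n + N - j)
      mono' := fun i j hij => hG (by omega)
      le' := fun j => hle _ }
  set D : Ω → ℝ := fun ω => K ω - (μ[K|G (n + N)]) ω with hD
  have hDL : MemLp D 2 μ := hK.sub (hK.condExp one_le_two)
  have hmart := martingale_condExp D 𝒢 μ
  have hsub : Submartingale (fun j => |μ[D|𝒢 j]|) 𝒢 μ := by
    have := hmart.submartingale.sup hmart.neg.submartingale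
    exact this
  have hval : ∀ j, j ≤ N → μ[D|𝒢 j] =ᵐ[μ] fun ω =>
      (μ[K|G (n + N - j)]) ω - (μ[K|G (n + N)]) ω := by
    intro j hj
    have h1 := condExp_sub (hK.integrable one_le_two)
      ((hK.condExp (m := G (n + N)) one_le_two).integrable one_le_two) (𝒢 j)
    have h2 : μ[μ[K|G (n + N)]|𝒢 j] = μ[K|G (n + N)] :=
      condExp_of_stronglyMeasurable (hle _)
        (stronglyMeasurable_condExp.mono (hG (by omega))) integrable_condExp
    rw [h2] at h1
    exact h1
  have hmax := maximal_ineq hsub (fun j ω => abs_nonneg _) (ε := ε) N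
  have hset : μ {ω | ∃ k ∈ Finset.Icc n (n + N),
      (ε : ℝ) ≤ |(μ[K|G k]) ω - (μ[K|G (n + N)]) ω|}
      ≤ μ {ω | (ε : ℝ) ≤ (Finset.range (N + 1)).sup' Finset.nonempty_range_add_one
        fun k => |μ[D|𝒢 k]| ω} := by
    have hall : ∀ᵐ ω ∂μ, ∀ j, j ≤ N → (μ[D|𝒢 j]) ω =
        (μ[K|G (n + N - j)]) ω - (μ[K|G (n + N)]) ω := by
      rw [ae_all_iff]; intro j
      by_cases hj : j ≤ N
      · filter_upwards [hval j hj] with ω hω _ using hω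
      · exact ae_of_all _ fun ω h => absurd h hj
    refine measure_mono_ae ?_
    filter_upwards [hall] with ω hω
    rintro ⟨k, hk, hk2⟩
    rw [Finset.mem_Icc] at hk
    change (ε : ℝ) ≤ _
    rw [Finset.le_sup'_iff]
    refine ⟨n + N - k, by simp; omega, ?_⟩
    rw [Pi.abs_apply, hω _ (by omega)]
    rwa [show n + N - (n + N - k) = k by omega]
  refine (mul_le_mul_right hset _).trans (hmax.trans (ENNReal.ofReal_le_ofReal ?_))
  have hDN : MemLp (μ[D|𝒢 N]) 2 μ := hDL.condExp one_le_two
  refine (setIntegral_le_integral (hDN.integrable one_le_two).abs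
    (ae_of_all _ fun ω => abs_nonneg _)).trans ?_
  refine Real.le_sqrt_of_sq_le ((sq_integral_abs_le hDN).trans (le_of_eq ?_))
  rw [← integral_sq_condExp_sub (hG (by omega)) (hle _) hK]
  refine integral_congr_ae ?_
  filter_upwards [hval N le_rfl] with ω hω
  rw [hω, show n + N - N = n by omega]

/-- The energies `e n` decrease to a limit l. By the maximal inequality, the probability that the
sequence moves by 2ε after index n is at most √(e n - l)/ε, which tends to zero. -/
lemma ae_cauchySeq_condExp_of_antitone [IsProbabilityMeasure μ] {G : ℕ → MeasurableSpace Ω}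
    (hG : Antitone G) (hle : ∀ n, G n ≤ mΩ) {K : Ω → ℝ} (hK : MemLp K 2 μ) :
    ∀ᵐ ω ∂μ, CauchySeq fun n => (μ[K|G n]) ω := by
  set e : ℕ → ℝ := fun n => ∫ ω, (μ[K|G n]) ω ^ 2 ∂μ with he
  have he_anti : Antitone e := fun n m hnm => by
    have h := integral_sq_condExp_sub (hG hnm) (hle n) hK
    have : 0 ≤ ∫ ω, ((μ[K|G n]) ω - (μ[K|G m]) ω) ^ 2 ∂μ := integral_nonneg fun _ => sq_nonneg _
    rw [h] at this
    simp only [he]; linarith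
  have he0 : ∀ n, 0 ≤ e n := fun n => integral_nonneg fun _ => sq_nonneg _
  have hbdd : BddBelow (range e) := ⟨0, by rintro _ ⟨n, rfl⟩; exact he0 n⟩
  have hlim := tendsto_atTop_ciInf he_anti hbdd
  set l := ⨅ n, e n
  have hδ : Tendsto (fun n => ENNReal.ofReal (√(e n - l))) atTop (𝓝 0) := by
    have : Tendsto (fun n => √(e n - l)) atTop (𝓝 0) := by
      have h := (hlim.sub_const l).sqrt
      simpa using h
    simpa using ENNReal.tendsto_ofReal this
  -- The maximal inequality compares with the last index n+N of the window. Comparing with n instead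
  -- uses the triangle inequality and costs the factor 2.
  have hbad : ∀ ε : ℝ≥0, 0 < ε → ∀ n,
      μ {ω | ∃ k, n ≤ k ∧ 2 * (ε : ℝ) ≤ |(μ[K|G k]) ω - (μ[K|G n]) ω|}
        ≤ ENNReal.ofReal (√(e n - l)) / ε := by
    intro ε hε n
    have hU : {ω | ∃ k, n ≤ k ∧ 2 * (ε : ℝ) ≤ |(μ[K|G k]) ω - (μ[K|G n]) ω|}
        = ⋃ N, {ω | ∃ k ∈ Finset.Icc n (n + N), 2 * (ε : ℝ) ≤ |(μ[K|G k]) ω - (μ[K|G n]) ω|} := by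
      ext ω
      simp only [mem_iUnion, mem_ofPred_eq, Finset.mem_Icc]
      constructor
      · rintro ⟨k, hk, h⟩; exact ⟨k, k, ⟨hk, by omega⟩, h⟩
      · rintro ⟨N, k, hk, h⟩; exact ⟨k, hk.1, h⟩
    rw [hU, Monotone.measure_iUnion]
    · refine iSup_le fun N => ?_
      rw [ENNReal.le_div_iff_mul_le (by simp [hε.ne']) (by simp), mul_comm]
      refine le_trans (mul_le_mul_right (measure_mono ?_) _)
        ((measure_exists_le_abs_condExp_sub hG hle hK n N).trans
          (ENNReal.ofReal_le_ofReal (Real.sqrt_le_sqrt (sub_le_sub_left (ciInf_le hbdd _) _))))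
      rintro ω ⟨k, hk, h⟩
      by_contra hcon
      simp only [mem_ofPred_eq, not_exists, not_and, not_le] at hcon
      have h1 := hcon k hk
      have h2 := hcon n (by simp)
      have := abs_sub_le ((μ[K|G k]) ω) ((μ[K|G (n + N)]) ω) ((μ[K|G n]) ω)
      rw [abs_sub_comm ((μ[K|G (n + N)]) ω)] at this
      linarith
    · rintro N M hNM ω ⟨k, hk, h⟩
      simp only [Finset.mem_Icc] at hk
      exact ⟨k, by simp; omega, h⟩
  have hnull : ∀ ε : ℝ≥0, 0 < ε →
      ∀ᵐ ω ∂μ, ∃ n, ∀ k, n ≤ k → |(μ[K|G k]) ω - (μ[K|G n]) ω| < 2 * (ε : ℝ) := by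
    intro ε hε
    rw [ae_iff]
    have hle' : ∀ n, μ {ω | ¬ ∃ n, ∀ k, n ≤ k → |(μ[K|G k]) ω - (μ[K|G n]) ω| < 2 * (ε : ℝ)}
        ≤ ENNReal.ofReal (√(e n - l)) / ε := fun n => by
      refine (measure_mono ?_).trans (hbad ε hε n)
      intro ω hω
      simp only [mem_ofPred_eq, not_exists, not_forall, not_lt] at hω
      obtain ⟨k, hk, h⟩ := hω n
      exact ⟨k, hk, h⟩
    have hz : Tendsto (fun n => ENNReal.ofReal (√(e n - l)) / ε) atTop (𝓝 0) := by
      have h := ENNReal.Tendsto.div_const hδ (b := (ε : ℝ≥0∞)) (Or.inr (by simp [hε.ne']))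
      simpa using h
    exact le_antisymm (ge_of_tendsto' hz hle') zero_le
  have hj : ∀ᵐ ω ∂μ, ∀ j : ℕ, ∃ n, ∀ k, n ≤ k →
      |(μ[K|G k]) ω - (μ[K|G n]) ω| < 2 * (((1 : ℝ≥0) / (j + 1) : ℝ≥0) : ℝ) :=
    ae_all_iff.2 fun j => hnull _ (by positivity)
  filter_upwards [hj] with ω hω
  rw [Metric.cauchySeq_iff']
  intro ε hε
  obtain ⟨j, hj⟩ := exists_nat_one_div_lt (half_pos hε)
  obtain ⟨n, hn⟩ := hω j
  refine ⟨n, fun k hk => ?_⟩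
  rw [Real.dist_eq]
  refine (hn k hk).trans ?_
  push_cast
  linarith

/-- **Lévy's downward theorem** in `L²`, for a real-valued closing variable. -/
theorem condExp_ae_eq_limsup_of_antitone [IsProbabilityMeasure μ] {G : ℕ → MeasurableSpace Ω}
    (hG : Antitone G) (hle : ∀ n, G n ≤ mΩ) {m : MeasurableSpace Ω} (hm : ∀ n, m ≤ G n)
    {K : Ω → ℝ} (hK : MemLp K 2 μ)
    (hmeas : Measurable[m] fun ω => limsup (fun n => (μ[K|G n]) ω) atTop) :
    (fun ω => limsup (fun n => (μ[K|G n]) ω) atTop) =ᵐ[μ] μ[K|m] := by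
  have hm' : m ≤ mΩ := (hm 0).trans (hle 0)
  set a : Ω → ℝ := fun ω => limsup (fun n => (μ[K|G n]) ω) atTop with ha
  have hK1 := hK.integrable one_le_two
  have htend : ∀ᵐ ω ∂μ, Tendsto (fun n => (μ[K|G n]) ω) atTop (𝓝 (a ω)) := by
    filter_upwards [ae_cauchySeq_condExp_of_antitone hG hle hK] with ω hω
    obtain ⟨c, hc⟩ := cauchySeq_tendsto_of_complete hω
    rw [ha]; dsimp only; rwa [hc.limsup_eq]
  have hUI := hK1.uniformIntegrable_condExp hle
  have haL : MemLp a 1 μ := hUI.memLp_of_ae_tendsto htend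
  have hL1 := tendsto_Lp_finite_of_tendsto_ae le_rfl ENNReal.one_ne_top
    (fun n => (integrable_condExp (m := G n) (μ := μ) (f := K)).aestronglyMeasurable) haL
    hUI.unifIntegrable htend
  refine ae_eq_condExp_of_forall_setIntegral_eq hm' hK1
    (fun s _ _ => (memLp_one_iff_integrable.1 haL).integrableOn) (fun s hs _ => ?_)
    hmeas.stronglyMeasurable.aestronglyMeasurable
  have h1 := tendsto_setIntegral_of_L1' a haL.1 (Eventually.of_forall fun n =>
    integrable_condExp (m := G n) (μ := μ) (f := K)) hL1 s
  have h2 : ∀ n, ∫ x in s, (μ[K|G n]) x ∂μ = ∫ x in s, K x ∂μ := fun n =>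
    setIntegral_condExp (hle n) hK1 (hm n s hs)
  simp only [h2] at h1
  exact tendsto_nhds_unique h1 tendsto_const_nhds

end ReverseMartingale

/-! ### Progressive versions of closed martingales. -/

section ProgressiveVersion

/-- The first dyadic number of level `n` that is strictly larger than `t`. -/
noncomputable def dyadicAfter (n : ℕ) (t : ℝ≥0) : ℝ≥0 := (⌊2 ^ n * t⌋₊ + 1) / 2 ^ n

lemma lt_dyadicAfter (n : ℕ) (t : ℝ≥0) : t < dyadicAfter n t := by
  rw [dyadicAfter, lt_div_iff₀ (by positivity), mul_comm]
  exact Nat.lt_floor_add_one _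

lemma dyadicAfter_le (n : ℕ) (t : ℝ≥0) : dyadicAfter n t ≤ t + (1 / 2) ^ n := by
  rw [dyadicAfter, div_le_iff₀ (by positivity), add_mul, ← mul_pow]
  have := Nat.floor_le (a := 2 ^ n * t) zero_le
  have h : ((1 : ℝ≥0) / 2 * 2) = 1 := by norm_num
  rw [h, one_pow, mul_comm t]
  gcongr

/-- The dyadic grids are nested. -/
lemma antitone_dyadicAfter (t : ℝ≥0) : Antitone fun n => dyadicAfter n t := by
  refine antitone_nat_of_succ_le fun n => ?_
  simp only [dyadicAfter]
  rw [div_le_div_iff₀ (by positivity) (by positivity)]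
  have h : ⌊2 ^ (n + 1) * t⌋₊ + 1 ≤ 2 * (⌊2 ^ n * t⌋₊ + 1) := by
    have h1 : 2 ^ (n + 1) * t < ((2 * (⌊2 ^ n * t⌋₊ + 1) : ℕ) : ℝ≥0) := by
      push_cast
      rw [pow_succ, mul_comm (2 ^ n : ℝ≥0) 2, mul_assoc]
      exact mul_lt_mul_of_pos_left (Nat.lt_floor_add_one _) (by norm_num)
    exact (Nat.floor_lt zero_le).2 h1
  have h' : ((⌊2 ^ (n + 1) * t⌋₊ : ℝ≥0) + 1) ≤ 2 * (⌊2 ^ n * t⌋₊ + 1) := by exact_mod_cast h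
  calc ((⌊2 ^ (n + 1) * t⌋₊ : ℝ≥0) + 1) * 2 ^ n ≤ 2 * (⌊2 ^ n * t⌋₊ + 1) * 2 ^ n := by gcongr
    _ = _ := by ring

lemma eventually_dyadicAfter_le {t j : ℝ≥0} (h : t < j) : ∃ N, ∀ n, N ≤ n → dyadicAfter n t ≤ j := by
  obtain ⟨N, hN⟩ := exists_pow_lt_of_lt_one (tsub_pos_of_lt h) (show (1 / 2 : ℝ≥0) < 1 by
    rw [← NNReal.coe_lt_coe]; norm_num)
  refine ⟨N, fun n hn => (antitone_dyadicAfter t hn).trans ((dyadicAfter_le N t).trans ?_)⟩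
  calc t + (1 / 2) ^ N ≤ t + (j - t) := by gcongr
    _ = j := add_tsub_cancel_of_le h.le

/-- Right-continuity identifies `𝓕 t` with the intersection of the later σ-algebras. -/
lemma measurable_of_forall_gt {Ω : Type*} {mΩ : MeasurableSpace Ω} (𝓕 : Filtration ℝ≥0 mΩ)
    [𝓕.IsRightContinuous] {t : ℝ≥0} {f : Ω → ℝ} (h : ∀ j, t < j → Measurable[𝓕 j] f) :
    Measurable[𝓕 t] f := by
  intro s hs
  refine Filtration.IsRightContinuous.RC (𝓕 := 𝓕) t _ ?_
  rw [Filtration.rightCont_eq]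
  simp only [MeasurableSpace.measurableSet_iInf]
  exact fun j hj => h j hj hs

/-- A process that is the upper limit of an adapted process along dyadic times from the right is
progressive as soon as it is adapted. -/
lemma isStronglyProgressive_limsup_dyadicAfter {Ω : Type*} {mΩ : MeasurableSpace Ω}
    {𝓕 : Filtration ℝ≥0 mΩ} {X m : ℝ≥0 → Ω → ℝ} (hX : ∀ t, Measurable[𝓕 t] (X t))
    (hmeas : ∀ t, Measurable[𝓕 t] (m t))
    (hm : ∀ t ω, m t ω = limsup (fun n => X (dyadicAfter n t) ω) atTop) :
    IsStronglyProgressive 𝓕 m := by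
  refine IsProgressive.isStronglyProgressive fun i => ?_
  -- Values at times beyond i are replaced by 0 to stay `𝓕 i`-measurable. For s < i this changes
  -- only finitely many terms of the upper limit; at s = i every dyadic time lies beyond i, and
  -- adaptedness of `m` is used instead.
  let Z : ℕ → ℕ × Ω → ℝ := fun n z =>
    if ((z.1 : ℝ≥0) + 1) / 2 ^ n ≤ i then X (((z.1 : ℝ≥0) + 1) / 2 ^ n) z.2 else 0
  let : MeasurableSpace Ω := 𝓕 i
  have hZ : ∀ n, Measurable (Z n) := fun n => measurable_from_prod_countable_right fun k => by
    by_cases hk : ((k : ℝ≥0) + 1) / 2 ^ n ≤ i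
    · simp only [Z, hk, if_true]
      exact (hX _).mono (𝓕.mono hk) le_rfl
    · simp only [Z, hk, if_false]
      exact measurable_const
  have hfl : ∀ n : ℕ, Measurable fun q : Iic i × Ω => (⌊2 ^ n * (q.1 : ℝ≥0)⌋₊, q.2) := fun n =>
    (Nat.measurable_floor.comp
      ((measurable_const.mul measurable_subtype_coe).comp measurable_fst)).prodMk measurable_snd
  have e : (fun q : Iic i × Ω => m q.1 q.2) = fun q : Iic i × Ω =>
      if (q.1 : ℝ≥0) < i then limsup (fun n => Z n (⌊2 ^ n * (q.1 : ℝ≥0)⌋₊, q.2)) atTop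
      else m i q.2 := by
    ext ⟨⟨s, hs⟩, ω⟩
    by_cases hsi : s < i
    · simp only [hsi, if_true, hm]
      refine limsup_congr ?_
      obtain ⟨N, hN⟩ := eventually_dyadicAfter_le hsi
      filter_upwards [eventually_ge_atTop N] with n hn
      have h := hN n hn
      rw [dyadicAfter] at h
      simp only [Z, h, if_true, dyadicAfter]
    · have : s = i := le_antisymm hs (not_lt.1 hsi)
      simp [this]
  rw [e]
  refine Measurable.ite ?_ (Measurable.limsup fun n => (hZ n).comp (hfl n))
    ((hmeas i).comp measurable_snd)
  exact measurableSet_lt (measurable_subtype_coe.comp measurable_fst) measurable_const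


/-- For a right-continuous filtration, a martingale closed by a square integrable variable has a
progressively measurable version. -/
theorem exists_progressive_condExp {Ω : Type*} {mΩ : MeasurableSpace Ω} {μ : Measure Ω}
    [IsProbabilityMeasure μ] (𝓕 : Filtration ℝ≥0 mΩ) [𝓕.IsRightContinuous] {K : Ω → ℝ}
    (hK : MemLp K 2 μ) :
    ∃ m : ℝ≥0 → Ω → ℝ, IsStronglyProgressive 𝓕 m ∧ ∀ t, m t =ᵐ[μ] μ[K|𝓕 t] := by
  set m : ℝ≥0 → Ω → ℝ := fun t ω => limsup (fun n => (μ[K|𝓕 (dyadicAfter n t)]) ω) atTop with hm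
  -- For any j > t, dropping finitely many terms leaves only times up to j and does not change the
  -- upper limit.
  have hmeas : ∀ t, Measurable[𝓕 t] (m t) := fun t => by
    refine measurable_of_forall_gt 𝓕 fun j hj => ?_
    obtain ⟨N, hN⟩ := eventually_dyadicAfter_le hj
    have e : m t = fun ω => limsup (fun n => (μ[K|𝓕 (dyadicAfter (n + N) t)]) ω) atTop := by
      ext ω
      exact (limsup_nat_add (fun n => (μ[K|𝓕 (dyadicAfter n t)]) ω) N).symm
    rw [e]
    exact @Measurable.limsup _ _ _ _ _ (𝓕 j) _ _ _ _ fun n =>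
      (stronglyMeasurable_condExp.mono (𝓕.mono (hN _ (by omega)))).measurable
  refine ⟨m, isStronglyProgressive_limsup_dyadicAfter (fun t => stronglyMeasurable_condExp.measurable)
    hmeas fun _ _ => rfl, fun t => condExp_ae_eq_limsup_of_antitone
    (G := fun n => 𝓕 (dyadicAfter n t)) (fun a b hab => 𝓕.mono (antitone_dyadicAfter t hab))
    (fun n => 𝓕.le _) (fun n => 𝓕.mono (lt_dyadicAfter n t).le) hK (hmeas t)⟩

end ProgressiveVersion

/-! ### Joint and progressive measurability of processes and of their time integrals. -/

section JointMeasurability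

/-- The process `v` is jointly measurable on `[0, T] × Ω`, where `Ω` carries the σ-algebra `m`. -/
def IsJointlyMeasurable {Ω : Type*} (m : MeasurableSpace Ω) (T : ℝ) (v : ℝ → Ω → ℝ) : Prop :=
  @Measurable (Icc (0 : ℝ) T × Ω) ℝ (Subtype.instMeasurableSpace.prod m) _ fun z => v z.1 z.2

namespace IsJointlyMeasurable

variable {Ω : Type*} {m : MeasurableSpace Ω} {T : ℝ} {v w : ℝ → Ω → ℝ}

lemma add (hv : IsJointlyMeasurable m T v) (hw : IsJointlyMeasurable m T w) :
    IsJointlyMeasurable m T (fun t ω => v t ω + w t ω) := Measurable.add hv hw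

lemma sub (hv : IsJointlyMeasurable m T v) (hw : IsJointlyMeasurable m T w) :
    IsJointlyMeasurable m T (fun t ω => v t ω - w t ω) := Measurable.sub hv hw

lemma mul (hv : IsJointlyMeasurable m T v) (hw : IsJointlyMeasurable m T w) :
    IsJointlyMeasurable m T (fun t ω => v t ω * w t ω) := Measurable.mul hv hw

lemma of_time {g : ℝ → ℝ} (hg : Measurable g) : IsJointlyMeasurable m T (fun t _ => g t) :=
  (hg.comp measurable_subtype_coe).comp measurable_fst

lemma of_space {K : Ω → ℝ} (hK : Measurable K) : IsJointlyMeasurable m T (fun _ => K) :=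
  hK.comp measurable_snd

lemma congr (hv : IsJointlyMeasurable m T v) (h : ∀ t ∈ Icc 0 T, ∀ ω, w t ω = v t ω) :
    IsJointlyMeasurable m T w := by
  have e : (fun z : Icc (0 : ℝ) T × Ω => w z.1 z.2) = fun z => v z.1 z.2 :=
    funext fun z => h _ z.1.2 _
  rw [IsJointlyMeasurable, e]
  exact hv

lemma mono_measurableSpace {m' : MeasurableSpace Ω} (hv : IsJointlyMeasurable m T v)
    (h : m ≤ m') : IsJointlyMeasurable m' T v :=
  Measurable.mono (f := fun z : Icc (0 : ℝ) T × Ω => v z.1 z.2) hv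
    (sup_le_sup_left (MeasurableSpace.comap_mono h) _) le_rfl

/-- Clamping time to [0, T] gives a function that is measurable on all of ℝ × Ω, to which the
results on product spaces apply. -/
lemma measurable_extend (hv : IsJointlyMeasurable m T v) (hT : 0 ≤ T) :
    Measurable fun z : ℝ × Ω => v (projIcc 0 T hT z.1) z.2 :=
  hv.comp (g := fun z : Icc (0 : ℝ) T × Ω => v z.1 z.2)
    (f := fun z : ℝ × Ω => (projIcc 0 T hT z.1, z.2))
    ((continuous_projIcc.measurable.comp measurable_fst).prodMk measurable_snd)

lemma measurable_section (hv : IsJointlyMeasurable m T v) {t : ℝ} (ht : t ∈ Icc 0 T) :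
    Measurable (v t) :=
  hv.comp (g := fun z : Icc (0 : ℝ) T × Ω => v z.1 z.2) (f := fun ω => (⟨t, ht⟩, ω))
    measurable_prodMk_left

lemma measurable_path (hv : IsJointlyMeasurable m T v) (hT : 0 ≤ T) (ω : Ω) :
    Measurable fun s => v (projIcc 0 T hT s) ω :=
  (hv.measurable_extend hT).comp measurable_prodMk_right

lemma aestronglyMeasurable_path (hv : IsJointlyMeasurable m T v) (ω : Ω) :
    AEStronglyMeasurable (fun s => v s ω) (volume.restrict (Icc 0 T)) := by
  by_cases hT : 0 ≤ T
  · refine (hv.measurable_path hT ω).aestronglyMeasurable.congr ?_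
    filter_upwards [ae_restrict_mem measurableSet_Icc] with s hs
    rw [projIcc_of_mem hT hs]
  · simp [Icc_eq_empty hT]

end IsJointlyMeasurable

/-- The moving endpoints become the indicator of a measurable subset of the product, so the integral
is a parameter integral over a fixed space. -/
lemma Measurable.intervalIntegral_prod {α Ω : Type*} [MeasurableSpace α] [MeasurableSpace Ω]
    {V : α → ℝ → ℝ} {a b : α → ℝ} (hV : Measurable (Function.uncurry V)) (ha : Measurable a)
    (hb : Measurable b) : Measurable fun x => ∫ s in a x..b x, V x s := by
  have key : ∀ c d : α → ℝ, Measurable c → Measurable d →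
      Measurable fun x => ∫ s in Ioc (c x) (d x), V x s := by
    intro c d hc hd
    have e : (fun x => ∫ s in Ioc (c x) (d x), V x s)
        = fun x => ∫ s, {z : α × ℝ | c z.1 < z.2 ∧ z.2 ≤ d z.1}.indicator
            (Function.uncurry V) (x, s) := by
      ext x
      rw [← integral_indicator measurableSet_Ioc]
      rfl
    rw [e]
    refine (StronglyMeasurable.integral_prod_right' (f := {z : α × ℝ | c z.1 < z.2 ∧ z.2 ≤ d z.1}.indicator
            (Function.uncurry V)) (Measurable.stronglyMeasurable ?_)).measurable
    refine hV.indicator ?_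
    exact (measurableSet_lt (hc.comp measurable_fst) measurable_snd).inter
      (measurableSet_le measurable_snd (hd.comp measurable_fst))
  exact (key a b ha hb).sub (key b a hb ha)

namespace IsJointlyMeasurable

variable {Ω : Type*} {m : MeasurableSpace Ω} {T : ℝ} {v w : ℝ → Ω → ℝ}

lemma intervalIntegral (hv : IsJointlyMeasurable m T v) {a b : ℝ → ℝ} (ha : Measurable a)
    (hb : Measurable b) (ha' : ∀ t ∈ Icc 0 T, a t ∈ Icc 0 T) (hb' : ∀ t ∈ Icc 0 T, b t ∈ Icc 0 T) :
    IsJointlyMeasurable m T (fun t ω => ∫ s in a t..b t, v s ω) := by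
  by_cases hT : 0 ≤ T
  · have h1 : Measurable fun z : ℝ × Ω =>
        ∫ s in a z.1..b z.1, v (projIcc 0 T hT s) z.2 :=
      Measurable.intervalIntegral_prod (Ω := Ω)
        (V := fun (z : ℝ × Ω) (s : ℝ) => v (projIcc 0 T hT s) z.2)
        ((hv.measurable_extend hT).comp
          (f := fun q : (ℝ × Ω) × ℝ => (q.2, q.1.2))
          (measurable_snd.prodMk (measurable_snd.comp measurable_fst)))
        (ha.comp measurable_fst) (hb.comp measurable_fst)
    have h2 : IsJointlyMeasurable m T fun t ω => ∫ s in a t..b t, v (projIcc 0 T hT s) ω :=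
      h1.comp ((measurable_subtype_coe.comp measurable_fst).prodMk measurable_snd)
    refine h2.congr fun t ht ω => ?_
    refine intervalIntegral.integral_congr fun s hs => ?_
    have : s ∈ Icc 0 T := (uIcc_subset_Icc (ha' t ht) (hb' t ht)) hs
    simp only [projIcc_of_mem hT this]
  · have : IsEmpty (Icc (0 : ℝ) T × Ω) := by
      rw [isEmpty_prod]; left; rw [isEmpty_coe_sort]; exact Icc_eq_empty (by linarith)
    exact measurable_of_empty _

lemma integral_zero_left (hv : IsJointlyMeasurable m T v) :
    IsJointlyMeasurable m T (fun t ω => ∫ s in (0 : ℝ)..t, v s ω) :=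
  hv.intervalIntegral measurable_const measurable_id
    (fun _ ht => ⟨le_rfl, ht.1.trans ht.2⟩) fun _ ht => ht

lemma measurable_intervalIntegral (hv : IsJointlyMeasurable m T v) {a b : ℝ} (ha : a ∈ Icc 0 T)
    (hb : b ∈ Icc 0 T) : Measurable fun ω => ∫ s in a..b, v s ω :=
  (hv.intervalIntegral measurable_const measurable_const (fun _ _ => ha)
    fun _ _ => hb).measurable_section ha

end IsJointlyMeasurable

section Progressive

variable {Ω : Type*} {mΩ : MeasurableSpace Ω} {𝓕 : Filtration ℝ≥0 mΩ} {v w : ℝ → Ω → ℝ}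

lemma isStronglyProgressive_onNonneg_iff :
    IsStronglyProgressive 𝓕 (onNonneg v) ↔ ∀ t : ℝ≥0, IsJointlyMeasurable (𝓕 t) t v := by
  constructor
  · intro h t
    have h1 := h.isProgressive t
    let : MeasurableSpace Ω := 𝓕 t
    exact h1.comp (g := fun q : Iic t × Ω => onNonneg v q.1 q.2)
      (f := fun z : Icc (0 : ℝ) t × Ω => (⟨⟨z.1, z.1.2.1⟩, z.1.2.2⟩, z.2))
      ((Measurable.subtype_mk (Measurable.subtype_mk
        (measurable_subtype_coe.comp measurable_fst))).prodMk measurable_snd)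
  · intro h
    refine IsProgressive.isStronglyProgressive fun t => ?_
    have h1 := h t
    let : MeasurableSpace Ω := 𝓕 t
    exact h1.comp (f := fun q : Iic t × Ω => (⟨(q.1 : ℝ≥0), q.1.1.2, q.1.2⟩, q.2))
      ((Measurable.subtype_mk (measurable_subtype_coe.comp
        (measurable_subtype_coe.comp measurable_fst))).prodMk measurable_snd)

lemma progressive_add (hv : IsStronglyProgressive 𝓕 (onNonneg v))
    (hw : IsStronglyProgressive 𝓕 (onNonneg w)) :
    IsStronglyProgressive 𝓕 (onNonneg fun t ω => v t ω + w t ω) := hv.add hw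

lemma progressive_sub (hv : IsStronglyProgressive 𝓕 (onNonneg v))
    (hw : IsStronglyProgressive 𝓕 (onNonneg w)) :
    IsStronglyProgressive 𝓕 (onNonneg fun t ω => v t ω - w t ω) := hv.sub hw

lemma progressive_mul (hv : IsStronglyProgressive 𝓕 (onNonneg v))
    (hw : IsStronglyProgressive 𝓕 (onNonneg w)) :
    IsStronglyProgressive 𝓕 (onNonneg fun t ω => v t ω * w t ω) := hv.mul hw

lemma progressive_of_time {g : ℝ → ℝ} (hg : Measurable g) :
    IsStronglyProgressive 𝓕 (onNonneg fun t (_ : Ω) => g t) :=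
  isStronglyProgressive_onNonneg_iff.2 fun _ => IsJointlyMeasurable.of_time hg

lemma progressive_integral (hv : IsStronglyProgressive 𝓕 (onNonneg v)) :
    IsStronglyProgressive 𝓕 (onNonneg fun t ω => ∫ s in (0 : ℝ)..t, v s ω) :=
  isStronglyProgressive_onNonneg_iff.2 fun t =>
    (isStronglyProgressive_onNonneg_iff.1 hv t).integral_zero_left

lemma IsJointlyMeasurable.of_progressive (hv : IsStronglyProgressive 𝓕 (onNonneg v)) (T : ℝ) :
    IsJointlyMeasurable mΩ T v := by
  rcases le_or_gt 0 T with hT | hT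
  · exact (isStronglyProgressive_onNonneg_iff.1 hv ⟨T, hT⟩).mono_measurableSpace (𝓕.le _)
  · have : IsEmpty (Icc (0 : ℝ) T × Ω) := by
      rw [isEmpty_prod]; left; rw [isEmpty_coe_sort]; exact Icc_eq_empty (by linarith)
    exact measurable_of_empty _

end Progressive

end JointMeasurability

/-! ### Fubini for dt ⊗ dℙ. -/

section TimeProd

variable {Ω : Type*} {mΩ : MeasurableSpace Ω} {μ : Measure Ω} [IsProbabilityMeasure μ] {T : ℝ}

lemma ae_timeProd_mem : ∀ᵐ z ∂(timeProd μ T), z.1 ∈ Icc 0 T :=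
  Measure.quasiMeasurePreserving_fst.ae (ae_restrict_mem measurableSet_Icc)

instance isFiniteMeasure_timeProd : IsFiniteMeasure (timeProd μ T) := by
  unfold timeProd; infer_instance

lemma ae_ae_of_ae_timeProd {p : ℝ × Ω → Prop} (h : ∀ᵐ z ∂(timeProd μ T), p z) :
    ∀ᵐ ω ∂μ, ∀ᵐ s ∂(volume.restrict (Icc 0 T)), p (s, ω) := by
  have h1 : ∀ᵐ z ∂(μ.prod (volume.restrict (Icc 0 T))), p z.swap := by
    rw [timeProd, ← Measure.prod_swap] at h
    exact ae_of_ae_map measurable_swap.aemeasurable h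
  exact Measure.ae_ae_of_ae_prod h1

lemma integral_timeProd (hT : 0 ≤ T) {f : ℝ × Ω → ℝ} (hf : Integrable f (timeProd μ T)) :
    ∫ z, f z ∂(timeProd μ T) = ∫ ω, (∫ s in (0 : ℝ)..T, f (s, ω)) ∂μ := by
  rw [timeProd] at hf ⊢
  rw [integral_prod_symm f hf]
  simp_rw [intervalIntegral.integral_of_le hT, integral_Icc_eq_integral_Ioc]

lemma integrable_integral_path (hT : 0 ≤ T) {f : ℝ × Ω → ℝ} (hf : Integrable f (timeProd μ T)) :
    Integrable (fun ω => ∫ s in (0 : ℝ)..T, f (s, ω)) μ := by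
  have h := hf.integral_prod_right
  simp_rw [intervalIntegral.integral_of_le hT, ← integral_Icc_eq_integral_Ioc]
  exact h

lemma IsJointlyMeasurable.aestronglyMeasurable {v : ℝ → Ω → ℝ} (hv : IsJointlyMeasurable mΩ T v) :
    AEStronglyMeasurable (fun z : ℝ × Ω => v z.1 z.2) (timeProd μ T) := by
  by_cases hT : 0 ≤ T
  · refine (hv.measurable_extend hT).aestronglyMeasurable.congr ?_
    filter_upwards [ae_timeProd_mem (μ := μ) (T := T)] with z hz
    rw [projIcc_of_mem hT hz]
  · simp [timeProd, Icc_eq_empty hT]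

end TimeProd

/-! ### Square integrable processes. -/

/-- Cauchy–Schwarz in time, obtained by expanding the nonnegative integral of (|f| - a/T)², where
a/T is the mean of |f|. -/
lemma sq_intervalIntegral_abs_le {f : ℝ → ℝ} {T : ℝ} (hT : 0 ≤ T)
    (hf : MemLp f 2 (volume.restrict (Icc 0 T))) :
    (∫ s in (0 : ℝ)..T, |f s|) ^ 2 ≤ T * ∫ s in (0 : ℝ)..T, f s ^ 2 := by
  rcases hT.eq_or_lt with rfl | hT'
  · simp
  simp_rw [intervalIntegral.integral_of_le hT, ← integral_Icc_eq_integral_Ioc]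
  set a := ∫ s in Icc 0 T, |f s|
  have h1 : Integrable (fun s => |f s|) (volume.restrict (Icc 0 T)) :=
    (hf.integrable one_le_two).abs
  have h0 : 0 ≤ ∫ s in Icc 0 T, (|f s| - a / T) ^ 2 := integral_nonneg fun _ => sq_nonneg _
  have e : (fun s => (|f s| - a / T) ^ 2)
      = fun s => (f s ^ 2 - 2 * (a / T) * |f s|) + (a / T) ^ 2 := by
    ext s; rw [sub_sq, sq_abs]; ring
  have h2 : Integrable (fun s => f s ^ 2 - 2 * (a / T) * |f s|) (volume.restrict (Icc 0 T)) :=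
    hf.integrable_sq.sub (h1.const_mul _)
  rw [e, integral_add h2 (integrable_const _),
    integral_sub hf.integrable_sq (h1.const_mul _), integral_const_mul] at h0
  simp only [integral_const, MeasurableSet.univ, measureReal_restrict_apply, univ_inter,
    Real.volume_real_Icc_of_le hT, sub_zero, smul_eq_mul] at h0
  have : T * (a / T) ^ 2 = a ^ 2 / T := by field_simp
  rw [this] at h0
  have h3 : 2 * (a / T) * a = 2 * (a ^ 2 / T) := by ring
  rw [h3] at h0
  have h4 : a ^ 2 / T ≤ ∫ s in Icc 0 T, f s ^ 2 := by linarith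
  rw [div_le_iff₀ hT'] at h4
  linarith

/-- Processes that are jointly measurable and square integrable for `dt ⊗ dℙ` on `[0, T] × Ω`. -/
structure IsSqIntegrable {Ω : Type*} [mΩ : MeasurableSpace Ω] (μ : Measure Ω) (T : ℝ)
    (v : ℝ → Ω → ℝ) : Prop where
  meas : IsJointlyMeasurable mΩ T v
  memLp : MemLp (fun z : ℝ × Ω => v z.1 z.2) 2 (timeProd μ T)

namespace IsSqIntegrable

variable {Ω : Type*} {mΩ : MeasurableSpace Ω} {μ : Measure Ω} [IsProbabilityMeasure μ] {T : ℝ}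
  {v w : ℝ → Ω → ℝ}

lemma add (hv : IsSqIntegrable μ T v) (hw : IsSqIntegrable μ T w) :
    IsSqIntegrable μ T (fun t ω => v t ω + w t ω) :=
  ⟨hv.meas.add hw.meas, hv.memLp.add hw.memLp⟩

lemma sub (hv : IsSqIntegrable μ T v) (hw : IsSqIntegrable μ T w) :
    IsSqIntegrable μ T (fun t ω => v t ω - w t ω) :=
  ⟨hv.meas.sub hw.meas, hv.memLp.sub hw.memLp⟩

lemma time_mul (hv : IsSqIntegrable μ T v) {g : ℝ → ℝ} (hg : Continuous g) :
    IsSqIntegrable μ T (fun t ω => g t * v t ω) := by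
  have hm := (IsJointlyMeasurable.of_time hg.measurable (m := mΩ) (T := T)).mul hv.meas
  obtain ⟨C, hC⟩ := isCompact_Icc.exists_bound_of_continuousOn (s := Icc 0 T) hg.continuousOn
  refine ⟨hm, MemLp.of_le_mul (c := C) hv.memLp hm.aestronglyMeasurable ?_⟩
  filter_upwards [ae_timeProd_mem (μ := μ) (T := T)] with z hz
  rw [norm_mul]
  exact mul_le_mul_of_nonneg_right (hC _ hz) (norm_nonneg _)

lemma const_mul (hv : IsSqIntegrable μ T v) (c : ℝ) :
    IsSqIntegrable μ T (fun t ω => c * v t ω) := hv.time_mul continuous_const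

lemma of_space {K : Ω → ℝ} (hK : Measurable K) (hK2 : MemLp K 2 μ) :
    IsSqIntegrable μ T (fun _ => K) :=
  ⟨IsJointlyMeasurable.of_space hK, MemLp.comp_snd hK2 (volume.restrict (Icc 0 T))⟩

lemma of_time {g : ℝ → ℝ} (hg : Continuous g) : IsSqIntegrable μ T (fun t (_ : Ω) => g t) := by
  have h := (of_space (μ := μ) (T := T) (measurable_const (a := (1 : ℝ))) (memLp_const 1)).time_mul
    hg
  simpa using h

lemma congr (hv : IsSqIntegrable μ T v) (h : ∀ t ∈ Icc 0 T, ∀ ω, w t ω = v t ω) :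
    IsSqIntegrable μ T w := by
  refine ⟨hv.meas.congr h, hv.memLp.ae_eq ?_⟩
  filter_upwards [ae_timeProd_mem (μ := μ) (T := T)] with z hz
  exact (h _ hz _).symm

lemma integrable_mul (hv : IsSqIntegrable μ T v) (hw : IsSqIntegrable μ T w) :
    Integrable (fun z : ℝ × Ω => v z.1 z.2 * w z.1 z.2) (timeProd μ T) :=
  hv.memLp.integrable_mul hw.memLp

lemma integrable_sq (hv : IsSqIntegrable μ T v) :
    Integrable (fun z : ℝ × Ω => v z.1 z.2 ^ 2) (timeProd μ T) := hv.memLp.integrable_sq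

lemma ae_memLp_path (hv : IsSqIntegrable μ T v) :
    ∀ᵐ ω ∂μ, MemLp (fun s => v s ω) 2 (volume.restrict (Icc 0 T)) := by
  filter_upwards [hv.integrable_sq.prod_left_ae] with ω hω
  exact (memLp_two_iff_integrable_sq (hv.meas.aestronglyMeasurable_path ω)).2 hω

lemma ae_memLp_section (hv : IsSqIntegrable μ T v) :
    ∀ᵐ t ∂(volume.restrict (Icc 0 T)), MemLp (v t) 2 μ := by
  filter_upwards [hv.integrable_sq.prod_right_ae, ae_restrict_mem measurableSet_Icc] with t h ht
  exact (memLp_two_iff_integrable_sq (hv.meas.measurable_section ht).aestronglyMeasurable).2 h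

end IsSqIntegrable

lemma MeasureTheory.MemLp.intervalIntegrable_of_Icc {f : ℝ → ℝ} {T a b : ℝ}
    (hf : MemLp f 2 (volume.restrict (Icc 0 T))) (ha : a ∈ Icc 0 T) (hb : b ∈ Icc 0 T) :
    IntervalIntegrable f volume a b := by
  have h : IntegrableOn f (Icc 0 T) := hf.integrable one_le_two
  exact (h.mono_set (uIcc_subset_Icc ha hb)).intervalIntegrable

namespace IsSqIntegrable

variable {Ω : Type*} {mΩ : MeasurableSpace Ω} {μ : Measure Ω} [IsProbabilityMeasure μ] {T : ℝ}
  {v w : ℝ → Ω → ℝ}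

/-- One random variable dominates the time integrals over all subintervals at once. Its square
integrability (`memLp_integral_abs`) is then inherited by every process built from such integrals.
-/
lemma ae_abs_integral_le (hv : IsSqIntegrable μ T v) :
    ∀ᵐ ω ∂μ, ∀ a ∈ Icc 0 T, ∀ b ∈ Icc 0 T,
      |∫ s in a..b, v s ω| ≤ ∫ s in (0 : ℝ)..T, |v s ω| := by
  filter_upwards [hv.ae_memLp_path] with ω hω a ha b hb
  have hT : 0 ≤ T := ha.1.trans ha.2
  refine (intervalIntegral.norm_integral_le_integral_norm_uIoc (f := fun s => v s ω)).trans ?_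
  simp only [Real.norm_eq_abs]
  rw [intervalIntegral.integral_of_le hT]
  refine setIntegral_mono_set ?_ (ae_of_all _ fun _ => abs_nonneg _) ?_
  · have h : IntegrableOn (fun s => v s ω) (Icc 0 T) := hω.integrable one_le_two
    exact (h.mono_set Ioc_subset_Icc_self).abs
  · exact (Ioc_subset_Ioc (le_min ha.1 hb.1) (max_le ha.2 hb.2)).eventuallyLE

lemma memLp_integral_abs (hv : IsSqIntegrable μ T v) (hT : 0 ≤ T) :
    MemLp (fun ω => ∫ s in (0 : ℝ)..T, |v s ω|) 2 μ := by
  have hm : IsJointlyMeasurable mΩ T fun t ω => |v t ω| := Measurable.abs hv.meas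
  have hm2 := (hm.measurable_intervalIntegral ⟨le_rfl, hT⟩ ⟨hT, le_rfl⟩).aestronglyMeasurable
    (μ := μ)
  refine (memLp_two_iff_integrable_sq hm2).2 ?_
  refine Integrable.mono' ((integrable_integral_path hT hv.integrable_sq).const_mul T)
    (hm2.pow 2) ?_
  filter_upwards [hv.ae_memLp_path] with ω hω
  rw [Real.norm_of_nonneg (sq_nonneg _)]
  exact sq_intervalIntegral_abs_le hT hω

lemma memLp_intervalIntegral (hv : IsSqIntegrable μ T v) {a b : ℝ} (ha : a ∈ Icc 0 T)
    (hb : b ∈ Icc 0 T) : MemLp (fun ω => ∫ s in a..b, v s ω) 2 μ := by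
  refine (hv.memLp_integral_abs (ha.1.trans ha.2)).mono
    (hv.meas.measurable_intervalIntegral ha hb).aestronglyMeasurable ?_
  filter_upwards [hv.ae_abs_integral_le] with ω hω
  exact (hω a ha b hb).trans (le_abs_self _)

lemma intervalIntegral (hv : IsSqIntegrable μ T v) {a b : ℝ → ℝ} (ha : Measurable a)
    (hb : Measurable b) (ha' : ∀ t ∈ Icc 0 T, a t ∈ Icc 0 T) (hb' : ∀ t ∈ Icc 0 T, b t ∈ Icc 0 T) :
    IsSqIntegrable μ T (fun t ω => ∫ s in a t..b t, v s ω) := by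
  have hm := hv.meas.intervalIntegral ha hb ha' hb'
  refine ⟨hm, ?_⟩
  by_cases hT : 0 ≤ T
  · refine (MemLp.comp_snd (hv.memLp_integral_abs hT) (volume.restrict (Icc 0 T))).mono
      hm.aestronglyMeasurable ?_
    have h1 : ∀ᵐ z ∂(timeProd μ T), ∀ a ∈ Icc 0 T, ∀ b ∈ Icc 0 T,
      |∫ s in a..b, v s z.2| ≤ ∫ s in (0 : ℝ)..T, |v s z.2| :=
      Measure.quasiMeasurePreserving_snd.ae hv.ae_abs_integral_le
    filter_upwards [h1, ae_timeProd_mem (μ := μ) (T := T)] with z hz hz'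
    exact (hz _ (ha' _ hz') _ (hb' _ hz')).trans (le_abs_self _)
  · simp [timeProd, Icc_eq_empty hT]

lemma integral_zero_left (hv : IsSqIntegrable μ T v) :
    IsSqIntegrable μ T (fun t ω => ∫ s in (0 : ℝ)..t, v s ω) :=
  hv.intervalIntegral measurable_const measurable_id
    (fun _ ht => ⟨le_rfl, ht.1.trans ht.2⟩) fun _ ht => ht

lemma integral_right (hv : IsSqIntegrable μ T v) :
    IsSqIntegrable μ T (fun t ω => ∫ s in t..T, v s ω) :=
  hv.intervalIntegral measurable_id measurable_const (fun _ ht => ht)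
    fun _ ht => ⟨ht.1.trans ht.2, le_rfl⟩

lemma integral_total (hv : IsSqIntegrable μ T v) :
    IsSqIntegrable μ T (fun _ ω => ∫ s in (0 : ℝ)..T, v s ω) :=
  hv.intervalIntegral measurable_const measurable_const
    (fun _ ht => ⟨le_rfl, ht.1.trans ht.2⟩) fun _ ht => ⟨ht.1.trans ht.2, le_rfl⟩

/-- A quantitative version of the square integrability of time averages. -/
lemma integral_sq_integral_abs_le (hv : IsSqIntegrable μ T v) (hT : 0 ≤ T) :
    ∫ ω, (∫ s in (0 : ℝ)..T, |v s ω|) ^ 2 ∂μ ≤ T * ∫ z, v z.1 z.2 ^ 2 ∂(timeProd μ T) := by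
  rw [integral_timeProd hT hv.integrable_sq, ← integral_const_mul]
  refine integral_mono_ae (hv.memLp_integral_abs hT).integrable_sq
    ((integrable_integral_path hT hv.integrable_sq).const_mul T) ?_
  filter_upwards [hv.ae_memLp_path] with ω hω
  exact sq_intervalIntegral_abs_le hT hω

end IsSqIntegrable

/-! ### Closure properties of admissible rates. -/

section Admissible

variable {Ω : Type*} {mΩ : MeasurableSpace Ω} {μ : Measure Ω} [IsProbabilityMeasure μ] {T : ℝ}
  {𝓕 : Filtration ℝ≥0 mΩ} {v w : ℝ → Ω → ℝ}

/-- Tonelli turns the iterated integral into an integral for dt ⊗ dℙ, which splits admissibility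
into progressive measurability and membership in L². -/
lemma isAdmissible_iff :
    IsAdmissible μ 𝓕 T v ↔ IsStronglyProgressive 𝓕 (onNonneg v) ∧ IsSqIntegrable μ T v := by
  have key : IsStronglyProgressive 𝓕 (onNonneg v) →
      ((∫⁻ ω, ∫⁻ s in Icc 0 T, ENNReal.ofReal (v s ω ^ 2) ∂volume ∂μ < ∞) ↔
        IsSqIntegrable μ T v) := by
    intro hp
    have hm := IsJointlyMeasurable.of_progressive hp T
    have hae := hm.aestronglyMeasurable (μ := μ)
    have e : ∫⁻ ω, ∫⁻ s in Icc 0 T, ENNReal.ofReal (v s ω ^ 2) ∂volume ∂μ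
        = ∫⁻ z, ENNReal.ofReal (v z.1 z.2 ^ 2) ∂(timeProd μ T) := by
      rw [timeProd, lintegral_prod_symm]
      exact (hae.pow 2).aemeasurable.ennreal_ofReal
    rw [e, lt_top_iff_ne_top, lintegral_ofReal_ne_top_iff_integrable
      (f := fun z : ℝ × Ω => v z.1 z.2 ^ 2) (hae.pow 2) (ae_of_all _ fun _ => sq_nonneg _)]
    exact ⟨fun h => ⟨hm, (memLp_two_iff_integrable_sq hae).2 h⟩, fun h => h.integrable_sq⟩
  exact ⟨fun h => ⟨h.progressive, (key h.progressive).1 h.sq_integrable⟩,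
    fun h => ⟨h.1, (key h.1).2 h.2⟩⟩

lemma IsAdmissible.isSqIntegrable (hv : IsAdmissible μ 𝓕 T v) : IsSqIntegrable μ T v :=
  (isAdmissible_iff.1 hv).2

lemma IsAdmissible.add (hv : IsAdmissible μ 𝓕 T v) (hw : IsAdmissible μ 𝓕 T w) :
    IsAdmissible μ 𝓕 T (fun t ω => v t ω + w t ω) :=
  isAdmissible_iff.2 ⟨progressive_add hv.progressive hw.progressive,
    hv.isSqIntegrable.add hw.isSqIntegrable⟩

lemma IsAdmissible.sub (hv : IsAdmissible μ 𝓕 T v) (hw : IsAdmissible μ 𝓕 T w) :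
    IsAdmissible μ 𝓕 T (fun t ω => v t ω - w t ω) :=
  isAdmissible_iff.2 ⟨progressive_sub hv.progressive hw.progressive,
    hv.isSqIntegrable.sub hw.isSqIntegrable⟩

lemma IsAdmissible.time_mul (hv : IsAdmissible μ 𝓕 T v) {g : ℝ → ℝ} (hg : Continuous g) :
    IsAdmissible μ 𝓕 T (fun t ω => g t * v t ω) :=
  isAdmissible_iff.2 ⟨progressive_mul (progressive_of_time hg.measurable) hv.progressive,
    hv.isSqIntegrable.time_mul hg⟩

lemma IsAdmissible.of_time {g : ℝ → ℝ} (hg : Continuous g) :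
    IsAdmissible μ 𝓕 T (fun t (_ : Ω) => g t) :=
  isAdmissible_iff.2 ⟨progressive_of_time hg.measurable, IsSqIntegrable.of_time hg⟩

lemma IsAdmissible.integral_zero_left (hv : IsAdmissible μ 𝓕 T v) :
    IsAdmissible μ 𝓕 T (fun t ω => ∫ s in (0 : ℝ)..t, v s ω) :=
  isAdmissible_iff.2 ⟨progressive_integral hv.progressive, hv.isSqIntegrable.integral_zero_left⟩

end Admissible

/-! ### Calculus of primitives and of the price distortion. -/

section Primitives

/-- Integration by parts for primitives of integrable functions. -/
lemma integral_mul_of_primitive {F G f g : ℝ → ℝ} {a b : ℝ} (hab : a ≤ b)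
    (hf : IntervalIntegrable f volume a b) (hg : IntervalIntegrable g volume a b)
    (hF : ∀ t ∈ Icc a b, F t = F a + ∫ s in a..t, f s)
    (hG : ∀ t ∈ Icc a b, G t = G a + ∫ s in a..t, g s) :
    ∫ t in a..b, F t * g t = F b * G b - F a * G a - ∫ t in a..b, f t * G t := by
  have ac : ∀ {h : ℝ → ℝ} (c : ℝ), IntervalIntegrable h volume a b →
      AbsolutelyContinuousOnInterval (fun t => c + ∫ s in a..t, h s) a b := fun c hh =>
    (LipschitzOnWith.absolutelyContinuousOnInterval (K := 0)
      (LipschitzWith.const c).lipschitzOnWith).add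
      (hh.absolutelyContinuousOnInterval_intervalIntegral left_mem_uIcc)
  have hd : ∀ {h : ℝ → ℝ} (c : ℝ), IntervalIntegrable h volume a b →
      ∀ᵐ t, t ∈ uIoc a b → deriv (fun t => c + ∫ s in a..t, h s) t = h t := fun c hh => by
    filter_upwards [hh.ae_hasDerivAt_integral] with t ht hmem
    exact ((ht (uIoc_subset_uIcc hmem) a left_mem_uIcc).const_add c).deriv
  have h := (ac (F a) hf).integral_mul_deriv_eq_deriv_mul (ac (G a) hg)
  have e1 : ∫ t in a..b, F t * g t
      = ∫ t in a..b, (F a + ∫ s in a..t, f s) * deriv (fun t => G a + ∫ s in a..t, g s) t := by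
    refine intervalIntegral.integral_congr_ae ?_
    filter_upwards [hd (G a) hg] with t ht hmem
    rw [ht hmem, ← hF t]
    rw [uIoc_of_le hab] at hmem
    exact Ioc_subset_Icc_self hmem
  have e2 : ∫ t in a..b, f t * G t
      = ∫ t in a..b, deriv (fun t => F a + ∫ s in a..t, f s) t * (G a + ∫ s in a..t, g s) := by
    refine intervalIntegral.integral_congr_ae ?_
    filter_upwards [hd (F a) hf] with t ht hmem
    rw [ht hmem, ← hG t]
    rw [uIoc_of_le hab] at hmem
    exact Ioc_subset_Icc_self hmem
  rw [e1, e2, h, ← hF b (right_mem_Icc.2 hab), ← hG b (right_mem_Icc.2 hab)]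
  simp

lemma primitive_of_hasDerivAt {F f : ℝ → ℝ} (h : ∀ t, HasDerivAt F (f t) t) (hf : Continuous f)
    (a t : ℝ) : F t = F a + ∫ s in a..t, f s := by
  rw [intervalIntegral.integral_eq_sub_of_hasDerivAt (fun x _ => h x) (hf.intervalIntegrable _ _)]
  ring

/-- Fubini on a triangle, in the form of an integration by parts whose boundary terms vanish. -/
lemma integral_mul_integral_right {f g : ℝ → ℝ} {T : ℝ} (hT : 0 ≤ T)
    (hf : IntervalIntegrable f volume 0 T) (hg : IntervalIntegrable g volume 0 T) :
    ∫ t in (0 : ℝ)..T, f t * (∫ s in t..T, g s)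
      = ∫ t in (0 : ℝ)..T, (∫ s in (0 : ℝ)..t, f s) * g t := by
  have h := integral_mul_of_primitive hT hf hg.neg (F := fun t => ∫ s in (0 : ℝ)..t, f s)
    (G := fun t => ∫ s in t..T, g s) (fun t _ => by simp) (fun t ht => by
      have h1 : IntervalIntegrable g volume 0 t := hg.mono_set (by
        rw [uIcc_of_le ht.1, uIcc_of_le hT]; exact Icc_subset_Icc_right ht.2)
      have h2 : IntervalIntegrable g volume t T := hg.mono_set (by
        rw [uIcc_of_le ht.2, uIcc_of_le hT]; exact Icc_subset_Icc_left ht.1)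
      simp only [Pi.neg_apply, intervalIntegral.integral_neg]
      rw [← intervalIntegral.integral_add_adjacent_intervals h1 h2]
      ring)
  simp only [Pi.neg_apply, mul_neg, intervalIntegral.integral_neg,
    intervalIntegral.integral_same, mul_zero, zero_mul, sub_zero, zero_sub] at h
  linarith

/-- The path of the price distortion generated by a rate `g`, started at `y`. -/
noncomputable def distortionPath (ρ γ y : ℝ) (g : ℝ → ℝ) (t : ℝ) : ℝ :=
  Real.exp (-ρ * t) * y + γ * ∫ s in (0 : ℝ)..t, Real.exp (-ρ * (t - s)) * g s

/-- Pulling e^{-ρt} out of the convolution leaves a primitive of a fixed integrable function.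
Continuity, linearity and measurability are read off from this form. -/
lemma distortionPath_eq (ρ γ y : ℝ) (g : ℝ → ℝ) (t : ℝ) : distortionPath ρ γ y g t
    = (y + ∫ s in (0 : ℝ)..t, γ * Real.exp (ρ * s) * g s) * Real.exp (-ρ * t) := by
  have e : ∀ s, Real.exp (-ρ * (t - s)) * g s = Real.exp (-ρ * t) * (Real.exp (ρ * s) * g s) := by
    intro s
    rw [← mul_assoc, ← Real.exp_add]; congr 2; ring
  simp_rw [distortionPath, e, mul_assoc, intervalIntegral.integral_const_mul]
  ring

lemma distortionPath_zero (ρ γ y : ℝ) (g : ℝ → ℝ) : distortionPath ρ γ y g 0 = y := by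
  simp [distortionPath]

variable {ρ γ y T : ℝ} {g : ℝ → ℝ}

lemma intervalIntegrable_sub_Icc {f : ℝ → ℝ} {a b c : ℝ} (hab : a ≤ b)
    (hf : IntervalIntegrable f volume a b) (hc : c ∈ Icc a b) :
    IntervalIntegrable f volume a c ∧ IntervalIntegrable f volume c b :=
  ⟨hf.mono_set (by rw [uIcc_of_le hc.1, uIcc_of_le hab]; exact Icc_subset_Icc_right hc.2),
    hf.mono_set (by rw [uIcc_of_le hc.2, uIcc_of_le hab]; exact Icc_subset_Icc_left hc.1)⟩

lemma continuousOn_integral {f : ℝ → ℝ} (hT : 0 ≤ T) (hf : IntervalIntegrable f volume 0 T) :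
    ContinuousOn (fun t => ∫ s in (0 : ℝ)..t, f s) (Icc 0 T) := by
  have h := intervalIntegral.continuousOn_primitive_interval (μ := volume) (f := f) (a := 0) (b := T)
    (by rw [uIcc_of_le hT]; exact (intervalIntegrable_iff_integrableOn_Icc_of_le hT).1 hf)
  rwa [uIcc_of_le hT] at h

lemma intervalIntegrable_exp_mul {f : ℝ → ℝ} {a b : ℝ} (hf : IntervalIntegrable f volume a b)
    (c k : ℝ) : IntervalIntegrable (fun s => c * Real.exp (k * s) * f s) volume a b :=
  hf.continuousOn_mul (by fun_prop)

lemma continuousOn_distortionPath (hT : 0 ≤ T) (hg : IntervalIntegrable g volume 0 T) :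
    ContinuousOn (distortionPath ρ γ y g) (Icc 0 T) := by
  have h := continuousOn_integral hT (intervalIntegrable_exp_mul hg γ ρ)
  have e : distortionPath ρ γ y g = fun t =>
      (y + ∫ s in (0 : ℝ)..t, γ * Real.exp (ρ * s) * g s) * Real.exp (-ρ * t) :=
    funext (distortionPath_eq ρ γ y g)
  rw [e]
  exact (continuousOn_const.add h).mul (by fun_prop)

lemma intervalIntegrable_of_continuousOn_Icc {f : ℝ → ℝ} (hT : 0 ≤ T)
    (hf : ContinuousOn f (Icc 0 T)) : IntervalIntegrable f volume 0 T :=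
  ContinuousOn.intervalIntegrable (by rwa [uIcc_of_le hT])

/-- Product rule for the two factors in `distortionPath_eq`. -/
lemma distortionPath_ode (hg : IntervalIntegrable g volume 0 T) {t : ℝ} (ht : t ∈ Icc 0 T) :
    distortionPath ρ γ y g t
      = y + ∫ s in (0 : ℝ)..t, (-ρ * distortionPath ρ γ y g s + γ * g s) := by
  have hT : 0 ≤ T := ht.1.trans ht.2
  have hgt := (intervalIntegrable_sub_Icc hT hg ht).1
  have hi := intervalIntegrable_exp_mul hgt γ ρ
  have hexp : ∀ s, HasDerivAt (fun s => Real.exp (-ρ * s)) (-ρ * Real.exp (-ρ * s)) s := fun s => by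
    have := ((hasDerivAt_id s).const_mul (-ρ)).exp
    simp only [id, mul_one] at this
    rw [mul_comm]; exact this
  have h := integral_mul_of_primitive ht.1 hi
    ((by fun_prop : Continuous fun s => -ρ * Real.exp (-ρ * s)).intervalIntegrable 0 t)
    (F := fun t => y + ∫ s in (0 : ℝ)..t, γ * Real.exp (ρ * s) * g s)
    (G := fun t => Real.exp (-ρ * t)) (fun s _ => by simp)
    (fun s _ => primitive_of_hasDerivAt hexp (by fun_prop) 0 s)
  have e1 : ∫ s in (0 : ℝ)..t, (y + ∫ u in (0 : ℝ)..s, γ * Real.exp (ρ * u) * g u)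
      * (-ρ * Real.exp (-ρ * s)) = ∫ s in (0 : ℝ)..t, -ρ * distortionPath ρ γ y g s := by
    refine intervalIntegral.integral_congr fun s _ => ?_
    simp only [distortionPath_eq]; ring
  have e2 : ∫ s in (0 : ℝ)..t, γ * Real.exp (ρ * s) * g s * Real.exp (-ρ * s)
      = ∫ s in (0 : ℝ)..t, γ * g s := by
    refine intervalIntegral.integral_congr fun s _ => ?_
    have : Real.exp (ρ * s) * Real.exp (-ρ * s) = 1 := by rw [← Real.exp_add]; simp
    linear_combination γ * g s * this
  rw [e1, e2] at h
  rw [intervalIntegral.integral_add, distortionPath_eq]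
  · simp only [mul_zero, Real.exp_zero, intervalIntegral.integral_same, mul_one, add_zero] at h
    linarith
  · exact (intervalIntegrable_of_continuousOn_Icc ht.1 (continuousOn_distortionPath ht.1 hgt)).const_mul _
  · exact hgt.const_mul _

/-- The linear equation of the price distortion has a unique solution. No regularity is assumed:
a solution is automatically integrable. -/
lemma eq_distortionPath_of_ode (hg : IntervalIntegrable g volume 0 T) {Y : ℝ → ℝ}
    (hY : ∀ t ∈ Icc 0 T, Y t = y + ∫ s in (0 : ℝ)..t, (-ρ * Y s + γ * g s)) :
    ∀ t ∈ Icc 0 T, Y t = distortionPath ρ γ y g t := by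
  intro t₀ ht₀
  have hT : 0 ≤ T := ht₀.1.trans ht₀.2
  have hDc := continuousOn_distortionPath (ρ := ρ) (γ := γ) (y := y) hT hg
  set D := distortionPath ρ γ y g with hD
  set h : ℝ → ℝ := fun s => -ρ * Y s + γ * g s with hh
  -- While the right-hand side is integrable, E = Y - D satisfies E' = -ρE and E(0) = 0. Integrating
  -- E against ρe^{ρs} by parts gives E(t)e^{ρt} = 0.
  have main : ∀ t ∈ Icc 0 T, IntervalIntegrable h volume 0 t → Y t = D t := by
    intro t ht hint
    have hgt := (intervalIntegrable_sub_Icc hT hg ht).1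
    have hE : ∀ s ∈ Icc 0 t, (Y s - D s) = (Y 0 - D 0) + ∫ u in (0 : ℝ)..s, -ρ * (Y u - D u) := by
      intro s hs
      have hsT : s ∈ Icc 0 T := ⟨hs.1, hs.2.trans ht.2⟩
      have h1 := (intervalIntegrable_sub_Icc ht.1 hint hs).1
      have h2 := (intervalIntegrable_sub_Icc ht.1 hgt hs).1
      have h3 := intervalIntegrable_of_continuousOn_Icc hs.1
        (hDc.mono (Icc_subset_Icc_right hsT.2))
      rw [hY s hsT, hD, distortionPath_ode hg hsT, distortionPath_zero,
        hY 0 ⟨le_rfl, hT⟩, add_sub_add_left_eq_sub, ← intervalIntegral.integral_sub h1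
          ((h3.const_mul _).add (h2.const_mul _))]
      simp only [intervalIntegral.integral_same, add_zero, sub_self, zero_add]
      refine intervalIntegral.integral_congr fun u _ => ?_
      ring
    have hD3 := intervalIntegrable_of_continuousOn_Icc ht.1 (hDc.mono (Icc_subset_Icc_right ht.2))
    have hEint : IntervalIntegrable (fun s => -ρ * (Y s - D s)) volume 0 t := by
      have h1 := (hint.sub (hgt.const_mul γ)).sub (hD3.const_mul (-ρ))
      refine h1.congr fun s _ => ?_
      simp only [hh]; ring
    have hexp : ∀ s, HasDerivAt (fun s => Real.exp (ρ * s)) (ρ * Real.exp (ρ * s)) s := fun s => by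
      have := ((hasDerivAt_id s).const_mul ρ).exp
      simp only [id, mul_one] at this
      rw [mul_comm]; exact this
    have ibp := integral_mul_of_primitive ht.1 hEint
      ((by fun_prop : Continuous fun s => ρ * Real.exp (ρ * s)).intervalIntegrable 0 t)
      hE (fun s _ => primitive_of_hasDerivAt hexp (by fun_prop) 0 s)
    have e : ∫ s in (0 : ℝ)..t, -ρ * (Y s - D s) * Real.exp (ρ * s)
        = -∫ s in (0 : ℝ)..t, (Y s - D s) * (ρ * Real.exp (ρ * s)) := by
      rw [← intervalIntegral.integral_neg]
      refine intervalIntegral.integral_congr fun s _ => ?_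
      ring
    have h0 : Y 0 - D 0 = 0 := by
      rw [hY 0 ⟨le_rfl, hT⟩, hD, distortionPath_zero]; simp
    rw [e, h0] at ibp
    have : (Y t - D t) * Real.exp (ρ * t) = 0 := by linarith
    have := (mul_eq_zero.1 this).resolve_right (Real.exp_pos _).ne'
    linarith
  refine main t₀ ht₀ ?_
  -- These times form an interval. Outside it the integral in `hY` takes its default value 0, so Y
  -- equals y there; inside it Y equals D. Thus Y is integrable on all of [0, T], and therefore so
  -- is `h`.
  set S : Set ℝ := {t | t ∈ Icc 0 T ∧ IntervalIntegrable h volume 0 t} with hS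
  have hSord : S.OrdConnected := ⟨fun a ha b hb c hc =>
    ⟨⟨ha.1.1.trans hc.1, hc.2.trans hb.1.2⟩,
      (intervalIntegrable_sub_Icc hb.1.1 hb.2 ⟨ha.1.1.trans hc.1, hc.2⟩).1⟩⟩
  have hSm : MeasurableSet S := hSord.measurableSet
  have hYeq : ∀ t ∈ Icc 0 T, Y t = S.indicator D t + Sᶜ.indicator (fun _ => y) t := by
    intro t ht
    by_cases hts : t ∈ S
    · simp [hts, main t ht hts.2]
    · have : ¬ IntervalIntegrable h volume 0 t := fun hi => hts ⟨ht, hi⟩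
      rw [hY t ht]
      simp [hts, intervalIntegral.integral_undef this]
  have hYint : IntegrableOn Y (Icc 0 T) := by
    have h1 : IntegrableOn (fun t => S.indicator D t + Sᶜ.indicator (fun _ => y) t) (Icc 0 T) :=
      (hDc.integrableOn_Icc.indicator hSm).add ((integrable_const y).indicator hSm.compl)
    exact h1.congr_fun (fun t ht => (hYeq t ht).symm) measurableSet_Icc
  have hYi := (intervalIntegrable_iff_integrableOn_Icc_of_le hT).2 hYint
  exact (intervalIntegrable_sub_Icc hT ((hYi.const_mul (-ρ)).add (hg.const_mul γ)) ht₀).1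

/-- The transient impact of a trading flow against itself is nonnegative. -/
lemma integral_mul_distortionPath_nonneg (hT : 0 ≤ T) (hρ : 0 ≤ ρ) (hγ : 0 < γ)
    (hg : IntervalIntegrable g volume 0 T) :
    0 ≤ ∫ t in (0 : ℝ)..T, g t * distortionPath ρ γ 0 g t := by
  have hDc := continuousOn_distortionPath (ρ := ρ) (γ := γ) (y := 0) hT hg
  have hode : ∀ t ∈ Icc 0 T, distortionPath ρ γ 0 g t = distortionPath ρ γ 0 g 0
      + ∫ s in (0 : ℝ)..t, (-ρ * distortionPath ρ γ 0 g s + γ * g s) := fun t ht => by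
    rw [distortionPath_zero]; exact distortionPath_ode hg ht
  set D := distortionPath ρ γ 0 g with hD
  have hDi := intervalIntegrable_of_continuousOn_Icc hT hDc
  have hi : IntervalIntegrable (fun s => -ρ * D s + γ * g s) volume 0 T :=
    (hDi.const_mul _).add (hg.const_mul _)
  -- Integrating D against its own derivative gives D(T)² = 2 ∫ D D', hence γ ∫ g D = D(T)²/2 + ρ ∫
  -- D².
  have h := integral_mul_of_primitive hT hi hi hode hode
  have hgD : IntervalIntegrable (fun t => g t * D t) volume 0 T :=
    hg.mul_continuousOn (by rwa [uIcc_of_le hT])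
  have hDD : IntervalIntegrable (fun t => D t ^ 2) volume 0 T :=
    intervalIntegrable_of_continuousOn_Icc hT (hDc.pow 2)
  have e1 : ∫ t in (0 : ℝ)..T, D t * (-ρ * D t + γ * g t)
      = -ρ * (∫ t in (0 : ℝ)..T, D t ^ 2) + γ * ∫ t in (0 : ℝ)..T, g t * D t := by
    rw [← intervalIntegral.integral_const_mul, ← intervalIntegral.integral_const_mul,
      ← intervalIntegral.integral_add (hDD.const_mul _) (hgD.const_mul _)]
    refine intervalIntegral.integral_congr fun t _ => ?_
    ring
  have e2 : ∫ t in (0 : ℝ)..T, (-ρ * D t + γ * g t) * D t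
      = ∫ t in (0 : ℝ)..T, D t * (-ρ * D t + γ * g t) :=
    intervalIntegral.integral_congr fun t _ => mul_comm _ _
  have h0 : D 0 = 0 := distortionPath_zero _ _ _ _
  rw [e2, e1, h0] at h
  have hsq : 0 ≤ ∫ t in (0 : ℝ)..T, D t ^ 2 :=
    intervalIntegral.integral_nonneg hT fun _ _ => sq_nonneg _
  have : 0 ≤ γ * ∫ t in (0 : ℝ)..T, g t * D t := by nlinarith [sq_nonneg (D T)]
  exact nonneg_of_mul_nonneg_right this hγ

end Primitives

/-! ### Pathwise payoff, its derivative and its quadratic cost. -/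

section PathFunctionals

/-- The pathwise payoff of the rate `v` at prices `S`, started from `x`, with terminal price `c`. -/
noncomputable def payoffPath (p : ImpactParams) (S : ℝ → ℝ) (x c : ℝ) (v : ℝ → ℝ) : ℝ :=
  (∫ t in (0 : ℝ)..p.T, S t * v t) - p.lam * (∫ t in (0 : ℝ)..p.T, v t ^ 2)
    - p.φ * (∫ t in (0 : ℝ)..p.T, (x - ∫ s in (0 : ℝ)..t, v s) ^ 2)
    + (x - ∫ s in (0 : ℝ)..p.T, v s) * (c - p.ϱ * (x - ∫ s in (0 : ℝ)..p.T, v s))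

/-- The pathwise derivative of the payoff in the direction of trading at time `t`. -/
noncomputable def marginalPath (p : ImpactParams) (S : ℝ → ℝ) (x c : ℝ) (v : ℝ → ℝ) (t : ℝ) : ℝ :=
  S t - 2 * p.lam * v t + 2 * p.φ * (∫ s in t..p.T, (x - ∫ u in (0 : ℝ)..s, v u)) - c
    + 2 * p.ϱ * (x - ∫ s in (0 : ℝ)..p.T, v s)

/-- The quadratic cost of the rate `w`. -/
noncomputable def costPath (p : ImpactParams) (w : ℝ → ℝ) : ℝ :=
  p.lam * (∫ t in (0 : ℝ)..p.T, w t ^ 2)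
    + p.φ * (∫ t in (0 : ℝ)..p.T, (∫ s in (0 : ℝ)..t, w s) ^ 2)
    + p.ϱ * (∫ s in (0 : ℝ)..p.T, w s) ^ 2

variable {p : ImpactParams} {S v w : ℝ → ℝ} {x c : ℝ}

lemma intervalIntegrable_mul_of_memLp {T : ℝ} (hT : 0 ≤ T)
    (hv : MemLp v 2 (volume.restrict (Icc 0 T))) (hw : MemLp w 2 (volume.restrict (Icc 0 T))) :
    IntervalIntegrable (fun t => v t * w t) volume 0 T :=
  (intervalIntegrable_iff_integrableOn_Icc_of_le hT).2 (hv.integrable_mul hw)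

lemma intervalIntegrable_sq_of_memLp {T : ℝ} (hT : 0 ≤ T)
    (hv : MemLp v 2 (volume.restrict (Icc 0 T))) :
    IntervalIntegrable (fun t => v t ^ 2) volume 0 T :=
  (intervalIntegrable_iff_integrableOn_Icc_of_le hT).2 hv.integrable_sq

lemma intervalIntegrable_of_memLp {T : ℝ} (hT : 0 ≤ T)
    (hv : MemLp v 2 (volume.restrict (Icc 0 T))) : IntervalIntegrable v volume 0 T :=
  hv.intervalIntegrable_of_Icc ⟨le_rfl, hT⟩ ⟨hT, le_rfl⟩

lemma continuousOn_inventoryPath {T : ℝ} (hT : 0 ≤ T) (hv : IntervalIntegrable v volume 0 T) :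
    ContinuousOn (fun t => x - ∫ s in (0 : ℝ)..t, v s) (Icc 0 T) :=
  continuousOn_const.sub (continuousOn_integral hT hv)

/-- Exchanging the two time integrals in the inventory term shows that pairing with `marginalPath`
is the directional derivative of the payoff along `w`. -/
lemma integral_mul_marginalPath (hS : MemLp S 2 (volume.restrict (Icc 0 p.T)))
    (hv : MemLp v 2 (volume.restrict (Icc 0 p.T))) (hw : MemLp w 2 (volume.restrict (Icc 0 p.T))) :
    ∫ t in (0 : ℝ)..p.T, w t * marginalPath p S x c v t
      = (∫ t in (0 : ℝ)..p.T, S t * w t) - 2 * p.lam * (∫ t in (0 : ℝ)..p.T, v t * w t)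
        + 2 * p.φ * (∫ t in (0 : ℝ)..p.T,
            (∫ s in (0 : ℝ)..t, w s) * (x - ∫ s in (0 : ℝ)..t, v s))
        - (∫ s in (0 : ℝ)..p.T, w s) * (c - 2 * p.ϱ * (x - ∫ s in (0 : ℝ)..p.T, v s)) := by
  have hT := p.T_pos.le
  have hvi := intervalIntegrable_of_memLp hT hv
  have hwi := intervalIntegrable_of_memLp hT hw
  have hX := intervalIntegrable_of_continuousOn_Icc hT (continuousOn_inventoryPath (x := x) hT hvi)
  rw [← integral_mul_integral_right hT hwi hX]
  have hSw := intervalIntegrable_mul_of_memLp hT hS hw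
  have hvw := intervalIntegrable_mul_of_memLp hT hv hw
  have hcX : ContinuousOn (fun t => ∫ s in t..p.T, (x - ∫ u in (0 : ℝ)..s, v u)) (Icc 0 p.T) := by
    have h := continuousOn_const (c := ∫ s in (0 : ℝ)..p.T, (x - ∫ u in (0 : ℝ)..s, v u)) |>.sub
      (continuousOn_integral hT hX)
    refine h.congr fun t ht => ?_
    have h2 := intervalIntegrable_sub_Icc hT hX ht
    rw [← intervalIntegral.integral_add_adjacent_intervals h2.1 h2.2]
    simp
  have hwX : IntervalIntegrable
      (fun t => w t * ∫ s in t..p.T, (x - ∫ u in (0 : ℝ)..s, v u)) volume 0 p.T :=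
    hwi.mul_continuousOn (by rwa [uIcc_of_le hT])
  rw [← intervalIntegral.integral_const_mul, ← intervalIntegral.integral_const_mul,
    ← intervalIntegral.integral_mul_const, ← intervalIntegral.integral_sub hSw (hvw.const_mul _),
    ← intervalIntegral.integral_add (hSw.sub (hvw.const_mul _)) (hwX.const_mul _),
    ← intervalIntegral.integral_sub ((hSw.sub (hvw.const_mul _)).add (hwX.const_mul _))
      (hwi.mul_const _)]
  refine intervalIntegral.integral_congr fun t _ => ?_
  simp only [marginalPath]
  ring

/-- The payoff is quadratic, so its Taylor expansion stops after second order. That remainder is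
exactly `costPath`, which is where concavity comes from. -/
lemma payoffPath_add (hS : MemLp S 2 (volume.restrict (Icc 0 p.T)))
    (hv : MemLp v 2 (volume.restrict (Icc 0 p.T))) (hw : MemLp w 2 (volume.restrict (Icc 0 p.T))) :
    payoffPath p S x c (fun t => v t + w t) = payoffPath p S x c v
      + (∫ t in (0 : ℝ)..p.T, w t * marginalPath p S x c v t) - costPath p w := by
  have hT := p.T_pos.le
  rw [integral_mul_marginalPath hS hv hw]
  have hvi := intervalIntegrable_of_memLp hT hv
  have hwi := intervalIntegrable_of_memLp hT hw
  have hSw := intervalIntegrable_mul_of_memLp hT hS hw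
  have hSv := intervalIntegrable_mul_of_memLp hT hS hv
  have hvw := intervalIntegrable_mul_of_memLp hT hv hw
  have hvv := intervalIntegrable_sq_of_memLp hT hv
  have hww := intervalIntegrable_sq_of_memLp hT hw
  have hcX := continuousOn_inventoryPath (x := x) hT hvi
  have hcW := continuousOn_integral hT hwi
  have e0 : ∀ t ∈ Icc 0 p.T, ∫ s in (0 : ℝ)..t, (v s + w s)
      = (∫ s in (0 : ℝ)..t, v s) + ∫ s in (0 : ℝ)..t, w s := fun t ht =>
    intervalIntegral.integral_add (intervalIntegrable_sub_Icc hT hvi ht).1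
      (intervalIntegrable_sub_Icc hT hwi ht).1
  have e1 : ∫ t in (0 : ℝ)..p.T, S t * (v t + w t)
      = (∫ t in (0 : ℝ)..p.T, S t * v t) + ∫ t in (0 : ℝ)..p.T, S t * w t := by
    rw [← intervalIntegral.integral_add hSv hSw]
    exact intervalIntegral.integral_congr fun t _ => by ring
  have e2 : ∫ t in (0 : ℝ)..p.T, (v t + w t) ^ 2
      = (∫ t in (0 : ℝ)..p.T, v t ^ 2) + 2 * (∫ t in (0 : ℝ)..p.T, v t * w t)
        + ∫ t in (0 : ℝ)..p.T, w t ^ 2 := by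
    rw [← intervalIntegral.integral_const_mul, ← intervalIntegral.integral_add hvv
      (hvw.const_mul _), ← intervalIntegral.integral_add (hvv.add (hvw.const_mul _)) hww]
    exact intervalIntegral.integral_congr fun t _ => by ring
  have e3 : ∫ t in (0 : ℝ)..p.T, (x - ∫ s in (0 : ℝ)..t, (v s + w s)) ^ 2
      = (∫ t in (0 : ℝ)..p.T, (x - ∫ s in (0 : ℝ)..t, v s) ^ 2)
        - 2 * (∫ t in (0 : ℝ)..p.T,
            (∫ s in (0 : ℝ)..t, w s) * (x - ∫ s in (0 : ℝ)..t, v s))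
        + ∫ t in (0 : ℝ)..p.T, (∫ s in (0 : ℝ)..t, w s) ^ 2 := by
    have i1 : IntervalIntegrable (fun t => (x - ∫ s in (0 : ℝ)..t, v s) ^ 2) volume 0 p.T :=
      intervalIntegrable_of_continuousOn_Icc hT (hcX.pow 2)
    have i2 : IntervalIntegrable (fun t => (∫ s in (0 : ℝ)..t, w s)
        * (x - ∫ s in (0 : ℝ)..t, v s)) volume 0 p.T :=
      intervalIntegrable_of_continuousOn_Icc hT (hcW.mul hcX)
    have i3 : IntervalIntegrable (fun t => (∫ s in (0 : ℝ)..t, w s) ^ 2) volume 0 p.T :=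
      intervalIntegrable_of_continuousOn_Icc hT (hcW.pow 2)
    rw [← intervalIntegral.integral_const_mul, ← intervalIntegral.integral_sub i1
      (i2.const_mul _), ← intervalIntegral.integral_add (i1.sub (i2.const_mul _)) i3]
    refine intervalIntegral.integral_congr fun t ht => ?_
    rw [uIcc_of_le hT] at ht
    simp only [e0 t ht]
    ring
  simp only [payoffPath, costPath, e1, e2, e3, e0 _ ⟨hT, le_rfl⟩]
  ring

/-- The derivative of the payoff is dissipative: this is the pathwise source of uniqueness. -/
lemma integral_mul_marginalPath_self_le (hw : MemLp w 2 (volume.restrict (Icc 0 p.T))) {D : ℝ → ℝ}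
    (hD : MemLp D 2 (volume.restrict (Icc 0 p.T)))
    (hDw : 0 ≤ ∫ t in (0 : ℝ)..p.T, w t * D t) :
    ∫ t in (0 : ℝ)..p.T, w t * marginalPath p (fun t => -p.κ * D t) 0 0 w t
      ≤ -(2 * p.lam) * ∫ t in (0 : ℝ)..p.T, w t ^ 2 := by
  have hT := p.T_pos.le
  rw [integral_mul_marginalPath (hD.const_mul _) hw hw]
  have e1 : ∫ t in (0 : ℝ)..p.T, -p.κ * D t * w t = -p.κ * ∫ t in (0 : ℝ)..p.T, w t * D t := by
    rw [← intervalIntegral.integral_const_mul]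
    exact intervalIntegral.integral_congr fun t _ => by ring
  have e2 : ∫ t in (0 : ℝ)..p.T, w t * w t = ∫ t in (0 : ℝ)..p.T, w t ^ 2 :=
    intervalIntegral.integral_congr fun t _ => by ring
  have e3 : ∫ t in (0 : ℝ)..p.T, (∫ s in (0 : ℝ)..t, w s) * (0 - ∫ s in (0 : ℝ)..t, w s)
      = -∫ t in (0 : ℝ)..p.T, (∫ s in (0 : ℝ)..t, w s) ^ 2 := by
    rw [← intervalIntegral.integral_neg]
    exact intervalIntegral.integral_congr fun t _ => by ring
  rw [e1, e2, e3]
  have h1 := mul_nonneg p.κ_pos.le hDw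
  have h2 : 0 ≤ p.φ * ∫ t in (0 : ℝ)..p.T, (∫ s in (0 : ℝ)..t, w s) ^ 2 :=
    mul_nonneg p.φ_pos.le (intervalIntegral.integral_nonneg hT fun _ _ => sq_nonneg _)
  have h3 : 0 ≤ p.ϱ * (∫ s in (0 : ℝ)..p.T, w s) ^ 2 := mul_nonneg p.ϱ_pos.le (sq_nonneg _)
  nlinarith

/-- The marginal is linear in prices, position, terminal price and rate jointly. Comparing two rates
with equal data therefore leaves a marginal with zero position and zero terminal price. -/
lemma marginalPath_sub {S' v' : ℝ → ℝ} {x' c' : ℝ} (hv : IntervalIntegrable v volume 0 p.T)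
    (hv' : IntervalIntegrable v' volume 0 p.T) {t : ℝ} (ht : t ∈ Icc 0 p.T) :
    marginalPath p S x c v t - marginalPath p S' x' c' v' t
      = marginalPath p (fun t => S t - S' t) (x - x') (c - c') (fun t => v t - v' t) t := by
  have hT := p.T_pos.le
  have e0 : ∀ t ∈ Icc 0 p.T, ∫ s in (0 : ℝ)..t, (v s - v' s)
      = (∫ s in (0 : ℝ)..t, v s) - ∫ s in (0 : ℝ)..t, v' s := fun t ht =>
    intervalIntegral.integral_sub (intervalIntegrable_sub_Icc hT hv ht).1
      (intervalIntegrable_sub_Icc hT hv' ht).1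
  have hX := intervalIntegrable_of_continuousOn_Icc hT (continuousOn_inventoryPath (x := x) hT hv)
  have hX' := intervalIntegrable_of_continuousOn_Icc hT (continuousOn_inventoryPath (x := x') hT hv')
  have e1 : ∫ s in t..p.T, (x - x' - ∫ u in (0 : ℝ)..s, (v u - v' u))
      = (∫ s in t..p.T, (x - ∫ u in (0 : ℝ)..s, v u))
        - ∫ s in t..p.T, (x' - ∫ u in (0 : ℝ)..s, v' u) := by
    rw [← intervalIntegral.integral_sub (intervalIntegrable_sub_Icc hT hX ht).2
      (intervalIntegrable_sub_Icc hT hX' ht).2]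
    refine intervalIntegral.integral_congr fun s hs => ?_
    rw [uIcc_of_le ht.2] at hs
    simp only [e0 s ⟨ht.1.trans hs.1, hs.2⟩]
    ring
  simp only [marginalPath, e1, e0 p.T ⟨hT, le_rfl⟩]
  ring

end PathFunctionals

/-! ### The function R and its differential equation. -/

section FeedbackFunction

/-- The derivative of `feedbackR`. -/
noncomputable def feedbackRDeriv (p : ImpactParams) (t : ℝ) : ℝ :=
  p.φ / p.lam * Real.sinh (√(p.φ / p.lam) * t)
    + p.ϱ / p.lam * √(p.φ / p.lam) * Real.cosh (√(p.φ / p.lam) * t)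

variable (p : ImpactParams)

lemma sqrt_mul_self_phi : √(p.φ / p.lam) * √(p.φ / p.lam) = p.φ / p.lam :=
  Real.mul_self_sqrt (div_pos p.φ_pos p.lam_pos).le

lemma hasDerivAt_feedbackR (t : ℝ) : HasDerivAt (feedbackR p) (feedbackRDeriv p t) t := by
  have hl : HasDerivAt (fun t => √(p.φ / p.lam) * t) (√(p.φ / p.lam)) t := by
    simpa using (hasDerivAt_id t).const_mul (√(p.φ / p.lam))
  have h := (hl.cosh.const_mul (√(p.φ / p.lam))).add (hl.sinh.const_mul (p.ϱ / p.lam))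
  refine h.congr_deriv ?_
  have := sqrt_mul_self_phi p
  rw [feedbackRDeriv]
  linear_combination Real.sinh (√(p.φ / p.lam) * t) * this

/-- The reason for the choice of R: R'' = (φ/λ) R balances the running penalty, and the boundary
relation `feedbackRDeriv_zero` balances the terminal penalty. -/
lemma hasDerivAt_feedbackRDeriv (t : ℝ) :
    HasDerivAt (feedbackRDeriv p) (p.φ / p.lam * feedbackR p t) t := by
  have hl : HasDerivAt (fun t => √(p.φ / p.lam) * t) (√(p.φ / p.lam)) t := by
    simpa using (hasDerivAt_id t).const_mul (√(p.φ / p.lam))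
  have h := (hl.sinh.const_mul (p.φ / p.lam)).add
    (hl.cosh.const_mul (p.ϱ / p.lam * √(p.φ / p.lam)))
  refine h.congr_deriv ?_
  have := sqrt_mul_self_phi p
  rw [feedbackR]
  linear_combination p.ϱ / p.lam * Real.sinh (√(p.φ / p.lam) * t) * this

lemma deriv_feedbackR : deriv (feedbackR p) = feedbackRDeriv p :=
  funext fun t => (hasDerivAt_feedbackR p t).deriv

lemma continuous_feedbackR : Continuous (feedbackR p) := by unfold feedbackR; fun_prop

lemma continuous_feedbackRDeriv : Continuous (feedbackRDeriv p) := by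
  unfold feedbackRDeriv; fun_prop

lemma feedbackR_zero : feedbackR p 0 = √(p.φ / p.lam) := by simp [feedbackR]

lemma feedbackRDeriv_zero : feedbackRDeriv p 0 = p.ϱ / p.lam * feedbackR p 0 := by
  simp [feedbackRDeriv, feedbackR_zero]

lemma feedbackR_pos {t : ℝ} (ht : 0 ≤ t) : 0 < feedbackR p t := by
  have h1 : 0 < √(p.φ / p.lam) := Real.sqrt_pos.2 (div_pos p.φ_pos p.lam_pos)
  have h2 : 0 ≤ Real.sinh (√(p.φ / p.lam) * t) :=
    Real.sinh_nonneg_iff.2 (mul_nonneg h1.le ht)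
  have h3 := div_pos p.ϱ_pos p.lam_pos
  have := mul_pos h1 (Real.cosh_pos (√(p.φ / p.lam) * t))
  rw [feedbackR]
  nlinarith [mul_nonneg h3.le h2]

lemma feedbackR_sub_primitive (a t : ℝ) : feedbackR p (p.T - t)
    = feedbackR p (p.T - a) + ∫ s in a..t, -feedbackRDeriv p (p.T - s) := by
  refine primitive_of_hasDerivAt (F := fun t => feedbackR p (p.T - t)) (fun s => ?_) ?_ a t
  · exact (hasDerivAt_feedbackR p (p.T - s)).comp_const_sub p.T s
  · exact ((continuous_feedbackRDeriv p).comp (by fun_prop)).neg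

lemma feedbackRDeriv_sub_primitive (a t : ℝ) : feedbackRDeriv p (p.T - t)
    = feedbackRDeriv p (p.T - a) + ∫ s in a..t, -(p.φ / p.lam * feedbackR p (p.T - s)) := by
  refine primitive_of_hasDerivAt (F := fun t => feedbackRDeriv p (p.T - t)) (fun s => ?_) ?_ a t
  · exact (hasDerivAt_feedbackRDeriv p (p.T - s)).comp_const_sub p.T s
  · exact (continuous_const.mul ((continuous_feedbackR p).comp (by fun_prop))).neg

end FeedbackFunction

/-! ### Lebesgue–Stieltjes integrals and integration by parts. -/

section Stieltjes

/-- The Jordan decomposition reduces the integral against a signed measure to two integrals against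
finite measures. -/
lemma SignedMeasure.setIntegral_eq_sub {X : Type*} {mX : MeasurableSpace X} (m : SignedMeasure X)
    {g : X → ℝ} {s : Set X} (hs : MeasurableSet s)
    (hpos : IntegrableOn g s m.toJordanDecomposition.posPart)
    (hneg : IntegrableOn g s m.toJordanDecomposition.negPart) :
    ∫ᵛ x in s, g x ∂•m = (∫ x in s, g x ∂m.toJordanDecomposition.posPart)
      - ∫ x in s, g x ∂m.toJordanDecomposition.negPart := by
  have hflip : ContinuousLinearMap.lsmul ℝ ℝ (E := ℝ)
      = (ContinuousLinearMap.lsmul ℝ ℝ (E := ℝ)).flip := by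
    ext; simp
  have hm : m.restrict s = (m.toJordanDecomposition.posPart.restrict s).toSignedMeasure
      - (m.toJordanDecomposition.negPart.restrict s).toSignedMeasure := by
    conv_lhs => rw [← m.toSignedMeasure_toJordanDecomposition]
    rw [JordanDecomposition.toSignedMeasure]
    ext t ht
    rw [VectorMeasure.restrict_apply _ hs ht, sub_apply, sub_apply]
    rw [Measure.toSignedMeasure_apply_measurable (ht.inter hs),
      Measure.toSignedMeasure_apply_measurable (ht.inter hs),
      Measure.toSignedMeasure_apply_measurable ht, Measure.toSignedMeasure_apply_measurable ht]
    simp [measureReal_def, Measure.restrict_apply ht]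
  rw [hm, VectorMeasure.integral_sub_vectorMeasure, hflip, VectorMeasure.integral_toSignedMeasure,
    VectorMeasure.integral_toSignedMeasure]
  · rw [VectorMeasure.Integrable, Measure.variation_toSignedMeasure]; exact hpos
  · rw [VectorMeasure.Integrable, Measure.variation_toSignedMeasure]; exact hneg

/-- Integration by parts against a finite measure. -/
lemma setIntegral_Ioc_eq_of_hasDerivAt (ν : Measure ℝ) [IsFiniteMeasure ν] {g g' : ℝ → ℝ}
    (hg : ∀ s, HasDerivAt g (g' s) s) (hg' : Continuous g') {a b : ℝ} (hab : a ≤ b) :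
    ∫ s in Ioc a b, g s ∂ν = g b * ν.real (Ioc a b) - ∫ r in a..b, g' r * ν.real (Ioc a r) := by
  -- With g(s) written as g(b) minus the integral of g' over [s, b], Fubini on {s ≤ r} produces the
  -- masses of (a, r].
  have h1 : ∀ s ∈ Ioc a b, g s = g b - ∫ r in Ioc a b, (Ici s).indicator g' r := by
    intro s hs
    rw [setIntegral_indicator measurableSet_Ici]
    have : Ioc a b ∩ Ici s = Icc s b := by ext r; simp; grind
    rw [this, integral_Icc_eq_integral_Ioc, ← intervalIntegral.integral_of_le hs.2,
      intervalIntegral.integral_eq_sub_of_hasDerivAt (fun x _ => hg x)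
        (hg'.intervalIntegrable _ _)]
    ring
  have hmeas : MeasurableSet {z : ℝ × ℝ | z.1 ≤ z.2} := measurableSet_le measurable_fst measurable_snd
  have hF : Integrable (fun z : ℝ × ℝ => {z : ℝ × ℝ | z.1 ≤ z.2}.indicator (fun z => g' z.2) z)
      ((ν.restrict (Ioc a b)).prod (volume.restrict (Ioc a b))) := by
    refine Integrable.indicator ?_ hmeas
    have : Integrable g' (volume.restrict (Ioc a b)) := hg'.integrableOn_Ioc
    exact this.comp_snd _
  have hF' : ∀ s r, {z : ℝ × ℝ | z.1 ≤ z.2}.indicator (fun z => g' z.2) (s, r)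
      = (Ici s).indicator g' r := fun s r => by simp [indicator]
  have h2 : ∫ s in Ioc a b, (∫ r in Ioc a b, (Ici s).indicator g' r) ∂ν
      = ∫ r in a..b, g' r * ν.real (Ioc a r) := by
    simp_rw [← hF']
    rw [integral_integral_swap (f := fun s r => {z : ℝ × ℝ | z.1 ≤ z.2}.indicator
      (fun z => g' z.2) (s, r)) hF, intervalIntegral.integral_of_le hab]
    refine setIntegral_congr_fun measurableSet_Ioc fun r hr => ?_
    have : ∀ s, {z : ℝ × ℝ | z.1 ≤ z.2}.indicator (fun z => g' z.2) (s, r)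
        = (Iic r).indicator (fun _ => g' r) s := fun s => by simp [indicator]
    simp_rw [this]
    rw [setIntegral_indicator measurableSet_Iic, setIntegral_const]
    have : Ioc a b ∩ Iic r = Ioc a r := by ext s; simp; grind
    rw [this, smul_eq_mul, mul_comm]
  have hi : Integrable (fun s => ∫ r in Ioc a b, (Ici s).indicator g' r)
      (ν.restrict (Ioc a b)) := by
    have := hF.integral_prod_left
    simpa only [hF'] using this
  rw [setIntegral_congr_fun measurableSet_Ioc h1, integral_sub (integrable_const _) hi, h2,
    setIntegral_const, smul_eq_mul, mul_comm]

/-- Integration by parts for the Lebesgue–Stieltjes integral. -/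
lemma stieltjesIntegral_eq_of_hasDerivAt {g g' f : ℝ → ℝ} {a b : ℝ} (hab : a ≤ b)
    (hg : ∀ s, HasDerivAt g (g' s) s) (hg' : Continuous g') (hf : BoundedVariationOn f (Icc a b))
    (hfi : IntervalIntegrable f volume a b)
    (hc : ∀ t ∈ Ico a b, ContinuousWithinAt f (Ici t) t) :
    stieltjesIntegral g f a b = g b * f b - g a * f a - ∫ s in a..b, g' s * f s := by
  set F : ℝ → ℝ := fun s => f (max a (min s b)) with hF
  have hBV : BoundedVariationOn F univ := by
    refine ne_top_of_le_ne_top hf (eVariationOn.comp_le_of_monotoneOn f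
      (φ := fun s => max a (min s b)) ?_ ?_)
    · intro s _ t _ hst
      exact max_le_max_left _ (min_le_min_right _ hst)
    · intro s _
      exact ⟨le_max_left _ _, max_le hab (min_le_right _ _)⟩
  -- The Stieltjes measure is given by right limits. They are the values of F: by `hc` for arguments
  -- in [a, b), and because F is constant before a and from b on.
  have hright : ∀ t, Function.rightLim F t = F t := by
    intro t
    refine ContinuousWithinAt.rightLim_eq ?_
    rcases lt_or_ge t b with h | h
    · have hm : ContinuousWithinAt (fun s => max a (min s b)) (Ici t) t := by fun_prop
      rcases hab.eq_or_lt with e | e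
      · subst e
        refine (continuousWithinAt_const (b := f a)).congr (fun s _ => ?_) ?_ <;> simp [hF]
      have hmem : max a (min t b) ∈ Ico a b :=
        ⟨le_max_left _ _, max_lt e ((min_le_left _ _).trans_lt h)⟩
      exact ContinuousWithinAt.comp (g := f) (f := fun s => max a (min s b)) (hc _ hmem) hm
        fun s (hs : t ≤ s) => max_le_max_left a (min_le_min_right b hs)
    · refine (continuousWithinAt_const (b := f b)).congr (fun s hs => ?_) ?_
      · simp [hF, min_eq_right (h.trans hs), hab]
      · simp [hF, min_eq_right h, hab]
  have hFI : ∀ s ∈ Icc a b, F s = f s := fun s hs => by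
    simp [hF, min_eq_left hs.2, max_eq_right hs.1]
  rw [stieltjesIntegral, dif_pos hBV]
  set m : SignedMeasure ℝ := hBV.vectorMeasure with hm
  have hmI : ∀ r ∈ Icc a b, m.toJordanDecomposition.posPart.real (Ioc a r)
      - m.toJordanDecomposition.negPart.real (Ioc a r) = f r - f a := by
    intro r hr
    rw [← m.apply_eq_posPart_real_sub_negPart_real measurableSet_Ioc, hm,
      hBV.vectorMeasure_Ioc hr.1, hright, hright, hFI r hr, hFI a ⟨le_rfl, hab⟩]
  have hgc : Continuous g := continuous_iff_continuousAt.2 fun s => (hg s).continuousAt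
  have hgi : ∀ (ν : Measure ℝ) [IsFiniteMeasure ν], IntegrableOn g (Ioc a b) ν := fun ν _ =>
    hgc.integrableOn_Ioc
  have hmi : ∀ (ν : Measure ℝ) [IsFiniteMeasure ν],
      IntervalIntegrable (fun r => g' r * ν.real (Ioc a r)) volume a b := fun ν _ => by
    have : Monotone fun r => ν.real (Ioc a r) := fun r s hrs =>
      measureReal_mono (Ioc_subset_Ioc_right hrs)
    exact this.intervalIntegrable.continuousOn_mul hg'.continuousOn
  rw [SignedMeasure.setIntegral_eq_sub m measurableSet_Ioc (hgi _) (hgi _),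
    setIntegral_Ioc_eq_of_hasDerivAt _ hg hg' hab, setIntegral_Ioc_eq_of_hasDerivAt _ hg hg' hab]
  have e1 := hmI b ⟨hab, le_rfl⟩
  have e2 : (∫ r in a..b, g' r * m.toJordanDecomposition.posPart.real (Ioc a r))
      - ∫ r in a..b, g' r * m.toJordanDecomposition.negPart.real (Ioc a r)
      = (∫ s in a..b, g' s * f s) - (g b - g a) * f a := by
    rw [← intervalIntegral.integral_eq_sub_of_hasDerivAt (fun x _ => hg x)
      (hg'.intervalIntegrable a b), ← intervalIntegral.integral_mul_const,
      ← intervalIntegral.integral_sub (hmi _) (hmi _),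
      ← intervalIntegral.integral_sub (hfi.continuousOn_mul hg'.continuousOn)
        ((hg'.intervalIntegrable a b).mul_const _)]
    refine intervalIntegral.integral_congr fun r hr => ?_
    rw [uIcc_of_le hab] at hr
    have := hmI r hr
    linear_combination g' r * this
  linear_combination g b * e1 - e2

end Stieltjes

/-! ### Eliminating the future rate, and optimal liquidation without signals. -/

section FeedbackPath

variable {p : ImpactParams} {S v : ℝ → ℝ} {x c : ℝ}

/-- Testing the first-order condition with `R'(T - ·)` eliminates the future of the rate. -/
lemma integral_feedbackRDeriv_mul_marginalPath (hS : IntervalIntegrable S volume 0 p.T)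
    (hv : IntervalIntegrable v volume 0 p.T) {t : ℝ} (ht : t ∈ Icc 0 p.T) :
    (∫ s in t..p.T, feedbackRDeriv p (p.T - s) * marginalPath p S x c v s)
        - feedbackR p (p.T - t) * marginalPath p S x c v t
      = (∫ s in t..p.T, feedbackRDeriv p (p.T - s) * (S s - c))
        - feedbackR p (p.T - t) * (S t - c)
        - 2 * p.lam * feedbackRDeriv p (p.T - t) * (x - ∫ s in (0 : ℝ)..t, v s)
        + 2 * p.lam * feedbackR p (p.T - t) * v t := by
  have hT := p.T_pos.le
  have hvt := (intervalIntegrable_sub_Icc hT hv ht).2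
  have hSt := (intervalIntegrable_sub_Icc hT hS ht).2
  have hcX := continuousOn_inventoryPath (x := x) hT hv
  have hX := intervalIntegrable_of_continuousOn_Icc hT hcX
  have hXt := (intervalIntegrable_sub_Icc hT hX ht).2
  have hRc : Continuous fun s => feedbackR p (p.T - s) :=
    (continuous_feedbackR p).comp (by fun_prop)
  have hRDc : Continuous fun s => feedbackRDeriv p (p.T - s) :=
    (continuous_feedbackRDeriv p).comp (by fun_prop)
  set X : ℝ → ℝ := fun s => x - ∫ u in (0 : ℝ)..s, v u with hXdef
  set Z : ℝ → ℝ := fun s => ∫ u in s..p.T, X u with hZdef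
  have hZprim : ∀ s ∈ Icc t p.T, Z s = Z t + ∫ u in t..s, -X u := fun s hs => by
    have h2 := intervalIntegrable_sub_Icc ht.2 hXt hs
    simp only [hZdef]
    rw [← intervalIntegral.integral_add_adjacent_intervals h2.1 h2.2,
      intervalIntegral.integral_neg]
    ring
  have hXprim : ∀ s ∈ Icc t p.T, X s = X t + ∫ u in t..s, -v u := fun s hs => by
    have h1 := (intervalIntegrable_sub_Icc hT hv ht).1
    have h2 := (intervalIntegrable_sub_Icc ht.2 hvt hs).1
    simp only [hXdef]
    rw [← intervalIntegral.integral_add_adjacent_intervals h1 h2,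
      intervalIntegral.integral_neg]
    ring
  have hZc : ContinuousOn Z (Icc t p.T) := by
    refine ContinuousOn.congr (f := fun s => Z t + ∫ u in t..s, -X u) ?_ hZprim
    have := intervalIntegral.continuousOn_primitive_interval (μ := volume) (f := fun u => -X u)
      (a := t) (b := p.T) (by
        rw [uIcc_of_le ht.2]
        exact (intervalIntegrable_iff_integrableOn_Icc_of_le ht.2).1 hXt.neg)
    rw [uIcc_of_le ht.2] at this
    exact continuousOn_const.add this
  -- `i1` trades the rate for the inventory X and `i2` trades Z, the remaining integral of X, for X.
  -- With R'' = (φ/λ) R the two integrals of R X cancel. The terms with X_T and R(0) cancel by R'(0)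
  -- = (ϱ/λ) R(0) and `i3`.
  have i1 := integral_mul_of_primitive ht.2 ((continuous_const.mul hRc).neg.intervalIntegrable t p.T)
    hvt.neg (fun s _ => feedbackRDeriv_sub_primitive p t s) hXprim
  have i2 := integral_mul_of_primitive ht.2 (hRDc.neg.intervalIntegrable t p.T)
    hXt.neg (fun s _ => feedbackR_sub_primitive p t s) hZprim
  have i3 := feedbackR_sub_primitive p t p.T
  have hZT : Z p.T = 0 := by simp [hZdef]
  simp only [sub_self, hZT, mul_zero, Pi.neg_apply, Pi.mul_apply, mul_neg, neg_mul, mul_assoc,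
    intervalIntegral.integral_neg, intervalIntegral.integral_const_mul] at i1 i2 i3
  have hZi : IntervalIntegrable Z volume t p.T :=
    ContinuousOn.intervalIntegrable (by rwa [uIcc_of_le ht.2])
  have jS := (hSt.sub (intervalIntegrable_const (c := c))).continuousOn_mul hRDc.continuousOn
  have jv := hvt.continuousOn_mul hRDc.continuousOn
  have jZ := hZi.continuousOn_mul hRDc.continuousOn
  have j1 : IntervalIntegrable (fun s => feedbackRDeriv p (p.T - s)) volume t p.T :=
    hRDc.intervalIntegrable _ _
  have e : ∫ s in t..p.T, feedbackRDeriv p (p.T - s) * marginalPath p S x c v s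
      = (∫ s in t..p.T, feedbackRDeriv p (p.T - s) * (S s - c))
        - 2 * p.lam * (∫ s in t..p.T, feedbackRDeriv p (p.T - s) * v s)
        + 2 * p.φ * (∫ s in t..p.T, feedbackRDeriv p (p.T - s) * Z s)
        + 2 * p.ϱ * X p.T * ∫ s in t..p.T, feedbackRDeriv p (p.T - s) := by
    rw [← intervalIntegral.integral_const_mul, ← intervalIntegral.integral_const_mul,
      ← intervalIntegral.integral_const_mul, ← intervalIntegral.integral_sub jS (jv.const_mul _),
      ← intervalIntegral.integral_add (jS.sub (jv.const_mul _)) (jZ.const_mul _),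
      ← intervalIntegral.integral_add ((jS.sub (jv.const_mul _)).add (jZ.const_mul _))
        (j1.const_mul _)]
    refine intervalIntegral.integral_congr fun s _ => ?_
    simp only [marginalPath, hXdef, hZdef]
    ring
  have hM : marginalPath p S x c v t = S t - c - 2 * p.lam * v t + 2 * p.φ * Z t
      + 2 * p.ϱ * X p.T := by
    simp only [marginalPath, hXdef, hZdef]
    ring
  rw [e, hM]
  have hl : p.lam ≠ 0 := p.lam_pos.ne'
  have k1 : p.lam * feedbackRDeriv p 0 = p.ϱ * feedbackR p 0 := by
    rw [feedbackRDeriv_zero]; field_simp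
  have k2 : p.lam * (p.φ / p.lam) = p.φ := by field_simp
  change _ = _ - 2 * p.lam * feedbackRDeriv p (p.T - t) * X t + _
  generalize (∫ s in t..p.T, feedbackRDeriv p (p.T - s) * v s) = I1 at *
  generalize (∫ s in t..p.T, feedbackRDeriv p (p.T - s) * Z s) = I2 at *
  generalize (∫ s in t..p.T, feedbackRDeriv p (p.T - s)) = I3 at *
  generalize (∫ s in t..p.T, feedbackR p (p.T - s) * X s) = I4 at *
  linear_combination 2 * p.lam * i1 - 2 * p.φ * i2 + 2 * p.ϱ * X p.T * i3
    + 2 * X p.T * k1 + 2 * I4 * k2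

/-- The rate with which a position of size one is closed in the absence of signals. -/
noncomputable def liquidationRate (p : ImpactParams) (t : ℝ) : ℝ :=
  feedbackRDeriv p (p.T - t) / feedbackR p p.T

lemma continuous_liquidationRate (p : ImpactParams) : Continuous (liquidationRate p) :=
  ((continuous_feedbackRDeriv p).comp (by fun_prop)).div_const _

/-- The rate is minus the derivative of R(T-t)/R(T), so this quotient is the remaining inventory. -/
lemma integral_liquidationRate (p : ImpactParams) (t : ℝ) :
    1 - ∫ s in (0 : ℝ)..t, liquidationRate p s = feedbackR p (p.T - t) / feedbackR p p.T := by
  have h := feedbackR_sub_primitive p 0 t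
  have hR := (feedbackR_pos p p.T_pos.le).ne'
  simp only [liquidationRate, intervalIntegral.integral_div]
  rw [sub_zero, intervalIntegral.integral_neg] at h
  field_simp
  linarith

/-- The equation for R, integrated over [t, T] with its boundary relation at 0, is the
Euler–Lagrange equation of the cost alone. Multiples of this rate can therefore absorb a change of
initial position. -/
lemma marginalPath_liquidationRate (p : ImpactParams) (t : ℝ) :
    marginalPath p (fun _ => 0) 1 0 (liquidationRate p) t = 0 := by
  simp only [marginalPath, integral_liquidationRate, intervalIntegral.integral_div]
  have h := feedbackRDeriv_sub_primitive p t p.T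
  have hR := (feedbackR_pos p p.T_pos.le).ne'
  have hl : p.lam ≠ 0 := p.lam_pos.ne'
  rw [intervalIntegral.integral_neg, intervalIntegral.integral_const_mul, sub_self,
    feedbackRDeriv_zero] at h
  simp only [liquidationRate, sub_self]
  field_simp at h ⊢
  linear_combination 2 * h

/-- As the primitive of an integrable function, the distortion is absolutely continuous. -/
lemma boundedVariationOn_distortionPath {ρ γ y T : ℝ} {g : ℝ → ℝ} (hT : 0 ≤ T)
    (hg : IntervalIntegrable g volume 0 T) :
    BoundedVariationOn (distortionPath ρ γ y g) (Icc 0 T) := by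
  have hD := intervalIntegrable_of_continuousOn_Icc hT
    (continuousOn_distortionPath (ρ := ρ) (γ := γ) (y := y) hT hg)
  have hi : IntervalIntegrable (fun s => -ρ * distortionPath ρ γ y g s + γ * g s) volume 0 T :=
    (hD.const_mul _).add (hg.const_mul _)
  have h := ((LipschitzOnWith.absolutelyContinuousOnInterval (K := 0)
    (LipschitzWith.const y).lipschitzOnWith).add
      (hi.absolutelyContinuousOnInterval_intervalIntegral (c := 0) (by simp))).boundedVariationOn
  rw [uIcc_of_le hT] at h
  rw [BoundedVariationOn, eVariationOn.congr fun t ht => distortionPath_ode hg ht]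
  exact h

lemma BoundedVariationOn.sub_const_mul {f g : ℝ → ℝ} {s : Set ℝ} (hf : BoundedVariationOn f s)
    (hg : BoundedVariationOn g s) (k : ℝ) : BoundedVariationOn (fun t => f t - k * g t) s := by
  refine ne_top_of_le_ne_top (ENNReal.add_ne_top.2
    ⟨hf, ENNReal.mul_ne_top (ENNReal.ofReal_ne_top (r := |k|)) hg⟩) (iSup_le fun q => ?_)
  calc ∑ i ∈ Finset.range q.1, edist (f (q.2.1 (i + 1)) - k * g (q.2.1 (i + 1)))
        (f (q.2.1 i) - k * g (q.2.1 i))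
      ≤ ∑ i ∈ Finset.range q.1, (edist (f (q.2.1 (i + 1))) (f (q.2.1 i))
          + ENNReal.ofReal |k| * edist (g (q.2.1 (i + 1))) (g (q.2.1 i))) := by
        refine Finset.sum_le_sum fun i _ => ?_
        simp only [edist_dist, Real.dist_eq]
        rw [← ENNReal.ofReal_mul (abs_nonneg _), ← abs_mul,
          ← ENNReal.ofReal_add (abs_nonneg _) (abs_nonneg _)]
        refine ENNReal.ofReal_le_ofReal ?_
        rw [mul_sub]
        exact (congrArg abs (by ring)).trans_le (abs_sub _ _)
    _ ≤ _ := by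
        rw [Finset.sum_add_distrib, ← Finset.mul_sum]
        exact add_le_add (eVariationOn.sum_le q.2.2.1 q.2.2.2)
          (mul_le_mul_right (eVariationOn.sum_le q.2.2.1 q.2.2.2) _)

end FeedbackPath

/-! ### Total variation along dyadic partitions. -/

section Variation

/-- The variation of a right-continuous function is computed along dyadic partitions. -/
lemma eVariationOn_Icc_eq_liminf {f : ℝ → ℝ} {T : ℝ} (hT : 0 < T)
    (hc : ∀ t ∈ Ico 0 T, ContinuousWithinAt f (Ici t) t) :
    eVariationOn f (Icc 0 T) = liminf (fun n : ℕ => ∑ k ∈ Finset.range (2 ^ n),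
      edist (f (T * ((k : ℕ) / 2 ^ n))) (f (T * ((k + 1 : ℕ) / 2 ^ n)))) atTop := by
  have hu : ∀ n : ℕ, Monotone fun k : ℕ => T * ((k : ℝ) / 2 ^ n) := fun n k l hkl => by
    have : (k : ℝ) ≤ l := by exact_mod_cast hkl
    exact mul_le_mul_of_nonneg_left (by gcongr) hT.le
  have hsum : ∀ n : ℕ, ∑ k ∈ Finset.range (2 ^ n),
      edist (f (T * ((k : ℕ) / 2 ^ n))) (f (T * ((k + 1 : ℕ) / 2 ^ n)))
      = eVariationOn f ((fun k : ℕ => T * ((k : ℝ) / 2 ^ n)) '' Iic (2 ^ n)) := fun n =>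
    (eVariationOn.image_range_of_monotone f (hu n) (2 ^ n)).symm
  simp_rw [hsum]
  have hsub : ∀ n : ℕ, ((fun k : ℕ => T * ((k : ℝ) / 2 ^ n)) '' Iic (2 ^ n)) ⊆ Icc 0 T := by
    rintro n _ ⟨k, hk, rfl⟩
    have hk' : (k : ℝ) ≤ 2 ^ n := by exact_mod_cast (mem_Iic.1 hk)
    refine ⟨by positivity, ?_⟩
    have : (k : ℝ) / 2 ^ n ≤ 1 := (div_le_one (by positivity)).2 hk'
    simpa using mul_le_mul_of_nonneg_left this hT.le
  refine le_antisymm ?_ ?_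
  -- Here `φ n` rounds up to the n-th dyadic grid of [0, T]. Approaching t from the right, f ∘ `φ n`
  -- converges pointwise to f, and variation is lower semicontinuous. The endpoint T is a grid
  -- point, so no right-continuity is needed there.
  · set φ : ℕ → ℝ → ℝ := fun n t => T * ((⌈2 ^ n * t / T⌉₊ : ℝ) / 2 ^ n) with hφ
    have hmono : ∀ n, Monotone (φ n) := fun n s t hst =>
      hu n (Nat.ceil_mono (by gcongr))
    have hmaps : ∀ n, MapsTo (φ n) (Icc 0 T)
        ((fun k : ℕ => T * ((k : ℝ) / 2 ^ n)) '' Iic (2 ^ n)) := fun n t ht => by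
      refine ⟨⌈2 ^ n * t / T⌉₊, ?_, rfl⟩
      rw [mem_Iic, Nat.ceil_le, div_le_iff₀ hT]
      push_cast
      exact mul_le_mul_of_nonneg_left ht.2 (by positivity)
    have hlow : ∀ n t, t ≤ φ n t := fun n t => by
      have := Nat.le_ceil (2 ^ n * t / T)
      rw [div_le_iff₀ hT] at this
      rw [hφ]
      simp only
      rw [← mul_div_assoc, le_div_iff₀ (by positivity)]
      linarith
    have hup : ∀ n t, 0 ≤ t → φ n t ≤ t + T * (1 / 2) ^ n := fun n t ht => by
      have := Nat.ceil_lt_add_one (a := 2 ^ n * t / T) (by positivity)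
      have h2 : (0 : ℝ) < 2 ^ n := by positivity
      calc φ n t ≤ T * ((2 ^ n * t / T + 1) / 2 ^ n) :=
            mul_le_mul_of_nonneg_left (by gcongr) hT.le
        _ = t + T * (1 / 2) ^ n := by rw [div_pow, one_pow]; field_simp
    have hlim : ∀ t ∈ Icc 0 T, Tendsto (fun n => f (φ n t)) atTop (𝓝 (f t)) := by
      intro t ht
      rcases ht.2.eq_or_lt with rfl | h
      · have : ∀ n, φ n t = t := fun n => by
          simp only [hφ]
          rw [mul_div_assoc, div_self hT.ne', mul_one]
          have : (2 : ℝ) ^ n = ((2 ^ n : ℕ) : ℝ) := by push_cast; rfl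
          rw [this, Nat.ceil_natCast, div_self (by positivity), mul_one]
        simp [this]
      · refine (hc t ⟨ht.1, h⟩).tendsto.comp (tendsto_nhdsWithin_of_tendsto_nhds_of_eventually_within
          _ ?_ (Eventually.of_forall fun n => hlow n t))
        refine tendsto_of_tendsto_of_tendsto_of_le_of_le tendsto_const_nhds ?_
          (fun n => hlow n t) (fun n => hup n t ht.1)
        have := (tendsto_pow_atTop_nhds_zero_of_lt_one (r := (1 / 2 : ℝ)) (by norm_num)
          (by norm_num)).const_mul T
        simpa using this.const_add t
    refine le_of_forall_lt fun v hv => ?_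
    obtain ⟨v', hv1, hv2⟩ := exists_between hv
    refine hv1.trans_le (le_liminf_of_le (by isBoundedDefault) ?_)
    filter_upwards [eVariationOn.lowerSemicontinuous_aux (F := fun n t => f (φ n t)) hlim hv2]
      with n hn
    exact hn.le.trans (eVariationOn.comp_le_of_monotoneOn f (φ n) ((hmono n).monotoneOn _) (hmaps n))
  · refine (liminf_le_liminf (Eventually.of_forall fun n => eVariationOn.mono f (hsub n))).trans ?_
    rw [liminf_const]

end Variation

/-! ### From eventual equality to convergence in L¹. -/

section Convergence

variable {Ω : Type*} {mΩ : MeasurableSpace Ω} {μ : Measure Ω} [IsProbabilityMeasure μ]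

/-- Eventual almost sure equality and boundedness in `L²` imply convergence in `L¹`. -/
lemma tendsto_integral_abs_sub_of_eventually_eq {a : ℕ → Ω → ℝ} {l : Ω → ℝ} {K : ℝ}
    (ha : ∀ n, MemLp (a n) 2 μ) (hl : MemLp l 2 μ) (hK : ∀ n, ∫ ω, a n ω ^ 2 ∂μ ≤ K)
    (h : ∀ᵐ ω ∂μ, ∀ᶠ n in atTop, a n ω = l ω) :
    Tendsto (fun n => ∫ ω, |a n ω - l ω| ∂μ) atTop (𝓝 0) := by
  -- The indicator of the event that a_n and l differ; its probability tends to zero by dominated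
  -- convergence.
  set d : ℕ → Ω → ℝ := fun n ω => if a n ω = l ω then 0 else 1 with hd
  have hdm : ∀ n, AEStronglyMeasurable (d n) μ := fun n => by
    have h1 : AEMeasurable (fun ω => a n ω - l ω) μ :=
      ((ha n).sub hl).aestronglyMeasurable.aemeasurable
    have h2 : Measurable fun x : ℝ => if x = 0 then (0 : ℝ) else 1 :=
      Measurable.ite (measurableSet_singleton 0) measurable_const measurable_const
    have h3 := (h2.comp_aemeasurable h1).aestronglyMeasurable
    refine h3.congr (Eventually.of_forall fun ω => ?_)
    simp [hd, sub_eq_zero]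
  have hdlim : Tendsto (fun n => ∫ ω, d n ω ∂μ) atTop (𝓝 0) := by
    have := tendsto_integral_of_dominated_convergence (F := d) (f := fun _ => (0 : ℝ)) (μ := μ)
      (fun _ => 1) hdm (integrable_const 1)
      (fun n => Eventually.of_forall fun ω => by simp only [hd]; split_ifs <;> simp) (by
        filter_upwards [h] with ω hω
        refine tendsto_const_nhds.congr' ?_
        filter_upwards [hω] with n hn
        simp [hd, hn])
    simpa using this
  have hdi : ∀ n, Integrable (d n) μ := fun n => Integrable.mono' (integrable_const 1) (hdm n)
    (Eventually.of_forall fun ω => by simp only [hd]; split_ifs <;> simp)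
  set C := 2 * K + 2 * ∫ ω, l ω ^ 2 ∂μ with hC
  have hsq : ∀ n, ∫ ω, (a n ω - l ω) ^ 2 ∂μ ≤ C := fun n => by
    calc ∫ ω, (a n ω - l ω) ^ 2 ∂μ ≤ ∫ ω, (2 * a n ω ^ 2 + 2 * l ω ^ 2) ∂μ := by
          refine integral_mono ((ha n).sub hl).integrable_sq
            (((ha n).integrable_sq.const_mul 2).add (hl.integrable_sq.const_mul 2)) fun ω => ?_
          simp only
          nlinarith [sq_nonneg (a n ω + l ω)]
      _ = 2 * (∫ ω, a n ω ^ 2 ∂μ) + 2 * ∫ ω, l ω ^ 2 ∂μ := by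
          rw [integral_add ((ha n).integrable_sq.const_mul 2) (hl.integrable_sq.const_mul 2),
            integral_const_mul, integral_const_mul]
      _ ≤ C := by have := hK n; rw [hC]; linarith
  have hC0 : 0 ≤ C := (integral_nonneg fun _ => sq_nonneg _).trans (hsq 0)
  -- Young's inequality |z| ≤ εz² + 1/(4ε), where the last summand is only needed where z ≠ 0.
  have hbound : ∀ ε > 0, ∀ n, ∫ ω, |a n ω - l ω| ∂μ ≤ ε * C + (∫ ω, d n ω ∂μ) / (4 * ε) := by
    intro ε hε n
    have i1 := (((ha n).sub hl).integrable_sq).const_mul ε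
    have i2 := (hdi n).div_const (4 * ε)
    calc ∫ ω, |a n ω - l ω| ∂μ
        ≤ ∫ ω, (ε * (a n ω - l ω) ^ 2 + d n ω / (4 * ε)) ∂μ := by
          refine integral_mono (((ha n).sub hl).integrable one_le_two).abs (i1.add i2) fun ω => ?_
          simp only [hd]
          split_ifs with h0
          · simp [h0]
          · rw [← sq_abs (a n ω - l ω)]
            have : (0 : ℝ) ≤ (2 * ε * |a n ω - l ω| - 1) ^ 2 / (4 * ε) := by positivity
            have e : (2 * ε * |a n ω - l ω| - 1) ^ 2 / (4 * ε)
                = ε * |a n ω - l ω| ^ 2 + 1 / (4 * ε) - |a n ω - l ω| := by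
              field_simp; ring
            linarith
      _ = ε * (∫ ω, (a n ω - l ω) ^ 2 ∂μ) + (∫ ω, d n ω ∂μ) / (4 * ε) := by
          rw [← integral_const_mul, ← integral_div]
          exact integral_add i1 i2
      _ ≤ _ := by gcongr; exact hsq n
  rw [Metric.tendsto_atTop]
  intro η hη
  set ε := η / (2 * (C + 1)) with hε
  have hε0 : 0 < ε := by positivity
  have h1 : ε * C ≤ η / 2 := by
    rw [hε, div_mul_eq_mul_div, div_le_div_iff₀ (by positivity) (by norm_num)]
    nlinarith
  have h2 : ∀ᶠ n in atTop, ∫ ω, d n ω ∂μ < η / 2 * (4 * ε) :=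
    hdlim.eventually_lt_const (by positivity)
  obtain ⟨N, hN⟩ := eventually_atTop.1 h2
  refine ⟨N, fun n hn => ?_⟩
  rw [Real.dist_eq, sub_zero, abs_of_nonneg (integral_nonneg fun _ => abs_nonneg _)]
  have h3 := hbound ε hε0 n
  have h4 : (∫ ω, d n ω ∂μ) / (4 * ε) < η / 2 := by
    rw [div_lt_iff₀ (by positivity)]; exact hN n hn
  linarith

end Convergence

/-! ### Progressive measurability of right-continuous processes. -/

section Cadlag

variable {Ω : Type*} {mΩ : MeasurableSpace Ω} {𝓕 : Filtration ℝ≥0 mΩ} {X : ℝ → Ω → ℝ}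

lemma tendsto_dyadicAfter (t : ℝ≥0) : Tendsto (fun n => dyadicAfter n t) atTop (𝓝[≥] t) := by
  refine tendsto_nhdsWithin_of_tendsto_nhds_of_eventually_within _ ?_
    (Eventually.of_forall fun n => (lt_dyadicAfter n t).le)
  refine tendsto_of_tendsto_of_tendsto_of_le_of_le tendsto_const_nhds ?_
    (fun n => (lt_dyadicAfter n t).le) (fun n => dyadicAfter_le n t)
  have := (NNReal.tendsto_pow_atTop_nhds_zero_of_lt_one (r := 1 / 2) (by
    rw [← NNReal.coe_lt_coe]; norm_num)).const_add t
  simpa using this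

/-- A right-continuous adapted process is progressively measurable. -/
lemma isStronglyProgressive_of_rightContinuous (hX : StronglyAdapted 𝓕 (onNonneg X))
    (hc : ∀ ω, ∀ t, 0 ≤ t → ContinuousWithinAt (fun t => X t ω) (Ici t) t) :
    IsStronglyProgressive 𝓕 (onNonneg X) := by
  refine isStronglyProgressive_limsup_dyadicAfter (X := onNonneg X) (fun t => (hX t).measurable)
    (fun t => (hX t).measurable) fun t ω => ?_
  refine (Tendsto.limsup_eq ?_).symm
  have h1 : Tendsto (fun n => ((dyadicAfter n t : ℝ≥0) : ℝ)) atTop (𝓝[≥] (t : ℝ)) :=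
    (NNReal.continuous_coe.continuousWithinAt.tendsto_nhdsWithin
      (fun s (hs : t ≤ s) => NNReal.coe_le_coe.2 hs)).comp (tendsto_dyadicAfter t)
  exact (hc ω t t.2).tendsto.comp h1

end Cadlag

lemma IsSqIntegrable.of_section_le {Ω : Type*} {mΩ : MeasurableSpace Ω} {μ : Measure Ω}
    [IsProbabilityMeasure μ] {T C : ℝ} {v : ℝ → Ω → ℝ} (hm : IsJointlyMeasurable mΩ T v)
    (hC : ∀ t ∈ Icc 0 T, MemLp (v t) 2 μ ∧ ∫ ω, v t ω ^ 2 ∂μ ≤ C) : IsSqIntegrable μ T v := by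
  refine ⟨hm, (memLp_two_iff_integrable_sq hm.aestronglyMeasurable).2 ?_⟩
  have hae := (hm.aestronglyMeasurable (μ := μ)).pow 2
  refine (integrable_prod_iff hae).2 ⟨?_, ?_⟩
  · filter_upwards [ae_restrict_mem measurableSet_Icc] with t ht
    exact (hC t ht).1.integrable_sq
  · refine Integrable.mono' (integrable_const C) hae.norm.integral_prod_right' ?_
    filter_upwards [ae_restrict_mem measurableSet_Icc] with t ht
    rw [Real.norm_eq_abs, abs_of_nonneg (integral_nonneg fun _ => norm_nonneg _)]
    simpa using (hC t ht).2

/-! ### Square integrability of the semimartingale and the true martingale property of L. -/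

namespace IsH2Semimartingale

variable {Ω : Type*} {mΩ : MeasurableSpace Ω} {μ : Measure Ω} {𝓕 : Filtration ℝ≥0 mΩ} {T : ℝ}
  {P L A : ℝ → Ω → ℝ}

lemma progressive_L (hP : IsH2Semimartingale μ 𝓕 T P L A) :
    IsStronglyProgressive 𝓕 (onNonneg L) :=
  isStronglyProgressive_of_rightContinuous hP.adapted_L fun ω t ht => (hP.cadlag_L ω t ht).1

lemma progressive_A (hP : IsH2Semimartingale μ 𝓕 T P L A) :
    IsStronglyProgressive 𝓕 (onNonneg A) := hP.predictable_A.isStronglyProgressive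

/-- The supremum over all partitions is uncountable; right-continuity reduces it to a lower limit
over dyadic ones. -/
lemma measurable_variation (hP : IsH2Semimartingale μ 𝓕 T P L A) (hT : 0 < T) :
    Measurable fun ω => eVariationOn (fun t => A t ω) (Icc 0 T) := by
  have e : (fun ω => eVariationOn (fun t => A t ω) (Icc 0 T)) = fun ω =>
      liminf (fun n : ℕ => ∑ k ∈ Finset.range (2 ^ n), edist (A (T * ((k : ℕ) / 2 ^ n)) ω)
        (A (T * ((k + 1 : ℕ) / 2 ^ n)) ω)) atTop :=
    funext fun ω => eVariationOn_Icc_eq_liminf hT fun t ht => (hP.cadlag_A ω t ht.1).1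
  rw [e]
  have hA : ∀ t, 0 ≤ t → Measurable (A t) := fun t ht =>
    ((hP.progressive_A.stronglyAdapted ⟨t, ht⟩).mono (𝓕.le _)).measurable
  refine Measurable.liminf fun n => Finset.measurable_sum _ fun k _ => ?_
  exact (hA _ (by positivity)).edist (hA _ (by positivity))

lemma ae_boundedVariationOn (hP : IsH2Semimartingale μ 𝓕 T P L A) (hT : 0 < T) :
    ∀ᵐ ω ∂μ, BoundedVariationOn (fun t => A t ω) (Icc 0 T) := by
  have h := ae_lt_top ((hP.measurable_variation hT).pow_const 2) hP.variation_A.ne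
  filter_upwards [h] with ω hω
  intro htop
  simp [htop] at hω

/-- Since A starts at zero, its total variation dominates |A_t| for all t simultaneously. -/
lemma exists_memLp_bound (hP : IsH2Semimartingale μ 𝓕 T P L A) (hT : 0 < T) :
    ∃ V : Ω → ℝ, Measurable V ∧ MemLp V 2 μ ∧ ∀ᵐ ω ∂μ, ∀ t ∈ Icc 0 T, |A t ω| ≤ V ω := by
  have hm := hP.measurable_variation hT
  refine ⟨fun ω => (eVariationOn (fun t => A t ω) (Icc 0 T)).toReal, hm.ennreal_toReal, ?_, ?_⟩
  · refine (memLp_two_iff_integrable_sq hm.ennreal_toReal.aestronglyMeasurable).2 ?_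
    have h := integrable_toReal_of_lintegral_ne_top (hm.pow_const 2).aemeasurable hP.variation_A.ne
    simpa only [ENNReal.toReal_pow] using h
  · filter_upwards [hP.ae_boundedVariationOn hT] with ω hω t ht
    have h := hω.dist_le ht ⟨le_rfl, hT.le⟩
    simpa [Real.dist_eq, hP.A_zero ω] using h

variable [IsProbabilityMeasure μ]

lemma memLp_A (hP : IsH2Semimartingale μ 𝓕 T P L A) (hT : 0 < T) {t : ℝ} (ht : t ∈ Icc 0 T) :
    MemLp (A t) 2 μ := by
  obtain ⟨V, -, hV2, hV⟩ := hP.exists_memLp_bound hT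
  refine hV2.mono ((hP.progressive_A.stronglyAdapted ⟨t, ht.1⟩).mono (𝓕.le _)).aestronglyMeasurable ?_
  filter_upwards [hV] with ω hω
  exact (hω t ht).trans (le_abs_self _)

lemma isSqIntegrable_A (hP : IsH2Semimartingale μ 𝓕 T P L A) (hT : 0 < T) :
    IsSqIntegrable μ T A := by
  obtain ⟨V, hVm, hV2, hV⟩ := hP.exists_memLp_bound hT
  have hm := IsJointlyMeasurable.of_progressive hP.progressive_A T
  refine ⟨hm, (IsSqIntegrable.of_space (T := T) hVm hV2).memLp.mono hm.aestronglyMeasurable ?_⟩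
  have h : ∀ᵐ z ∂(timeProd μ T), ∀ t ∈ Icc 0 T, |A t z.2| ≤ V z.2 :=
    Measure.quasiMeasurePreserving_snd.ae hV
  filter_upwards [h, ae_timeProd_mem (μ := μ) (T := T)] with z h1 h2
  exact (h1 _ h2).trans (le_abs_self _)

/-- Localising sequences for `L`: stopped values are bounded in `L²` and form martingales. -/
lemma exists_localization (hP : IsH2Semimartingale μ 𝓕 T P L A) (hT : 0 ≤ T) :
    ∃ (C : ℝ) (a : ℕ → ℝ≥0 → Ω → ℝ), (∀ n, Martingale (a n) 𝓕 μ) ∧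
      (∀ n, ∀ t : ℝ≥0, (t : ℝ) ≤ T → MemLp (a n t) 2 μ ∧ ∫ ω, a n t ω ^ 2 ∂μ ≤ C) ∧
      ∀ t, ∀ᵐ ω ∂μ, ∀ᶠ n in atTop, a n t ω = L t ω := by
  obtain ⟨Q, hQ, hQT⟩ := hP.bracket_L
  obtain ⟨τ, hτ, hM⟩ := hQ.localMartingale
  have hQm : ∀ t : ℝ≥0, Measurable (Q t) := fun t =>
    ((hQ.predictable.isStronglyProgressive.stronglyAdapted t).mono (𝓕.le _)).measurable
  have hQ0 : ∀ ω, 0 ≤ Q T ω := fun ω => by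
    have := hQ.mono ω (mem_Ici.2 le_rfl) (mem_Ici.2 hT) hT
    simpa [hQ.zero] using this
  have hQTm : Measurable (Q T) := hQm ⟨T, hT⟩
  have hQTi : Integrable (Q T) μ := by
    refine ⟨hQTm.aestronglyMeasurable, ?_⟩
    rw [hasFiniteIntegral_iff_ofReal (Eventually.of_forall hQ0)]
    exact hQT
  refine ⟨(∫ ω, L 0 ω ^ 2 ∂μ) + ∫ ω, Q T ω ∂μ, fun n => stoppedProcess (onNonneg L) (τ n),
    fun n => (hM n).1, fun n t ht => ?_, fun t => ?_⟩
  · set a : Ω → ℝ := stoppedProcess (onNonneg L) (τ n) t with ha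
    set m : Ω → ℝ := stoppedProcess (onNonneg fun t ω => L t ω ^ 2 - Q t ω) (τ n) t with hm
    set q : Ω → ℝ := stoppedProcess (onNonneg Q) (τ n) t with hq
    -- The square of the stopped process is a martingale, whose mean is E[L_0²], plus the stopped
    -- bracket, which monotonicity bounds by Q_T. This gives a bound uniform in n and t.
    have haq : ∀ ω, a ω ^ 2 = m ω + q ω := fun ω => by
      simp only [ha, hm, hq, stoppedProcess, onNonneg]; ring
    have ham : AEStronglyMeasurable a μ := ((hM n).1.integrable t).aestronglyMeasurable
    have hmi : Integrable m μ := (hM n).2.integrable t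
    have hqb : ∀ ω, 0 ≤ q ω ∧ q ω ≤ Q T ω := fun ω => by
      simp only [hq, stoppedProcess, onNonneg]
      set s : ℝ≥0 := (min (t : WithTop ℝ≥0) (τ n ω)).untopA with hs
      have hst : (s : ℝ) ≤ T := by
        have h1 : min (t : WithTop ℝ≥0) (τ n ω) ≠ ⊤ := 
          ne_top_of_le_ne_top WithTop.coe_ne_top (min_le_left _ _)
        have h2 : (s : WithTop ℝ≥0) ≤ t := by
          rw [hs, WithTop.untopA_eq_untop h1, WithTop.coe_untop]; exact min_le_left _ _
        exact (NNReal.coe_le_coe.2 (WithTop.coe_le_coe.1 h2)).trans ht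
      refine ⟨?_, hQ.mono ω (mem_Ici.2 s.2) (mem_Ici.2 hT) hst⟩
      have := hQ.mono ω (mem_Ici.2 le_rfl) (mem_Ici.2 s.2) s.2
      simpa [hQ.zero] using this
    have hqm : AEStronglyMeasurable q μ := by
      have e : q = fun ω => a ω ^ 2 - m ω := funext fun ω => by rw [haq]; ring
      rw [e]
      exact (ham.pow 2).sub hmi.aestronglyMeasurable
    have hqi : Integrable q μ := hQTi.mono' hqm (Eventually.of_forall fun ω => by
      rw [Real.norm_eq_abs, abs_of_nonneg (hqb ω).1]; exact (hqb ω).2)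
    have hai : Integrable (fun ω => a ω ^ 2) μ := by
      simp_rw [haq]; exact hmi.add hqi
    refine ⟨(memLp_two_iff_integrable_sq ham).2 hai, ?_⟩
    have hm0 : ∫ ω, m ω ∂μ = ∫ ω, L 0 ω ^ 2 ∂μ := by
      have h1 := (hM n).2.setIntegral_eq (zero_le : (0 : ℝ≥0) ≤ t) MeasurableSet.univ
      rw [setIntegral_univ, setIntegral_univ] at h1
      rw [hm, ← h1]
      refine integral_congr_ae (Eventually.of_forall fun ω => ?_)
      rw [stoppedProcess_eq_of_le (by exact_mod_cast (zero_le : (0 : WithTop ℝ≥0) ≤ τ n ω))]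
      simp [onNonneg, hQ.zero]
    change ∫ ω, a ω ^ 2 ∂μ ≤ _
    simp_rw [haq]
    rw [integral_add hmi hqi, hm0]
    exact add_le_add_right (integral_mono hqi hQTi fun ω => (hqb ω).2) _
  · filter_upwards [hτ.tendsto_top] with ω hω
    have h := hω.eventually (lt_mem_nhds (WithTop.coe_lt_top t))
    filter_upwards [h] with n hn
    rw [stoppedProcess_eq_of_le hn.le]

/-- Fatou's lemma along the localising sequence preserves the uniform second moment bound. -/
lemma exists_memLp_L (hP : IsH2Semimartingale μ 𝓕 T P L A) (hT : 0 ≤ T) :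
    ∃ C : ℝ, ∀ t ∈ Icc 0 T, MemLp (L t) 2 μ ∧ ∫ ω, L t ω ^ 2 ∂μ ≤ C := by
  obtain ⟨C, a, -, ha, hlim⟩ := hP.exists_localization hT
  refine ⟨C, fun t ht => ?_⟩
  have hC : 0 ≤ C := (integral_nonneg fun _ => sq_nonneg _).trans (ha 0 0 (by simpa using hT)).2
  have hLm : StronglyMeasurable (L t) := (hP.adapted_L ⟨t, ht.1⟩).mono (𝓕.le _)
  have hb : ∫⁻ ω, ENNReal.ofReal (L t ω ^ 2) ∂μ ≤ ENNReal.ofReal C := by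
    calc ∫⁻ ω, ENNReal.ofReal (L t ω ^ 2) ∂μ
        ≤ ∫⁻ ω, liminf (fun n => ENNReal.ofReal (a n ⟨t, ht.1⟩ ω ^ 2)) atTop ∂μ := by
          refine lintegral_mono_ae ?_
          filter_upwards [hlim ⟨t, ht.1⟩] with ω hω
          refine (Tendsto.liminf_eq (tendsto_const_nhds.congr' ?_)).ge
          filter_upwards [hω] with n hn
          rw [hn]
          rfl
      _ ≤ liminf (fun n => ∫⁻ ω, ENNReal.ofReal (a n ⟨t, ht.1⟩ ω ^ 2) ∂μ) atTop :=
          lintegral_liminf_le' fun n =>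
            ((ha n ⟨t, ht.1⟩ ht.2).1.aestronglyMeasurable.aemeasurable.pow_const 2).ennreal_ofReal
      _ ≤ liminf (fun _ : ℕ => ENNReal.ofReal C) atTop := by
          refine liminf_le_liminf (Eventually.of_forall fun n => ?_)
          rw [← ofReal_integral_eq_lintegral_ofReal (ha n ⟨t, ht.1⟩ ht.2).1.integrable_sq
            (Eventually.of_forall fun _ => sq_nonneg _)]
          exact ENNReal.ofReal_le_ofReal (ha n ⟨t, ht.1⟩ ht.2).2
      _ = ENNReal.ofReal C := liminf_const _
  have hi : Integrable (fun ω => L t ω ^ 2) μ := by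
    refine ⟨(hLm.measurable.pow_const 2).aestronglyMeasurable, ?_⟩
    rw [hasFiniteIntegral_iff_ofReal (Eventually.of_forall fun _ => sq_nonneg _)]
    exact hb.trans_lt ENNReal.ofReal_lt_top
  refine ⟨(memLp_two_iff_integrable_sq hLm.aestronglyMeasurable).2 hi, ?_⟩
  rwa [← ofReal_integral_eq_lintegral_ofReal hi (Eventually.of_forall fun _ => sq_nonneg _),
    ENNReal.ofReal_le_ofReal_iff hC] at hb

lemma memLp_L (hP : IsH2Semimartingale μ 𝓕 T P L A) {t : ℝ} (ht : t ∈ Icc 0 T) :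
    MemLp (L t) 2 μ := by
  obtain ⟨C, hC⟩ := hP.exists_memLp_L (ht.1.trans ht.2)
  exact (hC t ht).1

lemma memLp_P (hP : IsH2Semimartingale μ 𝓕 T P L A) (hT : 0 < T) {t : ℝ} (ht : t ∈ Icc 0 T) :
    MemLp (P t) 2 μ := by
  have e : P t = fun ω => L t ω + A t ω := funext fun ω => hP.decomp t ht ω
  rw [e]
  exact (hP.memLp_L ht).add (hP.memLp_A hT ht)

lemma isSqIntegrable_L (hP : IsH2Semimartingale μ 𝓕 T P L A) (hT : 0 ≤ T) :
    IsSqIntegrable μ T L := by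
  obtain ⟨C, hC⟩ := hP.exists_memLp_L hT
  exact IsSqIntegrable.of_section_le (IsJointlyMeasurable.of_progressive hP.progressive_L T) hC

lemma isSqIntegrable_P (hP : IsH2Semimartingale μ 𝓕 T P L A) (hT : 0 < T) :
    IsSqIntegrable μ T P :=
  ((hP.isSqIntegrable_L hT.le).add (hP.isSqIntegrable_A hT)).congr hP.decomp

/-- The local martingale `L` is a true martingale up to time `T`. -/
lemma condExp_L (hP : IsH2Semimartingale μ 𝓕 T P L A) (hT : 0 ≤ T) {t : ℝ≥0} (ht : (t : ℝ) ≤ T) :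
    μ[L T|𝓕 t] =ᵐ[μ] L t := by
  obtain ⟨C, a, hmart, ha, hlim⟩ := hP.exists_localization hT
  -- Boundedness in L² upgrades the localisation to L¹ convergence, so the martingale identity of
  -- the stopped processes passes to the limit on each event.
  have hconv : ∀ s : ℝ≥0, (s : ℝ) ≤ T → ∀ D, MeasurableSet D →
      Tendsto (fun n => ∫ ω in D, a n s ω ∂μ) atTop (𝓝 (∫ ω in D, L s ω ∂μ)) := by
    intro s hs D hD
    have hL := hP.memLp_L (t := s) ⟨s.2, hs⟩
    have h0 := tendsto_integral_abs_sub_of_eventually_eq (fun n => (ha n s hs).1) hL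
      (fun n => (ha n s hs).2) (hlim s)
    rw [tendsto_iff_norm_sub_tendsto_zero]
    refine squeeze_zero (fun _ => norm_nonneg _) (fun n => ?_) h0
    have i1 := (ha n s hs).1.integrable one_le_two
    have i2 := hL.integrable one_le_two
    rw [← integral_sub i1.integrableOn i2.integrableOn]
    refine (norm_integral_le_integral_norm _).trans ?_
    exact setIntegral_le_integral (i1.sub i2).abs (Eventually.of_forall fun _ => abs_nonneg _)
  have hLi : Integrable (L T) μ := (hP.memLp_L ⟨hT, le_rfl⟩).integrable one_le_two
  refine (ae_eq_condExp_of_forall_setIntegral_eq (𝓕.le t) hLi ?_ ?_ ?_).symm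
  · exact fun s _ _ => ((hP.memLp_L ⟨t.2, ht⟩).integrable one_le_two).integrableOn
  · intro D hD _
    have h1 := hconv t ht D (𝓕.le t _ hD)
    have h2 := hconv ⟨T, hT⟩ le_rfl D (𝓕.le t _ hD)
    refine tendsto_nhds_unique h1 (h2.congr fun n => ?_)
    exact ((hmart n).setIntegral_eq (show t ≤ ⟨T, hT⟩ from ht) hD).symm
  · exact (hP.adapted_L t).aestronglyMeasurable

end IsH2Semimartingale

/-! ### First-order conditions and uniqueness of their solutions. -/

section Marginal

variable {Ω : Type*} {mΩ : MeasurableSpace Ω} {μ : Measure Ω} [IsProbabilityMeasure μ]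
  {𝓕 : Filtration ℝ≥0 mΩ} {p : ImpactParams}

lemma IsSqIntegrable.distortionPath {T ρ γ y : ℝ} {ν : ℝ → Ω → ℝ} (hν : IsSqIntegrable μ T ν) :
    IsSqIntegrable μ T (fun t ω => distortionPath ρ γ y (fun s => ν s ω) t) := by
  have h := (((hν.time_mul (g := fun s => γ * Real.exp (ρ * s)) (by fun_prop)).integral_zero_left).add
    (IsSqIntegrable.of_time (continuous_const (y := y)))).time_mul
      (g := fun t => Real.exp (-ρ * t)) (by fun_prop)
  refine h.congr fun t _ ω => ?_
  rw [distortionPath_eq]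
  ring

lemma distortionPath_congr_ae {T ρ γ y : ℝ} {f g : ℝ → ℝ}
    (h : ∀ᵐ s ∂(volume.restrict (Icc 0 T)), f s = g s) {t : ℝ} (ht : t ∈ Icc 0 T) :
    distortionPath ρ γ y f t = distortionPath ρ γ y g t := by
  simp only [distortionPath]
  congr 2
  refine intervalIntegral.integral_congr_ae ?_
  rw [ae_restrict_iff' measurableSet_Icc] at h
  filter_upwards [h] with s hs hst
  rw [uIoc_of_le ht.1] at hst
  rw [hs ⟨hst.1.le, hst.2.trans ht.2⟩]

lemma distortionPath_sub {T ρ γ y y' : ℝ} {f g : ℝ → ℝ} (hf : IntervalIntegrable f volume 0 T)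
    (hg : IntervalIntegrable g volume 0 T) {t : ℝ} (ht : t ∈ Icc 0 T) :
    distortionPath ρ γ y f t - distortionPath ρ γ y' g t
      = distortionPath ρ γ (y - y') (fun s => f s - g s) t := by
  have hT := ht.1.trans ht.2
  simp only [distortionPath_eq]
  rw [← sub_mul, add_sub_add_comm, ← intervalIntegral.integral_sub]
  · simp only [mul_sub]
  · exact intervalIntegrable_exp_mul (intervalIntegrable_sub_Icc hT hf ht).1 _ _
  · exact intervalIntegrable_exp_mul (intervalIntegrable_sub_Icc hT hg ht).1 _ _

lemma IsSqIntegrable.marginalPath {S v : ℝ → Ω → ℝ} {K : Ω → ℝ} (x : ℝ)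
    (hS : IsSqIntegrable μ p.T S) (hv : IsSqIntegrable μ p.T v) (hK : Measurable K)
    (hK2 : MemLp K 2 μ) :
    IsSqIntegrable μ p.T
      (fun t ω => marginalPath p (fun s => S s ω) x (K ω) (fun s => v s ω) t) := by
  have hx : IsSqIntegrable μ p.T fun _ (_ : Ω) => x := IsSqIntegrable.of_time continuous_const
  have hX := (hx.sub hv.integral_zero_left).integral_right
  have hXT := hx.sub hv.integral_total
  exact (((hS.sub (hv.const_mul (2 * p.lam))).add (hX.const_mul (2 * p.φ))).sub
    (IsSqIntegrable.of_space hK hK2)).add (hXT.const_mul (2 * p.ϱ))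

/-- The derivative of the performance of `v`, as a process. -/
noncomputable def marginal (p : ImpactParams) (P : ℝ → Ω → ℝ) (x : ℝ) (v ν : ℝ → Ω → ℝ) :
    ℝ → Ω → ℝ :=
  fun t ω => marginalPath p (fun s => executionPrice p P ν s ω) x (P p.T ω) (fun s => v s ω) t

variable {P v w ν v' ν' : ℝ → Ω → ℝ} {x : ℝ}

lemma IsSqIntegrable.executionPrice (hP : IsSqIntegrable μ p.T P) (hν : IsSqIntegrable μ p.T ν) :
    IsSqIntegrable μ p.T (executionPrice p P ν) :=
  hP.sub ((hν.distortionPath (ρ := p.ρ) (γ := p.γ) (y := p.y)).const_mul p.κ)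

lemma IsSqIntegrable.marginal (hP : IsSqIntegrable μ p.T P) (hPT : MemLp (P p.T) 2 μ)
    (x : ℝ) (hv : IsSqIntegrable μ p.T v) (hν : IsSqIntegrable μ p.T ν) :
    IsSqIntegrable μ p.T (marginal p P x v ν) :=
  (hP.executionPrice hν).marginalPath x hv
    (hP.meas.measurable_section ⟨p.T_pos.le, le_rfl⟩) hPT

lemma performance_eq (P : ℝ → Ω → ℝ) (x : ℝ) (v ν : ℝ → Ω → ℝ) : performance μ p P x v ν
    = ∫ ω, payoffPath p (fun t => executionPrice p P ν t ω) x (P p.T ω) (fun t => v t ω) ∂μ := rfl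

lemma integrable_payoffPath (hP : IsSqIntegrable μ p.T P) (hPT : MemLp (P p.T) 2 μ)
    (hv : IsSqIntegrable μ p.T v) (hν : IsSqIntegrable μ p.T ν) :
    Integrable (fun ω => payoffPath p (fun t => executionPrice p P ν t ω) x (P p.T ω)
      (fun t => v t ω)) μ := by
  have hT := p.T_pos.le
  have hx : IsSqIntegrable μ p.T fun _ (_ : Ω) => x := IsSqIntegrable.of_time continuous_const
  have hX := hx.sub hv.integral_zero_left
  have hXT : MemLp (fun ω => x - ∫ s in (0 : ℝ)..p.T, v s ω) 2 μ :=
    (memLp_const x).sub (hv.memLp_intervalIntegral ⟨le_rfl, hT⟩ ⟨hT, le_rfl⟩)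
  exact (((integrable_integral_path hT ((hP.executionPrice hν).integrable_mul hv)).sub
    ((integrable_integral_path hT hv.integrable_sq).const_mul _)).sub
      ((integrable_integral_path hT hX.integrable_sq).const_mul _)).add
        (hXT.integrable_mul (hPT.sub (hXT.const_mul _)))

lemma integrable_costPath (hw : IsSqIntegrable μ p.T w) :
    Integrable (fun ω => costPath p (fun t => w t ω)) μ := by
  have hT := p.T_pos.le
  exact (((integrable_integral_path hT hw.integrable_sq).const_mul _).add
    ((integrable_integral_path hT hw.integral_zero_left.integrable_sq).const_mul _)).add
      ((hw.memLp_intervalIntegral ⟨le_rfl, hT⟩ ⟨hT, le_rfl⟩).integrable_sq.const_mul _)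

lemma costPath_nonneg (p : ImpactParams) (w : ℝ → ℝ) : 0 ≤ costPath p w := by
  have hT := p.T_pos.le
  have := p.lam_pos
  have := p.φ_pos
  have := p.ϱ_pos
  have h1 : 0 ≤ ∫ t in (0 : ℝ)..p.T, w t ^ 2 :=
    intervalIntegral.integral_nonneg hT fun _ _ => sq_nonneg _
  have h2 : 0 ≤ ∫ t in (0 : ℝ)..p.T, (∫ s in (0 : ℝ)..t, w s) ^ 2 :=
    intervalIntegral.integral_nonneg hT fun _ _ => sq_nonneg _
  rw [costPath]
  positivity

lemma costPath_const_mul (p : ImpactParams) (ε : ℝ) (w : ℝ → ℝ) :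
    costPath p (fun t => ε * w t) = ε ^ 2 * costPath p w := by
  simp only [costPath, mul_pow, intervalIntegral.integral_const_mul]
  ring

/-- Expectation of the pathwise expansion `payoffPath_add`, with Fubini for the linear term. -/
lemma performance_add (hP : IsSqIntegrable μ p.T P) (hPT : MemLp (P p.T) 2 μ)
    (hv : IsSqIntegrable μ p.T v) (hw : IsSqIntegrable μ p.T w) (hν : IsSqIntegrable μ p.T ν) :
    performance μ p P x (fun t ω => v t ω + w t ω) ν = performance μ p P x v ν
      + (∫ z, w z.1 z.2 * marginal p P x v ν z.1 z.2 ∂(timeProd μ p.T))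
      - ∫ ω, costPath p (fun t => w t ω) ∂μ := by
  have hT := p.T_pos.le
  have hB := hP.marginal hPT x hv hν
  have hwB := hw.integrable_mul hB
  have i1 := integrable_payoffPath (x := x) hP hPT hv hν
  have i2 := integrable_integral_path hT hwB
  have i12 : Integrable (fun ω => payoffPath p (fun t => executionPrice p P ν t ω) x (P p.T ω)
      (fun t => v t ω) + ∫ s in (0 : ℝ)..p.T, w s ω * marginal p P x v ν s ω) μ := i1.add i2
  rw [integral_timeProd hT hwB, performance_eq, performance_eq, ← integral_add i1 i2,
    ← integral_sub i12 (integrable_costPath hw)]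
  refine integral_congr_ae ?_
  filter_upwards [(hP.executionPrice hν).ae_memLp_path, hv.ae_memLp_path, hw.ae_memLp_path]
    with ω h1 h2 h3
  exact payoffPath_add h1 h2 h3

/-- The first-order condition for the optimality of `v` given `ν`, in weak form. -/
def IsStationaryRate (μ : Measure Ω) (𝓕 : Filtration ℝ≥0 mΩ) (p : ImpactParams) (P : ℝ → Ω → ℝ)
    (x : ℝ) (v ν : ℝ → Ω → ℝ) : Prop :=
  ∀ w, IsAdmissible μ 𝓕 p.T w →
    ∫ z, w z.1 z.2 * marginal p P x v ν z.1 z.2 ∂(timeProd μ p.T) = 0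

/-- In each direction w the performance at v + εw is a polynomial in ε of degree at most two with
nonpositive quadratic coefficient. It is maximal at ε = 0 exactly when its linear coefficient
vanishes. -/
lemma isOptimal_iff_isStationary (hP : IsSqIntegrable μ p.T P) (hPT : MemLp (P p.T) 2 μ)
    (hv : IsAdmissible μ 𝓕 p.T v) (hν : IsAdmissible μ 𝓕 p.T ν) :
    (∀ w, IsAdmissible μ 𝓕 p.T w → performance μ p P x w ν ≤ performance μ p P x v ν)
      ↔ IsStationaryRate μ 𝓕 p P x v ν := by
  have hC : ∀ w : ℝ → Ω → ℝ, 0 ≤ ∫ ω, costPath p (fun t => w t ω) ∂μ := fun w =>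
    integral_nonneg fun ω => costPath_nonneg p _
  constructor
  · intro h w hw
    set G := ∫ z, w z.1 z.2 * marginal p P x v ν z.1 z.2 ∂(timeProd μ p.T) with hG
    set C := ∫ ω, costPath p (fun t => w t ω) ∂μ with hCdef
    have h0 : 0 ≤ C := hC w
    have key : ∀ ε : ℝ, ε * G ≤ ε ^ 2 * C := fun ε => by
      have hεw : IsAdmissible μ 𝓕 p.T fun t ω => ε * w t ω := hw.time_mul continuous_const
      have h1 := h _ (hv.add hεw)
      rw [performance_add hP hPT hv.isSqIntegrable hεw.isSqIntegrable hν.isSqIntegrable] at h1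
      simp_rw [costPath_const_mul, mul_assoc, integral_const_mul] at h1
      linarith
    -- A step proportional to G makes the linear gain beat the quadratic cost unless G = 0; the
    -- added 1 covers C = 0.
    have h1 := key (G / (C + 1))
    have hC1 : 0 < C + 1 := by linarith
    have e : (G / (C + 1)) ^ 2 * C - G / (C + 1) * G = -(G / (C + 1)) ^ 2 := by
      field_simp; ring
    have h2 : (G / (C + 1)) ^ 2 ≤ 0 := by linarith
    have h3 : G / (C + 1) = 0 := by
      simpa using le_antisymm h2 (sq_nonneg _)
    simpa [hC1.ne'] using h3
  · intro h w hw
    have hwv := hw.sub hv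
    have e : w = fun t ω => v t ω + (w t ω - v t ω) := by ext; ring
    rw [e, performance_add hP hPT hv.isSqIntegrable hwv.isSqIntegrable hν.isSqIntegrable, h _ hwv]
    have := hC fun t ω => w t ω - v t ω
    linarith

/-- Testing both conditions with v - v' makes the pairing with the difference of marginals vanish,
while dissipativity bounds it by -2λ ‖v - v'‖². The assumption `hpos` covers both uses: it is
trivial for equal flows, and it is positivity of the impact kernel when the flows are the rates
themselves. -/
lemma ae_eq_of_isStationary (hP : IsSqIntegrable μ p.T P) (hPT : MemLp (P p.T) 2 μ)
    (hv : IsAdmissible μ 𝓕 p.T v) (hv' : IsAdmissible μ 𝓕 p.T v')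
    (hν : IsSqIntegrable μ p.T ν) (hν' : IsSqIntegrable μ p.T ν')
    (h : IsStationaryRate μ 𝓕 p P x v ν) (h' : IsStationaryRate μ 𝓕 p P x v' ν')
    (hpos : ∀ᵐ ω ∂μ, 0 ≤ ∫ t in (0 : ℝ)..p.T, (v t ω - v' t ω)
      * distortionPath p.ρ p.γ 0 (fun s => ν s ω - ν' s ω) t) :
    ∀ᵐ z ∂(timeProd μ p.T), v z.1 z.2 = v' z.1 z.2 := by
  have hT := p.T_pos.le
  have hw := (hv.sub hv').isSqIntegrable
  have hB := hP.marginal hPT x hv.isSqIntegrable hν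
  have hB' := hP.marginal hPT x hv'.isSqIntegrable hν'
  have h0 : ∫ z, (v z.1 z.2 - v' z.1 z.2)
      * (marginal p P x v ν z.1 z.2 - marginal p P x v' ν' z.1 z.2) ∂(timeProd μ p.T) = 0 := by
    simp_rw [mul_sub (_ - _)]
    rw [integral_sub (hw.integrable_mul hB) (hw.integrable_mul hB'), h _ (hv.sub hv'),
      h' _ (hv.sub hv'), sub_zero]
  have hle : ∫ z, (v z.1 z.2 - v' z.1 z.2)
      * (marginal p P x v ν z.1 z.2 - marginal p P x v' ν' z.1 z.2) ∂(timeProd μ p.T)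
      ≤ -(2 * p.lam) * ∫ z, (v z.1 z.2 - v' z.1 z.2) ^ 2 ∂(timeProd μ p.T) := by
    have i1 := hw.integrable_mul (hB.sub hB')
    rw [integral_timeProd hT i1, integral_timeProd hT hw.integrable_sq, ← integral_const_mul]
    refine integral_mono_ae (integrable_integral_path hT i1)
      ((integrable_integral_path hT hw.integrable_sq).const_mul _) ?_
    filter_upwards [hpos, hv.isSqIntegrable.ae_memLp_path, hv'.isSqIntegrable.ae_memLp_path,
      hν.ae_memLp_path, hν'.ae_memLp_path,
      ((hν.sub hν').distortionPath (ρ := p.ρ) (γ := p.γ) (y := 0)).ae_memLp_path]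
      with ω h1 h2 h3 h4 h5 h6
    have h2' := intervalIntegrable_of_memLp hT h2
    have h3' := intervalIntegrable_of_memLp hT h3
    refine le_of_eq_of_le ?_ (integral_mul_marginalPath_self_le (h2.sub h3) h6 h1)
    refine intervalIntegral.integral_congr fun t ht => ?_
    rw [uIcc_of_le hT] at ht
    simp only [marginal]
    rw [marginalPath_sub h2' h3' ht, sub_self, sub_self]
    simp only [marginalPath, executionPrice, Pi.sub_apply]
    have e := distortionPath_sub (ρ := p.ρ) (γ := p.γ) (y := p.y) (y' := p.y)
      (intervalIntegrable_of_memLp hT h4) (intervalIntegrable_of_memLp hT h5) ht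
    rw [sub_self] at e
    change _ * (P t ω - p.κ * distortionPath p.ρ p.γ p.y (fun s => ν s ω) t
      - (P t ω - p.κ * distortionPath p.ρ p.γ p.y (fun s => ν' s ω) t) - _ + _ - _ + _) = _
    rw [← e]
    ring
  have hz : ∫ z, (v z.1 z.2 - v' z.1 z.2) ^ 2 ∂(timeProd μ p.T) = 0 := by
    refine le_antisymm ?_ (integral_nonneg fun _ => sq_nonneg _)
    rw [h0] at hle
    have := p.lam_pos
    by_contra! hcon
    nlinarith [mul_pos this hcon]
  rw [integral_eq_zero_iff_of_nonneg (fun _ => sq_nonneg _) hw.integrable_sq] at hz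
  filter_upwards [hz] with z hz
  simpa [sub_eq_zero] using hz

/-- The best response to a given flow is unique. -/
lemma ae_eq_of_isStationary_same_flow (hP : IsSqIntegrable μ p.T P) (hPT : MemLp (P p.T) 2 μ)
    (hv : IsAdmissible μ 𝓕 p.T v) (hv' : IsAdmissible μ 𝓕 p.T v') (hν : IsSqIntegrable μ p.T ν)
    (h : IsStationaryRate μ 𝓕 p P x v ν) (h' : IsStationaryRate μ 𝓕 p P x v' ν) :
    ∀ᵐ z ∂(timeProd μ p.T), v z.1 z.2 = v' z.1 z.2 := by
  refine ae_eq_of_isStationary hP hPT hv hv' hν hν h h' (Eventually.of_forall fun ω => ?_)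
  simp [distortionPath]

/-- A rate which is a best response to the flow it generates is unique. -/
lemma ae_eq_of_isStationary_self (hP : IsSqIntegrable μ p.T P) (hPT : MemLp (P p.T) 2 μ)
    (hv : IsAdmissible μ 𝓕 p.T v) (hv' : IsAdmissible μ 𝓕 p.T v')
    (hν : IsSqIntegrable μ p.T ν) (hν' : IsSqIntegrable μ p.T ν')
    (h : IsStationaryRate μ 𝓕 p P x v ν) (h' : IsStationaryRate μ 𝓕 p P x v' ν')
    (hνv : ∀ᵐ z ∂(timeProd μ p.T), ν z.1 z.2 = v z.1 z.2)
    (hνv' : ∀ᵐ z ∂(timeProd μ p.T), ν' z.1 z.2 = v' z.1 z.2) :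
    ∀ᵐ z ∂(timeProd μ p.T), v z.1 z.2 = v' z.1 z.2 := by
  have hT := p.T_pos.le
  refine ae_eq_of_isStationary hP hPT hv hv' hν hν' h h' ?_
  filter_upwards [ae_ae_of_ae_timeProd hνv, ae_ae_of_ae_timeProd hνv',
    (hv.sub hv').isSqIntegrable.ae_memLp_path] with ω h1 h2 h3
  refine (integral_mul_distortionPath_nonneg hT p.ρ_pos.le p.γ_pos
    (intervalIntegrable_of_memLp hT h3)).trans_eq ?_
  refine intervalIntegral.integral_congr fun t ht => ?_
  rw [uIcc_of_le hT] at ht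
  rw [distortionPath_congr_ae (T := p.T) (f := fun s => v s ω - v' s ω)
    (g := fun s => ν s ω - ν' s ω) ?_ ht]
  filter_upwards [h1, h2] with s e1 e2
  rw [e1, e2]

/-- The first-order condition for the optimality of `v` given `ν`, in conditional form. -/
def IsConditionallyStationary (μ : Measure Ω) (𝓕 : Filtration ℝ≥0 mΩ) (p : ImpactParams)
    (P : ℝ → Ω → ℝ) (x : ℝ) (v ν : ℝ → Ω → ℝ) : Prop :=
  ∀ t : ℝ≥0, (t : ℝ) ≤ p.T → Integrable (marginal p P x v ν t) μ ∧
    μ[marginal p P x v ν t|𝓕 t] =ᵐ[μ] 0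

/-- For almost every t, w_t is `𝓕 t`-measurable and square integrable, so E[w_t B_t] = E[w_t
E_t[B_t]] = 0; then Fubini. -/
lemma integral_mul_eq_zero_of_condExp {T : ℝ} {B : ℝ → Ω → ℝ} (hB : IsSqIntegrable μ T B)
    (hce : ∀ t : ℝ≥0, (t : ℝ) ≤ T → μ[B t|𝓕 t] =ᵐ[μ] 0) (hw : IsAdmissible μ 𝓕 T w) :
    ∫ z, w z.1 z.2 * B z.1 z.2 ∂(timeProd μ T) = 0 := by
  have hi := hw.isSqIntegrable.integrable_mul hB
  rw [timeProd, integral_prod _ hi]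
  refine integral_eq_zero_of_ae ?_
  filter_upwards [hB.ae_memLp_section, hw.isSqIntegrable.ae_memLp_section,
    ae_restrict_mem measurableSet_Icc] with t h1 h2 ht
  refine (integral_mul_condExp_eq (𝓕.le ⟨t, ht.1⟩)
    (hw.progressive.stronglyAdapted ⟨t, ht.1⟩) h2 h1).trans ?_
  refine integral_eq_zero_of_ae ?_
  have h3 : μ[B t|𝓕 ⟨t, ht.1⟩] =ᵐ[μ] 0 := hce ⟨t, ht.1⟩ ht.2
  filter_upwards [h3] with ω hω
  rw [hω]
  simp

lemma IsConditionallyStationary.isStationary (hP : IsSqIntegrable μ p.T P)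
    (hPT : MemLp (P p.T) 2 μ) (hv : IsSqIntegrable μ p.T v) (hν : IsSqIntegrable μ p.T ν)
    (h : IsConditionallyStationary μ 𝓕 p P x v ν) : IsStationaryRate μ 𝓕 p P x v ν := fun _ hw =>
  integral_mul_eq_zero_of_condExp (hP.marginal hPT x hv hν) (fun t ht => (h t ht).2) hw

end Marginal

/-! ### The aggregated system as a first-order condition. -/

section Aggregated

variable {Ω : Type*} {mΩ : MeasurableSpace Ω} {μ : Measure Ω} [IsProbabilityMeasure μ]
  {𝓕 : Filtration ℝ≥0 mΩ} {p : ImpactParams} {P L A X Y ν v : ℝ → Ω → ℝ} {x xbar : ℝ}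

lemma IsSqIntegrable.ae_intervalIntegrable (hv : IsSqIntegrable μ p.T v) :
    ∀ᵐ ω ∂μ, IntervalIntegrable (fun s => v s ω) volume 0 p.T := by
  filter_upwards [hv.ae_memLp_path] with ω hω
  exact intervalIntegrable_of_memLp p.T_pos.le hω

namespace IsAggregatedSolution

lemma ae_eq_distortion (h : IsAggregatedSolution μ 𝓕 p P xbar X Y ν) :
    ∀ᵐ ω ∂μ, ∀ t ∈ Icc 0 p.T, Y t ω = distortion p ν t ω := by
  filter_upwards [h.forward_Y, h.admissible.isSqIntegrable.ae_intervalIntegrable] with ω h1 h2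
  exact eq_distortionPath_of_ode h2 h1

/-- Along a solution of the aggregated system the marginal payoff is a martingale increment. -/
lemma exists_martingale (h : IsAggregatedSolution μ 𝓕 p P xbar X Y ν) :
    ∃ M : ℝ → Ω → ℝ, Martingale (onNonneg M) 𝓕 μ ∧ ∀ t ∈ Icc 0 p.T,
      marginal p P xbar ν ν t =ᵐ[μ] fun ω => 2 * p.lam * (M p.T ω - M t ω) := by
  obtain ⟨M, hM, -, hback⟩ := h.backward
  refine ⟨M, hM, fun t ht => ?_⟩
  have hT := p.T_pos.le
  filter_upwards [hback t ht, hback p.T ⟨hT, le_rfl⟩, h.terminal, h.forward_X,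
    h.ae_eq_distortion, h.admissible.isSqIntegrable.ae_intervalIntegrable]
    with ω h1 h2 h3 hX hY hν
  have hDc := intervalIntegrable_of_continuousOn_Icc hT
    (continuousOn_distortionPath (ρ := p.ρ) (γ := p.γ) (y := p.y) hT hν)
  have hXc := intervalIntegrable_of_continuousOn_Icc hT (continuousOn_inventoryPath (x := xbar) hT hν)
  set D : ℝ → ℝ := distortionPath p.ρ p.γ p.y (fun s => ν s ω) with hD
  set I : ℝ → ℝ := fun t => xbar - ∫ s in (0 : ℝ)..t, ν s ω with hI
  have hl := p.lam_pos.ne'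
  -- The first two drift terms are -κ/(2λ) times the drift of Y, so they integrate to an increment
  -- of Y.
  have key : ∀ t ∈ Icc 0 p.T, ∫ s in (0 : ℝ)..t, (p.κ * p.ρ / (2 * p.lam) * Y s ω
            - p.κ * p.γ / (2 * p.lam) * ν s ω - p.φ / p.lam * X s ω)
        = -(p.κ / (2 * p.lam)) * (D t - p.y) - p.φ / p.lam * ∫ s in (0 : ℝ)..t, I s := by
    intro t ht
    have i1 := (intervalIntegrable_sub_Icc hT ((hDc.const_mul (-p.ρ)).add (hν.const_mul p.γ)) ht).1
    have i2 := (intervalIntegrable_sub_Icc hT hXc ht).1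
    have e := distortionPath_ode (ρ := p.ρ) (γ := p.γ) (y := p.y) hν ht
    rw [← hD] at e
    rw [e, add_sub_cancel_left, ← intervalIntegral.integral_const_mul,
      ← intervalIntegral.integral_const_mul,
      ← intervalIntegral.integral_sub (i1.const_mul _) (i2.const_mul _)]
    refine intervalIntegral.integral_congr fun s hs => ?_
    rw [uIcc_of_le ht.1] at hs
    have hs' : s ∈ Icc 0 p.T := ⟨hs.1, hs.2.trans ht.2⟩
    rw [hX s hs', hY s hs']
    change _ * D s - _ - _ * I s = _
    field_simp
    ring
  rw [key t ht] at h1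
  rw [key p.T ⟨hT, le_rfl⟩] at h2
  rw [hX _ ⟨hT, le_rfl⟩, hY _ ⟨hT, le_rfl⟩] at h3
  have hsplit := intervalIntegral.integral_add_adjacent_intervals
    (intervalIntegrable_sub_Icc hT hXc ht).1 (intervalIntegrable_sub_Icc hT hXc ht).2
  change ν p.T ω = p.ϱ / p.lam * I p.T - p.κ / (2 * p.lam) * D p.T at h3
  change P t ω - p.κ * D t - 2 * p.lam * ν t ω + 2 * p.φ * (∫ s in t..p.T, I s) - P p.T ω
    + 2 * p.ϱ * I p.T = _
  rw [← hsplit] at h2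
  generalize (∫ s in t..p.T, I s) = a at *
  generalize (∫ s in (0 : ℝ)..t, I s) = b at *
  rw [h2] at h3
  field_simp at h1 h3 ⊢
  linear_combination -h1 - h3

/-- The increment of a martingale from t to T has zero conditional mean at time t. -/
lemma isConditionallyStationary (h : IsAggregatedSolution μ 𝓕 p P xbar X Y ν) :
    IsConditionallyStationary μ 𝓕 p P xbar ν ν := by
  obtain ⟨M, hM, hB⟩ := h.exists_martingale
  intro t ht
  have hBt := hB t ⟨t.2, ht⟩
  have hMT : Integrable (M p.T) μ := hM.integrable ⟨p.T, p.T_pos.le⟩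
  have hMt : Integrable (M t) μ := hM.integrable t
  have hi : Integrable (fun ω => 2 * p.lam * (M p.T ω - M t ω)) μ := (hMT.sub hMt).const_mul _
  refine ⟨hi.congr hBt.symm, ?_⟩
  have h1 : μ[M p.T|𝓕 t] =ᵐ[μ] M t := hM.condExp_ae_eq (show t ≤ ⟨p.T, p.T_pos.le⟩ from ht)
  have h2 : μ[M t|𝓕 t] = M t := condExp_of_stronglyMeasurable (𝓕.le t) (hM.stronglyAdapted t) hMt
  have h3 := condExp_smul (2 * p.lam) (M p.T - M t) (𝓕 t) (μ := μ)
  have h4 := condExp_sub hMT hMt (𝓕 t)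
  refine (condExp_congr_ae hBt).trans ?_
  have e : (fun ω => 2 * p.lam * (M p.T ω - M t ω)) = (2 * p.lam) • (M p.T - M t) := rfl
  rw [e]
  filter_upwards [h1, h3, h4] with ω k1 k3 k4
  rw [k3, Pi.smul_apply, k4, Pi.sub_apply, k1, h2]
  simp

end IsAggregatedSolution

/-- Converse to `IsAggregatedSolution.exists_martingale`. -/
lemma isAggregatedSolution_of_martingale (hν : IsAdmissible μ 𝓕 p.T ν) {M : ℝ → Ω → ℝ}
    (hM : Martingale (onNonneg M) 𝓕 μ) (hM2 : ∀ t, 0 ≤ t → MemLp (M t) 2 μ)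
    (hB : ∀ t ∈ Icc 0 p.T,
      marginal p P xbar ν ν t =ᵐ[μ] fun ω => 2 * p.lam * (M p.T ω - M t ω)) :
    IsAggregatedSolution μ 𝓕 p P xbar (inventory xbar ν) (distortion p ν) ν := by
  have hT := p.T_pos.le
  have hl := p.lam_pos.ne'
  refine ⟨hν, Eventually.of_forall fun ω t _ => rfl, ?_, ⟨M, hM, hM2, fun t ht => ?_⟩, ?_⟩
  · filter_upwards [hν.isSqIntegrable.ae_intervalIntegrable] with ω hω t ht
    exact distortionPath_ode hω ht
  · filter_upwards [hB t ht, hB 0 ⟨le_rfl, hT⟩, hν.isSqIntegrable.ae_intervalIntegrable]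
      with ω h1 h2 hω
    have hDc := intervalIntegrable_of_continuousOn_Icc hT
      (continuousOn_distortionPath (ρ := p.ρ) (γ := p.γ) (y := p.y) hT hω)
    have hXc := intervalIntegrable_of_continuousOn_Icc hT
      (continuousOn_inventoryPath (x := xbar) hT hω)
    have e := distortionPath_ode (ρ := p.ρ) (γ := p.γ) (y := p.y) hω ht
    have hD0 := distortionPath_zero p.ρ p.γ p.y (fun s => ν s ω)
    set D : ℝ → ℝ := distortionPath p.ρ p.γ p.y (fun s => ν s ω) with hD
    set I : ℝ → ℝ := fun t => xbar - ∫ s in (0 : ℝ)..t, ν s ω with hI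
    have i1 := (intervalIntegrable_sub_Icc hT ((hDc.const_mul (-p.ρ)).add (hω.const_mul p.γ)) ht).1
    have i2 := (intervalIntegrable_sub_Icc hT hXc ht).1
    have key : ∫ s in (0 : ℝ)..t, (p.κ * p.ρ / (2 * p.lam) * distortion p ν s ω
            - p.κ * p.γ / (2 * p.lam) * ν s ω - p.φ / p.lam * inventory xbar ν s ω)
        = -(p.κ / (2 * p.lam)) * (D t - p.y) - p.φ / p.lam * ∫ s in (0 : ℝ)..t, I s := by
      rw [e, add_sub_cancel_left, ← intervalIntegral.integral_const_mul,
        ← intervalIntegral.integral_const_mul,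
        ← intervalIntegral.integral_sub (i1.const_mul _) (i2.const_mul _)]
      refine intervalIntegral.integral_congr fun s hs => ?_
      change _ * D s - _ - _ * I s = _
      field_simp
      ring
    rw [key]
    have hsplit := intervalIntegral.integral_add_adjacent_intervals
      (intervalIntegrable_sub_Icc hT hXc ht).1 (intervalIntegrable_sub_Icc hT hXc ht).2
    change P t ω - p.κ * D t - 2 * p.lam * ν t ω + 2 * p.φ * (∫ s in t..p.T, I s) - P p.T ω
      + 2 * p.ϱ * I p.T = _ at h1
    change P 0 ω - p.κ * D 0 - 2 * p.lam * ν 0 ω + 2 * p.φ * (∫ s in (0 : ℝ)..p.T, I s) - P p.T ω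
      + 2 * p.ϱ * I p.T = _ at h2
    rw [← hsplit, hD0] at h2
    field_simp
    linear_combination h2 - h1
  · filter_upwards [hB p.T ⟨hT, le_rfl⟩] with ω h1
    change P p.T ω - p.κ * distortion p ν p.T ω - 2 * p.lam * ν p.T ω
      + 2 * p.φ * (∫ s in p.T..p.T, inventory xbar ν s ω) - P p.T ω
      + 2 * p.ϱ * inventory xbar ν p.T ω = _ at h1
    rw [intervalIntegral.integral_same] at h1
    field_simp
    linear_combination -h1

end Aggregated

/-! ### From a weak first-order condition to a solution of the FBSDE. -/

section Regularisation

variable {Ω : Type*} {mΩ : MeasurableSpace Ω} {μ : Measure Ω} [IsProbabilityMeasure μ]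
  {𝓕 : Filtration ℝ≥0 mΩ} {p : ImpactParams} {P L A ν ν' v v' : ℝ → Ω → ℝ} {x xbar : ℝ}

lemma progressive_distortion (hν : IsStronglyProgressive 𝓕 (onNonneg ν)) :
    IsStronglyProgressive 𝓕 (onNonneg (distortion p ν)) := by
  have h1 := progressive_integral (progressive_mul (progressive_of_time (𝓕 := 𝓕)
    (g := fun s => p.γ * Real.exp (p.ρ * s)) (by fun_prop)) hν)
  have h2 := progressive_mul (progressive_add (progressive_of_time (𝓕 := 𝓕)
    (g := fun _ => p.y) (by fun_prop)) h1)
      (progressive_of_time (𝓕 := 𝓕) (g := fun t => Real.exp (-p.ρ * t)) (by fun_prop))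
  have e : distortion p ν = fun t ω => (p.y + ∫ s in (0 : ℝ)..t,
      p.γ * Real.exp (p.ρ * s) * ν s ω) * Real.exp (-p.ρ * t) :=
    funext fun t => funext fun ω => distortionPath_eq _ _ _ _ _
  rw [e]
  exact h2

/-- A square integrable martingale has a version that is progressively measurable and square
integrable over time. -/
lemma exists_isAdmissible_condExp [𝓕.IsRightContinuous] {K : Ω → ℝ} (hK : MemLp K 2 μ) (T : ℝ) :
    ∃ m : ℝ → Ω → ℝ, IsAdmissible μ 𝓕 T m ∧ ∀ t : ℝ≥0, m t =ᵐ[μ] μ[K|𝓕 t] := by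
  obtain ⟨m, hm, hmK⟩ := exists_progressive_condExp 𝓕 hK
  have e : onNonneg (fun t : ℝ => m t.toNNReal) = m := by
    ext t ω; simp [onNonneg]
  have hp : IsStronglyProgressive 𝓕 (onNonneg fun t : ℝ => m t.toNNReal) := by rwa [e]
  refine ⟨fun t => m t.toNNReal, isAdmissible_iff.2 ⟨hp, ?_⟩, fun t => ?_⟩
  · refine IsSqIntegrable.of_section_le (C := ∫ ω, K ω ^ 2 ∂μ)
      (IsJointlyMeasurable.of_progressive hp T) fun t _ => ?_
    have h1 := hmK t.toNNReal
    have h2 : MemLp (μ[K|𝓕 t.toNNReal]) 2 μ := hK.condExp one_le_two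
    refine ⟨h2.ae_eq h1.symm, ?_⟩
    -- Pythagoras with the full σ-algebra as the finer one: conditioning contracts L², so the bound
    -- by E[K²] is uniform in t.
    have h3 := integral_sq_condExp_sub (𝓕.le t.toNNReal) le_rfl hK
    have h4 : μ[K|mΩ] =ᵐ[μ] K := condExp_of_aestronglyMeasurable' le_rfl
      hK.aestronglyMeasurable (hK.integrable one_le_two)
    have h5 : ∫ ω, (μ[K|mΩ]) ω ^ 2 ∂μ = ∫ ω, K ω ^ 2 ∂μ := integral_congr_ae (by
      filter_upwards [h4] with ω hω; rw [hω])
    have h6 : ∫ ω, m t.toNNReal ω ^ 2 ∂μ = ∫ ω, (μ[K|𝓕 t.toNNReal]) ω ^ 2 ∂μ :=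
      integral_congr_ae (by filter_upwards [h1] with ω hω; rw [hω])
    rw [h6, ← h5]
    have h7 : 0 ≤ ∫ ω, ((μ[K|mΩ]) ω - (μ[K|𝓕 t.toNNReal]) ω) ^ 2 ∂μ :=
      integral_nonneg fun _ => sq_nonneg _
    linarith
  · simpa using hmK t

lemma intervalIntegral_eq_of_ae_Icc {f g : ℝ → ℝ} {t T : ℝ}
    (h : ∀ᵐ s ∂(volume.restrict (Icc 0 T)), f s = g s) (ht : t ∈ Icc 0 T) :
    ∫ s in (0 : ℝ)..t, f s = ∫ s in (0 : ℝ)..t, g s := by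
  refine intervalIntegral.integral_congr_ae ?_
  rw [ae_restrict_iff' measurableSet_Icc] at h
  filter_upwards [h] with s hs hst
  rw [uIoc_of_le ht.1] at hst
  exact hs ⟨hst.1.le, hst.2.trans ht.2⟩

lemma ae_integral_eq_of_ae_eq (h : ∀ᵐ z ∂(timeProd μ p.T), v z.1 z.2 = v' z.1 z.2) :
    ∀ᵐ ω ∂μ, ∀ t ∈ Icc 0 p.T, ∫ s in (0 : ℝ)..t, v s ω = ∫ s in (0 : ℝ)..t, v' s ω := by
  filter_upwards [ae_ae_of_ae_timeProd h] with ω hω t ht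
  exact intervalIntegral_eq_of_ae_Icc hω ht

lemma ae_distortion_eq_of_ae_eq (h : ∀ᵐ z ∂(timeProd μ p.T), ν z.1 z.2 = ν' z.1 z.2) :
    ∀ᵐ ω ∂μ, ∀ t ∈ Icc 0 p.T, distortion p ν t ω = distortion p ν' t ω := by
  filter_upwards [ae_ae_of_ae_timeProd h] with ω hω t ht
  exact distortionPath_congr_ae hω ht

/-- Weak stationarity ignores dt ⊗ dℙ-null sets, whereas the backward equation must hold almost
surely at each fixed time. The remedy is to define the rate at time t by solving E_t[B_t] = 0; this
changes it only on a null set, and its marginal is then a martingale increment. -/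
theorem exists_isAggregatedSolution_of_isStationaryRate [𝓕.IsRightContinuous]
    (hP : IsH2Semimartingale μ 𝓕 p.T P L A) (hν : IsAdmissible μ 𝓕 p.T ν)
    (hstat : IsStationaryRate μ 𝓕 p P xbar ν ν) :
    ∃ X Y ν : ℝ → Ω → ℝ, IsAggregatedSolution μ 𝓕 p P xbar X Y ν := by
  have hT := p.T_pos.le
  have hl := p.lam_pos.ne'
  have hTm : p.T ∈ Icc 0 p.T := ⟨hT, le_rfl⟩
  have hνS := hν.isSqIntegrable
  have hX : IsAdmissible μ 𝓕 p.T (inventory xbar ν) :=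
    (IsAdmissible.of_time (continuous_const (y := xbar))).sub hν.integral_zero_left
  -- The part of the marginal that does not depend on t: B_t is K plus the adapted process P_t -
  -- κY_t - 2λν_t - 2φ ∫_0^t X.
  set K : Ω → ℝ := fun ω => -(L p.T ω + A p.T ω)
    + 2 * p.φ * (∫ s in (0 : ℝ)..p.T, inventory xbar ν s ω)
    + 2 * p.ϱ * inventory xbar ν p.T ω with hKdef
  have hK2 : MemLp K 2 μ :=
    ((((hP.memLp_L hTm).add (hP.memLp_A p.T_pos hTm)).neg).add
      ((hX.isSqIntegrable.memLp_intervalIntegral ⟨le_rfl, hT⟩ hTm).const_mul _)).add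
      (((memLp_const xbar).sub (hνS.memLp_intervalIntegral ⟨le_rfl, hT⟩ hTm)).const_mul _)
  have hKm : StronglyMeasurable[𝓕 ⟨p.T, hT⟩] K :=
    ((((hP.progressive_L.stronglyAdapted ⟨p.T, hT⟩).add
      (hP.progressive_A.stronglyAdapted ⟨p.T, hT⟩)).neg).add
      ((hX.integral_zero_left.progressive.stronglyAdapted ⟨p.T, hT⟩).const_mul _)).add
      ((hX.progressive.stronglyAdapted ⟨p.T, hT⟩).const_mul _)
  obtain ⟨m, hm, hmK⟩ := exists_isAdmissible_condExp (𝓕 := 𝓕) hK2 p.T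
  have hLA : IsAdmissible μ 𝓕 p.T fun t ω => L t ω + A t ω := isAdmissible_iff.2
    ⟨progressive_add hP.progressive_L hP.progressive_A,
      (hP.isSqIntegrable_L hT).add (hP.isSqIntegrable_A p.T_pos)⟩
  have hY : IsAdmissible μ 𝓕 p.T (distortion p ν) := isAdmissible_iff.2
    ⟨progressive_distortion hν.progressive,
      hνS.distortionPath (ρ := p.ρ) (γ := p.γ) (y := p.y)⟩
  -- With K replaced by the progressive version `m` of E_t[K], the equation B_t = 0 is solved for
  -- the rate.
  set ν' : ℝ → Ω → ℝ := fun t ω => (2 * p.lam)⁻¹ * (L t ω + A t ω - p.κ * distortion p ν t ω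
    - 2 * p.φ * (∫ s in (0 : ℝ)..t, inventory xbar ν s ω) + m t ω) with hν'def
  have hν' : IsAdmissible μ 𝓕 p.T ν' :=
    (((hLA.sub (hY.time_mul (continuous_const (y := p.κ)))).sub
      (hX.integral_zero_left.time_mul (continuous_const (y := 2 * p.φ)))).add hm).time_mul
        (continuous_const (y := (2 * p.lam)⁻¹))
  have hPS := hP.isSqIntegrable_P p.T_pos
  have hPT := hP.memLp_P p.T_pos hTm
  -- the marginal payoff in terms of the regularised rate
  have hmarg : ∀ᵐ ω ∂μ, ∀ t ∈ Icc 0 p.T,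
      marginal p P xbar ν ν t ω = 2 * p.lam * (ν' t ω - ν t ω) + (K ω - m t ω) := by
    filter_upwards [hX.isSqIntegrable.ae_intervalIntegrable] with ω hω t ht
    have hsplit := intervalIntegral.integral_add_adjacent_intervals
      (intervalIntegrable_sub_Icc hT hω ht).1 (intervalIntegrable_sub_Icc hT hω ht).2
    change P t ω - p.κ * distortion p ν t ω - 2 * p.lam * ν t ω
      + 2 * p.φ * (∫ s in t..p.T, inventory xbar ν s ω) - P p.T ω
      + 2 * p.ϱ * inventory xbar ν p.T ω = _
    simp only [hν'def, hKdef, ← hsplit]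
    rw [hP.decomp t ht, hP.decomp p.T hTm]
    field_simp
    ring
  have hKS : IsSqIntegrable μ p.T fun _ => K :=
    IsSqIntegrable.of_space (hKm.measurable.mono (𝓕.le _) le_rfl) hK2
  have hKmS : IsSqIntegrable μ p.T fun t ω => K ω - m t ω := hKS.sub hm.isSqIntegrable
  have hw := hν'.sub hν
  have horth : ∫ z, (ν' z.1 z.2 - ν z.1 z.2) * (K z.2 - m z.1 z.2) ∂(timeProd μ p.T) = 0 := by
    refine integral_mul_eq_zero_of_condExp hKmS (fun t ht => ?_) hw
    have hKi := hK2.integrable one_le_two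
    have e : μ[(fun ω => K ω - m t ω)|𝓕 t] =ᵐ[μ] μ[K - μ[K|𝓕 t]|𝓕 t] :=
      condExp_congr_ae (by filter_upwards [hmK t] with ω hω; simp [hω])
    have h1 := condExp_sub hKi (integrable_condExp (m := 𝓕 t) (f := K)) (𝓕 t)
    have h2 : μ[μ[K|𝓕 t]|𝓕 t] = μ[K|𝓕 t] :=
      condExp_of_stronglyMeasurable (𝓕.le t) stronglyMeasurable_condExp integrable_condExp
    refine e.trans (h1.trans ?_)
    rw [h2, sub_self]
  -- Stationarity is tested with ν' - ν. Since K - E_t[K] is orthogonal to admissible rates, only 2λ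
  -- ‖ν' - ν‖² = 0 remains.
  have hνν' : ∀ᵐ z ∂(timeProd μ p.T), ν' z.1 z.2 = ν z.1 z.2 := by
    have h0 := hstat _ hw
    have e : ∫ z, (ν' z.1 z.2 - ν z.1 z.2) * marginal p P xbar ν ν z.1 z.2 ∂(timeProd μ p.T)
        = 2 * p.lam * (∫ z, (ν' z.1 z.2 - ν z.1 z.2) ^ 2 ∂(timeProd μ p.T))
          + ∫ z, (ν' z.1 z.2 - ν z.1 z.2) * (K z.2 - m z.1 z.2) ∂(timeProd μ p.T) := by
      rw [← integral_const_mul, ← integral_add (hw.isSqIntegrable.integrable_sq.const_mul _)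
        (hw.isSqIntegrable.integrable_mul hKmS)]
      have hmarg' : ∀ᵐ z ∂(timeProd μ p.T), ∀ t ∈ Icc 0 p.T,
          marginal p P xbar ν ν t z.2 = 2 * p.lam * (ν' t z.2 - ν t z.2) + (K z.2 - m t z.2) :=
        Measure.quasiMeasurePreserving_snd.ae hmarg
      refine integral_congr_ae ?_
      filter_upwards [hmarg', ae_timeProd_mem (μ := μ) (T := p.T)] with z h1 h2
      rw [h1 _ h2]
      ring
    rw [h0, horth, add_zero, eq_comm, mul_eq_zero_iff_left (by positivity)] at e
    rw [integral_eq_zero_iff_of_nonneg (fun _ => sq_nonneg _) hw.isSqIntegrable.integrable_sq] at e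
    filter_upwards [e] with z hz
    simpa [sub_eq_zero] using hz
  refine ⟨_, _, ν', isAggregatedSolution_of_martingale hν'
    (M := fun t ω => (2 * p.lam)⁻¹ * (μ[K|𝓕 t.toNNReal]) ω) ?_ (fun t _ => ?_) fun t ht => ?_⟩
  · have e : onNonneg (fun (t : ℝ) ω => (2 * p.lam)⁻¹ * (μ[K|𝓕 t.toNNReal]) ω)
        = (2 * p.lam)⁻¹ • fun t : ℝ≥0 => μ[K|𝓕 t] := by
      ext t ω; simp [onNonneg]
    rw [e]
    exact (martingale_condExp K 𝓕 μ).smul _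
  · exact (hK2.condExp one_le_two).const_mul _
  · have hTn : p.T.toNNReal = ⟨p.T, hT⟩ := Real.toNNReal_of_nonneg hT
    have hKT : μ[K|𝓕 p.T.toNNReal] = K := by
      rw [hTn]
      exact condExp_of_stronglyMeasurable (𝓕.le _) hKm (hK2.integrable one_le_two)
    have hmt : m t =ᵐ[μ] μ[K|𝓕 t.toNNReal] := by
      have := hmK t.toNNReal
      rwa [Real.coe_toNNReal t ht.1] at this
    filter_upwards [hmarg, hmt, ae_integral_eq_of_ae_eq hνν',
      ae_distortion_eq_of_ae_eq hνν'] with ω h1 h2 h3 h4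
    have e1 : ∫ s in t..p.T, inventory xbar ν' s ω = ∫ s in t..p.T, inventory xbar ν s ω := by
      refine intervalIntegral.integral_congr fun s hs => ?_
      rw [uIcc_of_le ht.2] at hs
      simp only [inventory]
      rw [h3 s ⟨ht.1.trans hs.1, hs.2⟩]
    have e2 : inventory xbar ν' p.T ω = inventory xbar ν p.T ω := by
      simp only [inventory]
      rw [h3 p.T hTm]
    have h5 := h1 t ht
    change P t ω - p.κ * distortion p ν t ω - 2 * p.lam * ν t ω
      + 2 * p.φ * (∫ s in t..p.T, inventory xbar ν s ω) - P p.T ω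
      + 2 * p.ϱ * inventory xbar ν p.T ω = _ at h5
    change P t ω - p.κ * distortion p ν' t ω - 2 * p.lam * ν' t ω
      + 2 * p.φ * (∫ s in t..p.T, inventory xbar ν' s ω) - P p.T ω
      + 2 * p.ϱ * inventory xbar ν' p.T ω = _
    rw [e1, e2, h4 t ht, hKT, ← h2]
    field_simp
    linear_combination h5

end Regularisation

/-! ### Lax–Milgram on the space of admissible rates. -/

section LaxMilgram

variable {Ω : Type*} {mΩ : MeasurableSpace Ω} {μ : Measure Ω} [IsProbabilityMeasure μ]
  {𝓕 : Filtration ℝ≥0 mΩ} {T : ℝ}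

lemma Lp_norm_sq_eq_integral {α : Type*} {m : MeasurableSpace α} {ν : Measure α}
    (f : Lp ℝ 2 ν) : ‖f‖ ^ 2 = ∫ a, f a ^ 2 ∂ν := by
  rw [← real_inner_self_eq_norm_sq, L2.inner_def]
  exact integral_congr_ae (Eventually.of_forall fun a => by simp [sq])

/-- The square integrable functions with an admissible version. -/
def admissibleSubmodule (μ : Measure Ω) [IsProbabilityMeasure μ] (𝓕 : Filtration ℝ≥0 mΩ) (T : ℝ) :
    Submodule ℝ (Lp ℝ 2 (timeProd μ T)) where
  carrier := {f | ∃ v, IsAdmissible μ 𝓕 T v ∧ f =ᵐ[timeProd μ T] fun z => v z.1 z.2}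
  zero_mem' := ⟨fun _ _ => 0, IsAdmissible.of_time continuous_const, Lp.coeFn_zero _ _ _⟩
  add_mem' := by
    rintro f g ⟨v, hv, hfv⟩ ⟨w, hw, hgw⟩
    refine ⟨_, hv.add hw, (Lp.coeFn_add f g).trans ?_⟩
    filter_upwards [hfv, hgw] with z h1 h2
    rw [Pi.add_apply, h1, h2]
  smul_mem' := by
    rintro c f ⟨v, hv, hfv⟩
    refine ⟨_, hv.time_mul (continuous_const (y := c)), (Lp.coeFn_smul c f).trans ?_⟩
    filter_upwards [hfv] with z h1
    rw [Pi.smul_apply, h1, smul_eq_mul]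

/-- An L² limit is an almost everywhere limit along a subsequence, and the pointwise upper limit of
admissible representatives is a progressive version of it. -/
lemma isClosed_admissibleSubmodule :
    IsClosed (admissibleSubmodule μ 𝓕 T : Set (Lp ℝ 2 (timeProd μ T))) := by
  refine IsSeqClosed.isClosed fun f g hf hlim => ?_
  choose v hv hfv using hf
  obtain ⟨ns, -, hns⟩ := (tendstoInMeasure_of_tendsto_Lp hlim).exists_seq_tendsto_ae
  set w : ℝ → Ω → ℝ := fun t ω => limsup (fun n => v (ns n) t ω) atTop with hw
  have hgw : g =ᵐ[timeProd μ T] fun z => w z.1 z.2 := by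
    filter_upwards [hns, ae_all_iff.2 hfv] with z h1 h2
    refine (Tendsto.limsup_eq ?_).symm
    simpa only [h2] using h1
  have hwp : IsStronglyProgressive 𝓕 (onNonneg w) := isStronglyProgressive_onNonneg_iff.2 fun t =>
    Measurable.limsup fun n => isStronglyProgressive_onNonneg_iff.1 (hv (ns n)).progressive t
  exact ⟨w, isAdmissible_iff.2 ⟨hwp, IsJointlyMeasurable.of_progressive hwp T,
    (Lp.memLp g).ae_eq hgw⟩, hgw⟩

instance completeSpace_admissibleSubmodule : CompleteSpace (admissibleSubmodule μ 𝓕 T) :=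
  isClosed_admissibleSubmodule.completeSpace_coe

lemma IsAdmissible.toLp_mem {v : ℝ → Ω → ℝ} (hv : IsAdmissible μ 𝓕 T v) :
    hv.isSqIntegrable.memLp.toLp ∈ admissibleSubmodule μ 𝓕 T :=
  ⟨v, hv, MemLp.coeFn_toLp _⟩

/-- The Lax–Milgram theorem for operators on admissible rates. -/
theorem exists_isAdmissible_of_coercive {R : (ℝ → Ω → ℝ) → ℝ → Ω → ℝ} {b : ℝ → Ω → ℝ} {c C : ℝ}
    (hR : ∀ v, IsAdmissible μ 𝓕 T v → IsSqIntegrable μ T (R v)) (hb : IsSqIntegrable μ T b)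
    (hlin : ∀ (k : ℝ) (v v' w : ℝ → Ω → ℝ), IsAdmissible μ 𝓕 T v → IsAdmissible μ 𝓕 T v' →
      IsAdmissible μ 𝓕 T w → (∀ᵐ z ∂(timeProd μ T), w z.1 z.2 = k * v z.1 z.2 + v' z.1 z.2) →
      ∀ᵐ z ∂(timeProd μ T), R w z.1 z.2 = k * R v z.1 z.2 + R v' z.1 z.2)
    (hbound : ∀ v, IsAdmissible μ 𝓕 T v → ∫ z, R v z.1 z.2 ^ 2 ∂(timeProd μ T)
      ≤ C ^ 2 * ∫ z, v z.1 z.2 ^ 2 ∂(timeProd μ T))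
    (hC : 0 ≤ C) (hc : 0 < c)
    (hcoer : ∀ v, IsAdmissible μ 𝓕 T v → c * ∫ z, v z.1 z.2 ^ 2 ∂(timeProd μ T)
      ≤ ∫ z, v z.1 z.2 * R v z.1 z.2 ∂(timeProd μ T)) :
    ∃ v, IsAdmissible μ 𝓕 T v ∧ ∀ w, IsAdmissible μ 𝓕 T w →
      ∫ z, w z.1 z.2 * R v z.1 z.2 ∂(timeProd μ T)
        = ∫ z, w z.1 z.2 * b z.1 z.2 ∂(timeProd μ T) := by
  set H := admissibleSubmodule μ 𝓕 T with hH
  -- `R` acts on processes, not on classes. Any choice of representatives will do, because `hlin`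
  -- needs only almost everywhere relations.
  choose rep hrep hfrep using fun f : H => f.2
  have hzero : ∀ᵐ z ∂(timeProd μ T), R (fun _ _ => 0) z.1 z.2 = 0 := by
    have h0 : IsAdmissible μ 𝓕 T fun _ (_ : Ω) => (0 : ℝ) := IsAdmissible.of_time continuous_const
    filter_upwards [hlin 1 _ _ _ h0 h0 h0 (Eventually.of_forall fun _ => by simp)] with z hz
    linarith
  let S : H →ₗ[ℝ] Lp ℝ 2 (timeProd μ T) :=
    { toFun := fun f => (hR _ (hrep f)).memLp.toLp
      map_add' := fun f g => by
        refine Lp.ext ?_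
        have h1 := hlin 1 _ _ _ (hrep f) (hrep g) (hrep (f + g)) (by
          filter_upwards [hfrep f, hfrep g, hfrep (f + g), Lp.coeFn_add (f : Lp ℝ 2 _) g]
            with z e1 e2 e3 e4
          rw [one_mul, ← e1, ← e2, ← e3, Submodule.coe_add, e4, Pi.add_apply])
        filter_upwards [h1, MemLp.coeFn_toLp (hR _ (hrep f)).memLp,
          MemLp.coeFn_toLp (hR _ (hrep g)).memLp, MemLp.coeFn_toLp (hR _ (hrep (f + g))).memLp,
          Lp.coeFn_add (hR _ (hrep f)).memLp.toLp (hR _ (hrep g)).memLp.toLp]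
          with z e1 e2 e3 e4 e5
        rw [e4, e5, Pi.add_apply, e2, e3, e1, one_mul]
      map_smul' := fun k f => by
        refine Lp.ext ?_
        have h0 : IsAdmissible μ 𝓕 T fun _ (_ : Ω) => (0 : ℝ) :=
          IsAdmissible.of_time continuous_const
        have h1 := hlin k _ _ _ (hrep f) h0 (hrep (k • f)) (by
          filter_upwards [hfrep f, hfrep (k • f), Lp.coeFn_smul k (f : Lp ℝ 2 _)] with z e1 e3 e4
          rw [add_zero, ← e1, ← e3, Submodule.coe_smul, e4, Pi.smul_apply, smul_eq_mul])
        filter_upwards [h1, hzero, MemLp.coeFn_toLp (hR _ (hrep f)).memLp,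
          MemLp.coeFn_toLp (hR _ (hrep (k • f))).memLp,
          Lp.coeFn_smul k (hR _ (hrep f)).memLp.toLp] with z e1 e2 e3 e4 e5
        rw [e4, RingHom.id_apply, e5, Pi.smul_apply, e3, e1, e2, add_zero, smul_eq_mul] }
  have hS : ∀ f : H, S f =ᵐ[timeProd μ T] fun z => R (rep f) z.1 z.2 := fun f =>
    MemLp.coeFn_toLp (hR _ (hrep f)).memLp
  have hnorm : ∀ f : H, ‖f‖ ^ 2 = ∫ z, rep f z.1 z.2 ^ 2 ∂(timeProd μ T) := fun f => by
    rw [Submodule.coe_norm, Lp_norm_sq_eq_integral]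
    exact integral_congr_ae (by filter_upwards [hfrep f] with z hz; rw [hz])
  have hSn : ∀ f : H, ‖S f‖ ≤ C * ‖f‖ := fun f => by
    refine le_of_sq_le_sq ?_ (by positivity)
    rw [mul_pow, hnorm, Lp_norm_sq_eq_integral]
    refine le_of_eq_of_le ?_ (hbound _ (hrep f))
    exact integral_congr_ae (by filter_upwards [hS f] with z hz; rw [hz])
  let Sc : H →L[ℝ] Lp ℝ 2 (timeProd μ T) := S.mkContinuous C hSn
  -- The values of S need not be admissible; testing against elements of the subspace makes a
  -- projection unnecessary.
  let B : H →L[ℝ] H →L[ℝ] ℝ := ((innerSL ℝ).flip.comp H.subtypeL).flip.comp Sc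
  have hB : ∀ f g : H, B f g = ∫ z, rep g z.1 z.2 * R (rep f) z.1 z.2 ∂(timeProd μ T) := by
    intro f g
    have e : B f g = inner ℝ (S f) (g : Lp ℝ 2 (timeProd μ T)) := rfl
    rw [e, L2.inner_def]
    refine integral_congr_ae ?_
    filter_upwards [hS f, hfrep g] with z h1 h2
    rw [h1, h2]
    simp
  have hBc : IsCoercive B := ⟨c, hc, fun f => by
    rw [hB, mul_assoc, ← sq, hnorm]
    exact hcoer _ (hrep f)⟩
  let ℓ : H →L[ℝ] ℝ := (innerSL ℝ hb.memLp.toLp).comp H.subtypeL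
  set f := hBc.continuousLinearEquivOfBilin.symm ((InnerProductSpace.toDual ℝ H).symm ℓ) with hf
  have hfg : ∀ g, B f g = ℓ g := fun g => by
    rw [← hBc.continuousLinearEquivOfBilin_apply, hf, ContinuousLinearEquiv.apply_symm_apply,
      InnerProductSpace.toDual_symm_apply]
  refine ⟨rep f, hrep f, fun w hw => ?_⟩
  set g : H := ⟨_, hw.toLp_mem⟩ with hg
  have hgw : (g : Lp ℝ 2 (timeProd μ T)) =ᵐ[timeProd μ T] fun z => w z.1 z.2 :=
    MemLp.coeFn_toLp hw.isSqIntegrable.memLp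
  have h1 := hfg g
  rw [hB] at h1
  have e2 : ℓ g = ∫ z, w z.1 z.2 * b z.1 z.2 ∂(timeProd μ T) := by
    have e : ℓ g = inner ℝ hb.memLp.toLp (g : Lp ℝ 2 (timeProd μ T)) := rfl
    rw [e, L2.inner_def]
    refine integral_congr_ae ?_
    filter_upwards [MemLp.coeFn_toLp hb.memLp, hgw] with z h1 h2
    rw [h1, h2]
    simp
  rw [← e2, ← h1]
  refine integral_congr_ae ?_
  filter_upwards [hgw, hfrep g] with z h1 h2
  rw [← h1, h2]

end LaxMilgram

/-! ### The linear response operator. -/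

section Response

variable {p : ImpactParams} {S S' v v' w : ℝ → ℝ} {x c t : ℝ}

/-- Price and rate enter pointwise only at time t; everywhere else the rate is seen through
integrals. -/
lemma marginalPath_congr_ae (hS : S t = S' t) (hv : v t = v' t)
    (h : ∀ᵐ s ∂(volume.restrict (Icc 0 p.T)), v s = v' s) (ht : t ∈ Icc 0 p.T) :
    marginalPath p S x c v t = marginalPath p S' x c v' t := by
  have e : ∫ s in t..p.T, (x - ∫ u in (0 : ℝ)..s, v u)
      = ∫ s in t..p.T, (x - ∫ u in (0 : ℝ)..s, v' u) := by
    refine intervalIntegral.integral_congr fun s hs => ?_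
    rw [uIcc_of_le ht.2] at hs
    rw [intervalIntegral_eq_of_ae_Icc h ⟨ht.1.trans hs.1, hs.2⟩]
  simp only [marginalPath]
  rw [hS, hv, e, intervalIntegral_eq_of_ae_Icc h ⟨p.T_pos.le, le_rfl⟩]

lemma marginalPath_linear (k x x' c c' : ℝ) (hv : IntervalIntegrable v volume 0 p.T)
    (hv' : IntervalIntegrable v' volume 0 p.T) (ht : t ∈ Icc 0 p.T) :
    marginalPath p (fun t => k * S t + S' t) (k * x + x') (k * c + c') (fun t => k * v t + v' t) t
      = k * marginalPath p S x c v t + marginalPath p S' x' c' v' t := by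
  have hT := p.T_pos.le
  have e0 : ∀ t ∈ Icc 0 p.T, ∫ s in (0 : ℝ)..t, (k * v s + v' s)
      = k * (∫ s in (0 : ℝ)..t, v s) + ∫ s in (0 : ℝ)..t, v' s := fun t ht => by
    rw [← intervalIntegral.integral_const_mul]
    exact intervalIntegral.integral_add ((intervalIntegrable_sub_Icc hT hv ht).1.const_mul k)
      (intervalIntegrable_sub_Icc hT hv' ht).1
  have hX := intervalIntegrable_of_continuousOn_Icc hT (continuousOn_inventoryPath (x := x) hT hv)
  have hX' := intervalIntegrable_of_continuousOn_Icc hT (continuousOn_inventoryPath (x := x') hT hv')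
  have e1 : ∫ s in t..p.T, (k * x + x' - ∫ u in (0 : ℝ)..s, (k * v u + v' u))
      = k * (∫ s in t..p.T, (x - ∫ u in (0 : ℝ)..s, v u))
        + ∫ s in t..p.T, (x' - ∫ u in (0 : ℝ)..s, v' u) := by
    rw [← intervalIntegral.integral_const_mul,
      ← intervalIntegral.integral_add ((intervalIntegrable_sub_Icc hT hX ht).2.const_mul k)
      (intervalIntegrable_sub_Icc hT hX' ht).2]
    refine intervalIntegral.integral_congr fun s hs => ?_
    rw [uIcc_of_le ht.2] at hs
    simp only [e0 s ⟨ht.1.trans hs.1, hs.2⟩]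
    ring
  simp only [marginalPath, e1, e0 p.T ⟨hT, le_rfl⟩]
  ring

lemma distortionPath_linear {T ρ γ y y' k : ℝ} {f g : ℝ → ℝ}
    (hf : IntervalIntegrable f volume 0 T) (hg : IntervalIntegrable g volume 0 T)
    (ht : t ∈ Icc 0 T) :
    distortionPath ρ γ (k * y + y') (fun s => k * f s + g s) t
      = k * distortionPath ρ γ y f t + distortionPath ρ γ y' g t := by
  have hT := ht.1.trans ht.2
  simp only [distortionPath_eq]
  have i1 := intervalIntegrable_exp_mul (intervalIntegrable_sub_Icc hT hf ht).1 γ ρ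
  have i2 := intervalIntegrable_exp_mul (intervalIntegrable_sub_Icc hT hg ht).1 γ ρ
  have e : ∫ s in (0 : ℝ)..t, γ * Real.exp (ρ * s) * (k * f s + g s)
      = k * (∫ s in (0 : ℝ)..t, γ * Real.exp (ρ * s) * f s)
        + ∫ s in (0 : ℝ)..t, γ * Real.exp (ρ * s) * g s := by
    rw [← intervalIntegral.integral_const_mul, ← intervalIntegral.integral_add (i1.const_mul k) i2]
    exact intervalIntegral.integral_congr fun s _ => by ring
  rw [e]
  ring

/-- The linear part of the first-order condition when the rate `v` also is the net flow. -/
noncomputable def responsePath (p : ImpactParams) (v : ℝ → ℝ) (t : ℝ) : ℝ :=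
  -marginalPath p (fun s => -p.κ * distortionPath p.ρ p.γ 0 v s) 0 0 v t

lemma responsePath_linear {k : ℝ} (hv : IntervalIntegrable v volume 0 p.T)
    (hv' : IntervalIntegrable v' volume 0 p.T)
    (h : ∀ᵐ s ∂(volume.restrict (Icc 0 p.T)), w s = k * v s + v' s)
    (hwt : w t = k * v t + v' t) (ht : t ∈ Icc 0 p.T) :
    responsePath p w t = k * responsePath p v t + responsePath p v' t := by
  have e := distortionPath_linear (ρ := p.ρ) (γ := p.γ) (y := 0) (y' := 0) (k := k) hv hv' ht
  have e2 := marginalPath_linear (S := fun s => -p.κ * distortionPath p.ρ p.γ 0 v s)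
    (S' := fun s => -p.κ * distortionPath p.ρ p.γ 0 v' s) k 0 0 0 0 hv hv' ht
  simp only [mul_zero, add_zero] at e e2
  rw [responsePath, marginalPath_congr_ae (v' := fun s => k * v s + v' s)
    (S' := fun t => k * (-p.κ * distortionPath p.ρ p.γ 0 v t)
      + -p.κ * distortionPath p.ρ p.γ 0 v' t) ?_ hwt h ht, e2, responsePath, responsePath]
  · ring
  · rw [distortionPath_congr_ae h ht, e]
    ring

lemma abs_distortionPath_le {T : ℝ} {ρ γ : ℝ} (hρ : 0 ≤ ρ) (hγ : 0 ≤ γ)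
    (hv : IntervalIntegrable v volume 0 T) (ht : t ∈ Icc 0 T) :
    |distortionPath ρ γ 0 v t| ≤ γ * ∫ s in (0 : ℝ)..T, |v s| := by
  have hT := ht.1.trans ht.2
  have hvt := (intervalIntegrable_sub_Icc hT hv ht).1
  rw [distortionPath, mul_zero, zero_add, abs_mul, abs_of_nonneg hγ]
  refine mul_le_mul_of_nonneg_left ?_ hγ
  calc |∫ s in (0 : ℝ)..t, Real.exp (-ρ * (t - s)) * v s|
      ≤ ∫ s in (0 : ℝ)..t, |Real.exp (-ρ * (t - s)) * v s| :=
        intervalIntegral.abs_integral_le_integral_abs ht.1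
    _ ≤ ∫ s in (0 : ℝ)..t, |v s| := by
        refine intervalIntegral.integral_mono_on ht.1 (hvt.continuousOn_mul (by fun_prop)).abs
          hvt.abs fun s hs => ?_
        rw [abs_mul, abs_of_pos (Real.exp_pos _)]
        refine mul_le_of_le_one_left (abs_nonneg _) (Real.exp_le_one_iff.2 ?_)
        nlinarith [hs.2]
    _ ≤ ∫ s in (0 : ℝ)..T, |v s| :=
        intervalIntegral.integral_mono_interval le_rfl ht.1 ht.2
          (Eventually.of_forall fun _ => abs_nonneg _) hv.abs

/-- All nonlocal terms are controlled by the time integral of |v|, which makes the operator bounded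
on L². -/
lemma abs_responsePath_le (hv : IntervalIntegrable v volume 0 p.T) (ht : t ∈ Icc 0 p.T) :
    |responsePath p v t| ≤ 2 * p.lam * |v t|
      + (p.κ * p.γ + 2 * p.φ * p.T + 2 * p.ϱ) * ∫ s in (0 : ℝ)..p.T, |v s| := by
  have hT := p.T_pos.le
  set N := ∫ s in (0 : ℝ)..p.T, |v s| with hN
  have hD := abs_distortionPath_le p.ρ_pos.le p.γ_pos.le hv ht
  have hI : ∀ s ∈ Icc 0 p.T, |∫ u in (0 : ℝ)..s, v u| ≤ N := fun s hs =>
    (intervalIntegral.abs_integral_le_integral_abs hs.1).trans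
      (intervalIntegral.integral_mono_interval le_rfl hs.1 hs.2
          (Eventually.of_forall fun _ => abs_nonneg _) hv.abs)
  have hN0 : 0 ≤ N := intervalIntegral.integral_nonneg hT fun _ _ => abs_nonneg _
  have hZ : |∫ s in t..p.T, (0 - ∫ u in (0 : ℝ)..s, v u)| ≤ p.T * N := by
    have h := intervalIntegral.norm_integral_le_of_norm_le_const (C := N) (a := t) (b := p.T)
      (f := fun s => 0 - ∫ u in (0 : ℝ)..s, v u) (fun s hs => by
        rw [uIoc_of_le ht.2] at hs
        rw [zero_sub, norm_neg]
        exact hI s ⟨ht.1.trans hs.1.le, hs.2⟩)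
    refine h.trans ?_
    rw [abs_of_nonneg (by linarith [ht.2]), mul_comm]
    exact mul_le_mul_of_nonneg_right (by linarith [ht.1]) hN0
  have hXT := hI p.T ⟨hT, le_rfl⟩
  simp only [responsePath, marginalPath, abs_neg]
  have h1 := p.κ_pos
  have h2 := p.lam_pos
  have h3 := p.φ_pos
  have h4 := p.ϱ_pos
  generalize (∫ s in t..p.T, (0 - ∫ u in (0 : ℝ)..s, v u)) = a at *
  generalize (∫ u in (0 : ℝ)..p.T, v u) = b at *
  generalize distortionPath p.ρ p.γ 0 v t = d at *
  calc |-p.κ * d - 2 * p.lam * v t + 2 * p.φ * a - 0 + 2 * p.ϱ * (0 - b)|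
      = |-(p.κ * d) + -(2 * p.lam * v t) + 2 * p.φ * a + -(2 * p.ϱ * b)| := by ring_nf
    _ ≤ |-(p.κ * d)| + |-(2 * p.lam * v t)| + |2 * p.φ * a| + |-(2 * p.ϱ * b)| :=
        (abs_add_le _ _).trans (add_le_add_left ((abs_add_le _ _).trans
          (add_le_add_left (abs_add_le _ _) _)) _)
    _ = p.κ * |d| + 2 * p.lam * |v t| + 2 * p.φ * |a| + 2 * p.ϱ * |b| := by
        simp only [abs_neg, abs_mul, abs_of_pos h1, abs_of_pos h2, abs_of_pos h3, abs_of_pos h4,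
          abs_two]
    _ ≤ p.κ * (p.γ * N) + 2 * p.lam * |v t| + 2 * p.φ * (p.T * N) + 2 * p.ϱ * N := by gcongr
    _ = _ := by ring

end Response

/-! ### Existence of a rate that responds optimally to its own flow. -/

section Existence

variable {Ω : Type*} {mΩ : MeasurableSpace Ω} {μ : Measure Ω} [IsProbabilityMeasure μ]
  {𝓕 : Filtration ℝ≥0 mΩ} {p : ImpactParams} {P : ℝ → Ω → ℝ} {xbar : ℝ}

lemma IsSqIntegrable.responsePath {v : ℝ → Ω → ℝ} (hv : IsSqIntegrable μ p.T v) :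
    IsSqIntegrable μ p.T (fun t ω => responsePath p (fun s => v s ω) t) := by
  have h := (((hv.distortionPath (ρ := p.ρ) (γ := p.γ) (y := 0)).const_mul (-p.κ)).marginalPath 0 hv
    (measurable_const (a := (0 : ℝ))) (memLp_const 0)).const_mul (-1)
  refine h.congr fun t _ ω => ?_
  simp only [_root_.responsePath]
  ring

/-- The pointwise bound, (a+b)² ≤ 2a² + 2b², and Cauchy–Schwarz in time for N. -/
lemma integral_responsePath_sq_le {v : ℝ → Ω → ℝ} (hv : IsSqIntegrable μ p.T v) :
    ∫ z, responsePath p (fun s => v s z.2) z.1 ^ 2 ∂(timeProd μ p.T)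
      ≤ (2 * (2 * p.lam) ^ 2 + 2 * ((p.κ * p.γ + 2 * p.φ * p.T + 2 * p.ϱ) * p.T) ^ 2)
        * ∫ z, v z.1 z.2 ^ 2 ∂(timeProd μ p.T) := by
  have hT := p.T_pos.le
  set C := p.κ * p.γ + 2 * p.φ * p.T + 2 * p.ϱ with hC
  set N : Ω → ℝ := fun ω => ∫ s in (0 : ℝ)..p.T, |v s ω| with hN
  have hN2 : IsSqIntegrable μ p.T fun _ => N :=
    IsSqIntegrable.integral_total (v := fun s ω => |v s ω|) ⟨Measurable.abs hv.meas, hv.memLp.abs⟩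
  have hNle : ∫ z, N z.2 ^ 2 ∂(timeProd μ p.T)
      ≤ p.T ^ 2 * ∫ z, v z.1 z.2 ^ 2 ∂(timeProd μ p.T) := by
    rw [integral_timeProd hT hN2.integrable_sq]
    simp only [intervalIntegral.integral_const, sub_zero, smul_eq_mul]
    rw [integral_const_mul, sq, mul_assoc]
    exact mul_le_mul_of_nonneg_left (hv.integral_sq_integral_abs_le hT) hT
  have hb : ∀ᵐ z ∂(timeProd μ p.T), responsePath p (fun s => v s z.2) z.1 ^ 2
      ≤ 2 * (2 * p.lam) ^ 2 * v z.1 z.2 ^ 2 + 2 * C ^ 2 * N z.2 ^ 2 := by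
    have h : ∀ᵐ z ∂(timeProd μ p.T), IntervalIntegrable (fun s => v s z.2) volume 0 p.T :=
      Measure.quasiMeasurePreserving_snd.ae hv.ae_intervalIntegrable
    filter_upwards [h, ae_timeProd_mem (μ := μ) (T := p.T)] with z h1 h2
    have h3 := abs_responsePath_le h1 h2
    rw [← sq_abs (responsePath p _ _), ← sq_abs (v z.1 z.2)]
    calc |responsePath p (fun s => v s z.2) z.1| ^ 2
        ≤ (2 * p.lam * |v z.1 z.2| + C * N z.2) ^ 2 := pow_le_pow_left₀ (abs_nonneg _) h3 2
      _ ≤ _ := by nlinarith [sq_nonneg (2 * p.lam * |v z.1 z.2| - C * N z.2)]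
  have i1 := hv.integrable_sq.const_mul (2 * (2 * p.lam) ^ 2)
  have i2 := hN2.integrable_sq.const_mul (2 * C ^ 2)
  calc ∫ z, responsePath p (fun s => v s z.2) z.1 ^ 2 ∂(timeProd μ p.T)
      ≤ ∫ z, (2 * (2 * p.lam) ^ 2 * v z.1 z.2 ^ 2 + 2 * C ^ 2 * N z.2 ^ 2) ∂(timeProd μ p.T) :=
        integral_mono_ae hv.responsePath.integrable_sq (i1.add i2) hb
    _ = 2 * (2 * p.lam) ^ 2 * (∫ z, v z.1 z.2 ^ 2 ∂(timeProd μ p.T))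
        + 2 * C ^ 2 * ∫ z, N z.2 ^ 2 ∂(timeProd μ p.T) := by
        rw [← integral_const_mul, ← integral_const_mul]
        exact integral_add i1 i2
    _ ≤ 2 * (2 * p.lam) ^ 2 * (∫ z, v z.1 z.2 ^ 2 ∂(timeProd μ p.T))
        + 2 * C ^ 2 * (p.T ^ 2 * ∫ z, v z.1 z.2 ^ 2 ∂(timeProd μ p.T)) := by gcongr
    _ = _ := by ring

/-- There is a rate which is a best response to the flow it generates. -/
theorem exists_isStationaryRate (hP : IsSqIntegrable μ p.T P) (hPT : MemLp (P p.T) 2 μ) :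
    ∃ ν, IsAdmissible μ 𝓕 p.T ν ∧ IsStationaryRate μ 𝓕 p P xbar ν ν := by
  have hT := p.T_pos.le
  have h0 : IsSqIntegrable μ p.T fun _ (_ : Ω) => (0 : ℝ) := IsSqIntegrable.of_time continuous_const
  set C2 := 2 * (2 * p.lam) ^ 2 + 2 * ((p.κ * p.γ + 2 * p.φ * p.T + 2 * p.ϱ) * p.T) ^ 2 with hC2
  have hb := hP.marginal hPT xbar h0 h0
  -- The operator is minus the linear part of the marginal, coercive with constant 2λ by
  -- dissipativity. The right-hand side is the marginal at zero rate and zero flow.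
  obtain ⟨ν, hν, hνw⟩ := exists_isAdmissible_of_coercive (μ := μ) (𝓕 := 𝓕) (T := p.T)
    (R := fun v t ω => responsePath p (fun s => v s ω) t) (c := 2 * p.lam) (C := √C2)
    (fun v hv => hv.isSqIntegrable.responsePath) hb
    (fun k v v' w hv hv' _ hw => by
      have i1 : ∀ᵐ z ∂(timeProd μ p.T), IntervalIntegrable (fun s => v s z.2) volume 0 p.T :=
        Measure.quasiMeasurePreserving_snd.ae hv.isSqIntegrable.ae_intervalIntegrable
      have i2 : ∀ᵐ z ∂(timeProd μ p.T), IntervalIntegrable (fun s => v' s z.2) volume 0 p.T :=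
        Measure.quasiMeasurePreserving_snd.ae hv'.isSqIntegrable.ae_intervalIntegrable
      have i3 : ∀ᵐ z ∂(timeProd μ p.T), ∀ᵐ s ∂(volume.restrict (Icc 0 p.T)),
          w s z.2 = k * v s z.2 + v' s z.2 :=
        Measure.quasiMeasurePreserving_snd.ae (ae_ae_of_ae_timeProd hw)
      filter_upwards [i1, i2, i3, hw, ae_timeProd_mem (μ := μ) (T := p.T)] with z e1 e2 e3 e4 e5
      exact responsePath_linear e1 e2 e3 e4 e5)
    (fun v hv => by
      rw [Real.sq_sqrt (by positivity)]
      exact integral_responsePath_sq_le hv.isSqIntegrable)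
    (Real.sqrt_nonneg _) (mul_pos two_pos p.lam_pos) (fun v hv => by
      have hvS := hv.isSqIntegrable
      have i1 := hvS.integrable_mul hvS.responsePath
      rw [integral_timeProd hT i1, integral_timeProd hT hvS.integrable_sq, ← integral_const_mul]
      refine integral_mono_ae ((integrable_integral_path hT hvS.integrable_sq).const_mul _)
        (integrable_integral_path hT i1) ?_
      filter_upwards [hvS.ae_memLp_path,
        (hvS.distortionPath (ρ := p.ρ) (γ := p.γ) (y := 0)).ae_memLp_path] with ω e1 e2
      have h := integral_mul_marginalPath_self_le e1 e2 (integral_mul_distortionPath_nonneg hT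
        p.ρ_pos.le p.γ_pos (intervalIntegrable_of_memLp hT e1))
      simp only [responsePath, mul_neg, intervalIntegral.integral_neg]
      linarith)
  refine ⟨ν, hν, fun w hw => ?_⟩
  have e : ∀ᵐ z ∂(timeProd μ p.T), w z.1 z.2 * marginal p P xbar ν ν z.1 z.2
      = w z.1 z.2 * marginal p P xbar (fun _ _ => 0) (fun _ _ => 0) z.1 z.2
        - w z.1 z.2 * responsePath p (fun s => ν s z.2) z.1 := by
    have i1 : ∀ᵐ z ∂(timeProd μ p.T), IntervalIntegrable (fun s => ν s z.2) volume 0 p.T :=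
      Measure.quasiMeasurePreserving_snd.ae hν.isSqIntegrable.ae_intervalIntegrable
    filter_upwards [i1, ae_timeProd_mem (μ := μ) (T := p.T)] with z h1 h2
    have i0 : IntervalIntegrable (fun _ : ℝ => (0 : ℝ)) volume 0 p.T := intervalIntegrable_const
    have h3 := marginalPath_sub (S := fun s => executionPrice p P ν s z.2)
      (S' := fun s => executionPrice p P (fun _ _ => 0) s z.2) (x := xbar) (x' := xbar)
      (c := P p.T z.2) (c' := P p.T z.2) h1 i0 h2
    have h4 := distortionPath_sub (ρ := p.ρ) (γ := p.γ) (y := p.y) (y' := p.y) h1 i0 h2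
    have h5 : marginalPath p (fun s => executionPrice p P ν s z.2
          - executionPrice p P (fun _ _ => 0) s z.2) (xbar - xbar) (P p.T z.2 - P p.T z.2)
          (fun s => ν s z.2 - 0) z.1 = -responsePath p (fun s => ν s z.2) z.1 := by
      simp only [sub_self, sub_zero] at h4 ⊢
      rw [responsePath, neg_neg]
      refine marginalPath_congr_ae ?_ rfl (Eventually.of_forall fun _ => rfl) h2
      rw [← h4]
      change P _ _ - p.κ * distortionPath p.ρ p.γ p.y (fun s => ν s z.2) z.1
        - (P _ _ - p.κ * distortionPath p.ρ p.γ p.y (fun _ => 0) z.1) = _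
      ring
    simp only [marginal]
    linear_combination w z.1 z.2 * h3 + w z.1 z.2 * h5
  rw [integral_congr_ae e, integral_sub (hw.isSqIntegrable.integrable_mul hb)
    (hw.isSqIntegrable.integrable_mul hν.isSqIntegrable.responsePath), hνw w hw, sub_self]

end Existence

/-! ### Variables with zero conditional mean. -/

section Centred

variable {Ω : Type*} {mΩ : MeasurableSpace Ω} {μ : Measure Ω} [IsProbabilityMeasure μ]
  {𝓕 : Filtration ℝ≥0 mΩ}

/-- Integrable functions with vanishing conditional expectation. -/
def IsCentred (μ : Measure[mΩ] Ω) (m : MeasurableSpace Ω) (f : Ω → ℝ) : Prop :=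
  Integrable f μ ∧ μ[f|m] =ᵐ[μ] 0

lemma IsCentred.sub {m : MeasurableSpace Ω} {f g : Ω → ℝ} (hf : IsCentred μ m f) (hg : IsCentred μ m g) :
    IsCentred μ m (fun ω => f ω - g ω) := by
  refine ⟨hf.1.sub hg.1, ?_⟩
  refine (condExp_sub hf.1 hg.1 m).trans ?_
  filter_upwards [hf.2, hg.2] with ω h1 h2
  simp [h1, h2]

lemma IsCentred.const_mul {m : MeasurableSpace Ω} {f : Ω → ℝ} (hf : IsCentred μ m f) (c : ℝ) :
    IsCentred μ m (fun ω => c * f ω) := by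
  refine ⟨hf.1.const_mul c, ?_⟩
  refine (condExp_smul c f m).trans ?_
  filter_upwards [hf.2] with ω h1
  simp [h1]

/-- An event of `𝓕 t` belongs to `𝓕 s` for every later s, so each time section integrates to zero
over it; Fubini does the rest. -/
lemma isCentred_integral {T : ℝ} {Z : ℝ → Ω → ℝ} (hZ : IsSqIntegrable μ T Z)
    (hce : ∀ s : ℝ≥0, (s : ℝ) ≤ T → μ[Z s|𝓕 s] =ᵐ[μ] 0) {g : ℝ → ℝ} (hg : Continuous g)
    {t : ℝ≥0} (ht : (t : ℝ) ≤ T) :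
    IsCentred μ (𝓕 t) (fun ω => ∫ s in (t : ℝ)..T, g s * Z s ω) := by
  have hgZ := hZ.time_mul hg
  have hi : Integrable (fun ω => ∫ s in (t : ℝ)..T, g s * Z s ω) μ :=
    (hgZ.memLp_intervalIntegral (a := t) ⟨t.2, ht⟩ ⟨t.2.trans ht, le_rfl⟩).integrable one_le_two
  refine ⟨hi, (ae_eq_condExp_of_forall_setIntegral_eq (𝓕.le t) hi
    (fun s _ _ => integrableOn_zero) (fun Γ hΓ _ => ?_)
    (stronglyMeasurable_zero.aestronglyMeasurable)).symm⟩
  have hΓ' := 𝓕.le t _ hΓ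
  have hprod : Integrable (fun z : ℝ × Ω => g z.1 * Z z.1 z.2)
      ((volume.restrict (Ioc (t : ℝ) T)).prod (μ.restrict Γ)) := by
    rw [Measure.prod_restrict]
    have h1 : Integrable (fun z : ℝ × Ω => g z.1 * Z z.1 z.2)
        ((volume.prod μ).restrict (Icc 0 T ×ˢ univ)) := by
      rw [← Measure.prod_restrict, Measure.restrict_univ]
      exact hgZ.memLp.integrable one_le_two
    exact IntegrableOn.mono_set h1
      (prod_mono (fun s (hs : s ∈ Ioc (t : ℝ) T) => ⟨t.2.trans hs.1.le, hs.2⟩) (subset_univ _))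
  simp_rw [intervalIntegral.integral_of_le ht]
  rw [← integral_integral_swap (f := fun s ω => g s * Z s ω) hprod]
  simp only [integral_zero]
  symm
  have hsec : ∀ᵐ s ∂(volume.restrict (Ioc (t : ℝ) T)), MemLp (Z s) 2 μ :=
    ae_restrict_of_ae_restrict_of_subset
      (fun s (hs : s ∈ Ioc (t : ℝ) T) => (⟨t.2.trans hs.1.le, hs.2⟩ : s ∈ Icc 0 T)) hZ.ae_memLp_section
  refine integral_eq_zero_of_ae ?_
  filter_upwards [hsec, ae_restrict_mem measurableSet_Ioc] with s h1 hs
  have hs0 : 0 ≤ s := t.2.trans hs.1.le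
  have hce' : μ[Z s|𝓕 ⟨s, hs0⟩] =ᵐ[μ] 0 := hce ⟨s, hs0⟩ hs.2
  have hΓs : MeasurableSet[𝓕 ⟨s, hs0⟩] Γ := 𝓕.mono (show t ≤ ⟨s, hs0⟩ from hs.1.le) _ hΓ
  rw [integral_const_mul, ← setIntegral_condExp (𝓕.le _) (h1.integrable one_le_two) hΓs]
  rw [integral_eq_zero_of_ae (ae_restrict_of_ae hce'), mul_zero, Pi.zero_apply]

end Centred

/-! ### The feedback form of a stationary rate. -/

section Feedback

variable {Ω : Type*} {mΩ : MeasurableSpace Ω} {μ : Measure Ω} [IsProbabilityMeasure μ]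
  {𝓕 : Filtration ℝ≥0 mΩ} {p : ImpactParams} {P L A Y ν v : ℝ → Ω → ℝ} {x : ℝ}

/-- Only the path frozen outside [a, b] enters. The definition carries a proof about that path, so
it is generalised and substituted rather than rewritten. -/
lemma stieltjesIntegral_congr {g f f' : ℝ → ℝ} {a b : ℝ} (hab : a ≤ b)
    (h : ∀ s ∈ Icc a b, f s = f' s) : stieltjesIntegral g f a b = stieltjesIntegral g f' a b := by
  have e : (fun s => f (max a (min s b))) = fun s => f' (max a (min s b)) :=
    funext fun s => h _ ⟨le_max_left _ _, max_le hab (min_le_right _ _)⟩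
  unfold stieltjesIntegral
  generalize (fun s => f (max a (min s b))) = F at e
  subst e
  rfl

/-- Integration by parts for the signal in the feedback formula. -/
lemma feedbackR_mul_feedbackTerm_eq {ω : Ω} {t : ℝ} (ht : t ∈ Icc 0 p.T)
    (hA : BoundedVariationOn (fun s => A s ω) (Icc 0 p.T)) (hAc : IsCadlagPath fun s => A s ω)
    (hAi : IntervalIntegrable (fun s => A s ω) volume 0 p.T)
    (hν : IntervalIntegrable (fun s => ν s ω) volume 0 p.T)
    (hY : ∀ t ∈ Icc 0 p.T, Y t ω = distortion p ν t ω) :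
    feedbackR p (p.T - t) * feedbackTerm p A Y t ω
      = feedbackR p 0 * A p.T ω - feedbackR p (p.T - t) * (A t ω - p.κ * distortion p ν t ω)
        + ∫ s in t..p.T, feedbackRDeriv p (p.T - s) * (A s ω - p.κ * distortion p ν s ω) := by
  have hT := p.T_pos.le
  have hR := (feedbackR_pos p (sub_nonneg.2 ht.2)).ne'
  have hsub : Icc t p.T ⊆ Icc 0 p.T := Icc_subset_Icc_left ht.1
  have hDc := continuousOn_distortionPath (ρ := p.ρ) (γ := p.γ) (y := p.y) hT hν
  have hDi := intervalIntegrable_of_continuousOn_Icc hT hDc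
  have hg : ∀ s, HasDerivAt (fun s => feedbackR p (p.T - s) / feedbackR p (p.T - t))
      (-feedbackRDeriv p (p.T - s) / feedbackR p (p.T - t)) s := fun s =>
    ((hasDerivAt_feedbackR p (p.T - s)).comp_const_sub p.T s).div_const _
  have hg' : Continuous fun s => -feedbackRDeriv p (p.T - s) / feedbackR p (p.T - t) :=
    ((continuous_feedbackRDeriv p).comp (by fun_prop)).neg.div_const _
  have hBV : BoundedVariationOn (fun s => A s ω - p.κ * distortion p ν s ω) (Icc t p.T) :=
    (hA.sub_const_mul (boundedVariationOn_distortionPath hT hν) p.κ).mono hsub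
  have hfi : IntervalIntegrable (fun s => A s ω - p.κ * distortion p ν s ω) volume t p.T :=
    (intervalIntegrable_sub_Icc hT (hAi.sub (hDi.const_mul p.κ)) ht).2
  have hc : ∀ s ∈ Ico t p.T,
      ContinuousWithinAt (fun s => A s ω - p.κ * distortion p ν s ω) (Ici s) s := fun s hs => by
    have h0 : 0 ≤ s := ht.1.trans hs.1
    have h1 : ContinuousWithinAt (fun s => distortion p ν s ω) (Ici s) s := by
      have h2 : ContinuousWithinAt (fun s => distortion p ν s ω) (Icc 0 p.T) s :=
        hDc s ⟨h0, hs.2.le⟩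
      have h3 : ContinuousWithinAt (fun s => distortion p ν s ω) (Ico s p.T) s :=
        h2.mono fun r hr => ⟨h0.trans hr.1, hr.2.le⟩
      refine h3.mono_of_mem_nhdsWithin ?_
      exact Ico_mem_nhdsGE hs.2
    exact (hAc s h0).1.sub (continuousWithinAt_const.mul h1)
  have hst := stieltjesIntegral_eq_of_hasDerivAt ht.2 hg hg' hBV hfi hc
  rw [feedbackTerm, stieltjesIntegral_congr ht.2 (f' := fun s => A s ω - p.κ * distortion p ν s ω)
    (fun s hs => by rw [hY s (hsub hs)]), hst, hY p.T ⟨hT, le_rfl⟩]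
  have e : ∫ s in t..p.T, -feedbackRDeriv p (p.T - s) / feedbackR p (p.T - t)
      * (A s ω - p.κ * distortion p ν s ω)
      = -(1 / feedbackR p (p.T - t)) * ∫ s in t..p.T,
        feedbackRDeriv p (p.T - s) * (A s ω - p.κ * distortion p ν s ω) := by
    rw [← intervalIntegral.integral_const_mul]
    exact intervalIntegral.integral_congr fun s _ => by ring
  -- The boundary term at T has weight R(0) = √(φ/λ), so the extra summand of `feedbackTerm` cancels
  -- its Y_T part.
  rw [e, sub_self, feedbackR_zero]
  field_simp
  ring

/-- A rate satisfying the first-order condition is given in feedback form. -/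
theorem IsConditionallyStationary.feedback (hP : IsH2Semimartingale μ 𝓕 p.T P L A)
    (hv : IsAdmissible μ 𝓕 p.T v) (hν : IsSqIntegrable μ p.T ν)
    (h : IsConditionallyStationary μ 𝓕 p P x v ν)
    (hY : ∀ᵐ ω ∂μ, ∀ t ∈ Icc 0 p.T, Y t ω = distortion p ν t ω) {t : ℝ≥0} (ht : (t : ℝ) ≤ p.T) :
    Integrable (feedbackTerm p A Y t) μ ∧
      v t =ᵐ[μ] fun ω =>
        deriv (feedbackR p) (p.T - t) / feedbackR p (p.T - t) * inventory x v t ω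
          - 1 / (2 * p.lam) * (μ[feedbackTerm p A Y t | 𝓕 t]) ω := by
  have hT := p.T_pos.le
  have htm : (t : ℝ) ∈ Icc 0 p.T := ⟨t.2, ht⟩
  have hTm : p.T ∈ Icc 0 p.T := ⟨hT, le_rfl⟩
  have hl := p.lam_pos.ne'
  have hRpos := feedbackR_pos p (sub_nonneg.2 ht)
  set R := feedbackR p (p.T - t) with hRdef
  set R' := feedbackRDeriv p (p.T - t) with hR'def
  have hR'c : Continuous fun s => feedbackRDeriv p (p.T - s) :=
    (continuous_feedbackRDeriv p).comp (by fun_prop)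
  have hAS := hP.isSqIntegrable_A p.T_pos
  have hLS := hP.isSqIntegrable_L hT
  have hPS := hP.isSqIntegrable_P p.T_pos
  have hPT := hP.memLp_P p.T_pos hTm
  have hB := hPS.marginal hPT x hv.isSqIntegrable hν
  have hD : IsSqIntegrable μ p.T (distortion p ν) :=
    hν.distortionPath (ρ := p.ρ) (γ := p.γ) (y := p.y)
  -- integrability of the signal
  have hF : IsSqIntegrable μ p.T fun t ω => A t ω - p.κ * distortion p ν t ω :=
    hAS.sub (hD.const_mul p.κ)
  have hDt : MemLp (distortion p ν t) 2 μ := by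
    have h1 := ((hν.time_mul (g := fun s => p.γ * Real.exp (p.ρ * s))
      (by fun_prop)).memLp_intervalIntegral ⟨le_rfl, hT⟩ htm)
    have h2 := ((memLp_const p.y).add h1).const_mul (Real.exp (-p.ρ * t))
    refine h2.ae_eq (Eventually.of_forall fun ω => ?_)
    change _ = distortionPath _ _ _ _ _
    rw [distortionPath_eq]
    exact mul_comm _ _
  have hΦ : (fun ω => R * feedbackTerm p A Y t ω) =ᵐ[μ] fun ω =>
      feedbackR p 0 * A p.T ω - R * (A t ω - p.κ * distortion p ν t ω)
        + ∫ s in (t : ℝ)..p.T, feedbackRDeriv p (p.T - s) * (A s ω - p.κ * distortion p ν s ω) := by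
    filter_upwards [hP.ae_boundedVariationOn p.T_pos, hAS.ae_intervalIntegrable,
      hν.ae_intervalIntegrable, hY] with ω h1 h2 h3 h4
    exact feedbackR_mul_feedbackTerm_eq htm h1 (hP.cadlag_A ω) h2 h3 h4
  have hΦi : Integrable (fun ω => R * feedbackTerm p A Y t ω) μ := by
    refine Integrable.congr ?_ hΦ.symm
    have h1 := (((hP.memLp_A p.T_pos hTm).const_mul (feedbackR p 0)).sub
      (((hP.memLp_A p.T_pos htm).sub (hDt.const_mul p.κ)).const_mul R)).add
      ((hF.time_mul hR'c).memLp_intervalIntegral htm hTm)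
    exact h1.integrable one_le_two
  have hint : Integrable (feedbackTerm p A Y t) μ := by
    refine (hΦi.const_mul R⁻¹).congr (Eventually.of_forall fun ω => ?_)
    simp only
    rw [inv_mul_cancel_left₀ hRpos.ne']
  refine ⟨hint, ?_⟩
  -- the centred part
  have hLce : ∀ s : ℝ≥0, (s : ℝ) ≤ p.T → IsCentred μ (𝓕 s) (fun ω => L s ω - L p.T ω) := by
    intro s hs
    have h1 := (hP.memLp_L (t := s) ⟨s.2, hs⟩).integrable one_le_two
    have h2 := (hP.memLp_L hTm).integrable one_le_two
    refine ⟨h1.sub h2, (condExp_sub h1 h2 _).trans ?_⟩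
    have h3 : μ[L s|𝓕 s] = L s := condExp_of_stronglyMeasurable (𝓕.le s) (hP.adapted_L s) h1
    rw [h3]
    filter_upwards [hP.condExp_L hT hs] with ω h4
    simp [h4]
  have hLTS : IsSqIntegrable μ p.T fun s ω => L s ω - L p.T ω :=
    hLS.sub (IsSqIntegrable.of_space (hLS.meas.measurable_section hTm) (hP.memLp_L hTm))
  -- Both the marginal and L_s - L_T have zero conditional mean at time s; hence so do, at time t,
  -- their integrals against R'(T-s) and their multiples by R.
  have hG := ((isCentred_integral (𝓕 := 𝓕) hB (fun s hs => (h s hs).2) hR'c ht).sub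
    (IsCentred.const_mul (h t ht) R)).sub
    ((isCentred_integral (𝓕 := 𝓕) (Z := fun s ω => L s ω - L p.T ω) hLTS (fun s hs => (hLce s hs).2) hR'c ht).sub
      ((hLce t ht).const_mul R))
  set G : Ω → ℝ := fun ω =>
    (∫ s in (t : ℝ)..p.T, feedbackRDeriv p (p.T - s) * marginal p P x v ν s ω)
      - R * marginal p P x v ν t ω
      - ((∫ s in (t : ℝ)..p.T, feedbackRDeriv p (p.T - s) * (L s ω - L p.T ω))
        - R * (L t ω - L p.T ω)) with hGdef
  set H : Ω → ℝ := fun ω => 2 * p.lam * R * v t ω - 2 * p.lam * R' * inventory x v t ω with hHdef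
  -- R times the signal is a centred variable minus H, which is `𝓕 t`-measurable and contains the
  -- current rate and inventory. Conditioning therefore reads off the rate.
  have hkey : (fun ω => R * feedbackTerm p A Y t ω) =ᵐ[μ] fun ω => G ω - H ω := by
    filter_upwards [hΦ, hLS.ae_intervalIntegrable, hF.ae_intervalIntegrable,
      hv.isSqIntegrable.ae_intervalIntegrable,
      (hPS.executionPrice hν).ae_intervalIntegrable] with ω h1 hLi hFi hvi hSi
    have h2 := integral_feedbackRDeriv_mul_marginalPath (x := x) (c := P p.T ω) hSi hvi htm
    have hLt := (intervalIntegrable_sub_Icc hT hLi htm).2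
    have hFt := (intervalIntegrable_sub_Icc hT hFi htm).2
    have i1 := (hLt.sub (intervalIntegrable_const (c := L p.T ω))).continuousOn_mul
      hR'c.continuousOn
    have i2 := hFt.continuousOn_mul hR'c.continuousOn
    have i3 : IntervalIntegrable (fun s => feedbackRDeriv p (p.T - s)) volume t p.T :=
      hR'c.intervalIntegrable _ _
    have h3 : ∫ s in (t : ℝ)..p.T, feedbackRDeriv p (p.T - s)
        * (executionPrice p P ν s ω - P p.T ω)
        = (∫ s in (t : ℝ)..p.T, feedbackRDeriv p (p.T - s) * (L s ω - L p.T ω))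
          + (∫ s in (t : ℝ)..p.T, feedbackRDeriv p (p.T - s)
              * (A s ω - p.κ * distortion p ν s ω))
          - A p.T ω * ∫ s in (t : ℝ)..p.T, feedbackRDeriv p (p.T - s) := by
      rw [← intervalIntegral.integral_const_mul, ← intervalIntegral.integral_add i1 i2,
        ← intervalIntegral.integral_sub (i1.add i2) (i3.const_mul _)]
      refine intervalIntegral.integral_congr fun s hs => ?_
      rw [uIcc_of_le ht] at hs
      simp only [executionPrice]
      rw [hP.decomp s ⟨t.2.trans hs.1, hs.2⟩, hP.decomp p.T hTm]
      ring
    have h4 := feedbackR_sub_primitive p t p.T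
    rw [intervalIntegral.integral_neg, sub_self] at h4
    rw [h3] at h2
    have h5 : executionPrice p P ν t ω = L t ω + A t ω - p.κ * distortion p ν t ω := by
      rw [executionPrice, hP.decomp t htm]
    have h6 := hP.decomp p.T hTm ω
    rw [h5, h6] at h2
    rw [h1]
    simp only [hGdef, hHdef, marginal, inventory]
    rw [← h6] at h2
    simp only [← hRdef, ← hR'def] at h2 h4
    linear_combination (-1) * h2 - R * h6 + A p.T ω * h4
  have hHi : Integrable H μ := by
    have : Integrable (fun ω => G ω - R * feedbackTerm p A Y t ω) μ := hG.1.sub hΦi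
    refine this.congr ?_
    filter_upwards [hkey] with ω hω
    rw [hω, sub_sub_cancel]
  have hHm : StronglyMeasurable[𝓕 t] H := by
    have h1 := hv.progressive.stronglyAdapted t
    have h2 := ((IsAdmissible.of_time (μ := μ) (𝓕 := 𝓕) (T := p.T)
      (continuous_const (y := x))).sub hv.integral_zero_left).progressive.stronglyAdapted t
    exact (h1.const_mul (2 * p.lam * R)).sub (h2.const_mul (2 * p.lam * R'))
  have hce1 : μ[(fun ω => R * feedbackTerm p A Y t ω)|𝓕 t] =ᵐ[μ] fun ω => -H ω := by
    refine (condExp_congr_ae hkey).trans ((condExp_sub hG.1 hHi (𝓕 t)).trans ?_)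
    rw [condExp_of_stronglyMeasurable (𝓕.le t) hHm hHi]
    filter_upwards [hG.2] with ω hω
    rw [Pi.sub_apply, hω]
    simp
  have hce2 : μ[(fun ω => R * feedbackTerm p A Y t ω)|𝓕 t]
      =ᵐ[μ] fun ω => R * (μ[feedbackTerm p A Y t|𝓕 t]) ω :=
    condExp_smul R (feedbackTerm p A Y t) (𝓕 t)
  filter_upwards [hce1, hce2] with ω h1 h2
  rw [h2] at h1
  rw [deriv_feedbackR, ← hR'def]
  simp only [hHdef] at h1
  field_simp
  linear_combination h1

end Feedback

/-! ### Uniqueness for the aggregated system and the equilibrium of the game. -/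

section Equilibrium

variable {Ω : Type*} {mΩ : MeasurableSpace Ω} {μ : Measure Ω} [IsProbabilityMeasure μ]
  {𝓕 : Filtration ℝ≥0 mΩ} {p : ImpactParams} {P L A : ℝ → Ω → ℝ}
  {X Y X' Y' v v' ν ν' : ℝ → Ω → ℝ} {x xbar k : ℝ}

/-- The rate `v` together with the optimal liquidation of `k` additional shares. -/
noncomputable def shiftedRate (p : ImpactParams) (k : ℝ) (v : ℝ → Ω → ℝ) : ℝ → Ω → ℝ :=
  fun t ω => k * liquidationRate p t + v t ω

lemma IsAdmissible.shiftedRate (hv : IsAdmissible μ 𝓕 p.T v) (k : ℝ) :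
    IsAdmissible μ 𝓕 p.T (shiftedRate p k v) :=
  (IsAdmissible.of_time (continuous_const.mul (continuous_liquidationRate p))).add hv

/-- By linearity the shift adds k times the marginal of the unit liquidation at zero prices, which
vanishes. -/
lemma ae_marginal_shiftedRate (hv : IsSqIntegrable μ p.T v) (k : ℝ) :
    ∀ᵐ ω ∂μ, ∀ t ∈ Icc 0 p.T,
      marginal p P (k + x) (shiftedRate p k v) ν t ω = marginal p P x v ν t ω := by
  filter_upwards [hv.ae_intervalIntegrable] with ω hω t ht
  have h := marginalPath_linear (S := fun _ => 0) (S' := fun s => executionPrice p P ν s ω) k 1 x 0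
    (P p.T ω) ((continuous_liquidationRate p).intervalIntegrable _ _) hω ht
  rw [marginalPath_liquidationRate] at h
  simpa [marginal, _root_.shiftedRate] using h

lemma IsConditionallyStationary.shiftedRate (hv : IsSqIntegrable μ p.T v)
    (h : IsConditionallyStationary μ 𝓕 p P x v ν) (k : ℝ) :
    IsConditionallyStationary μ 𝓕 p P (k + x) (shiftedRate p k v) ν := fun t ht => by
  have e : marginal p P x v ν t =ᵐ[μ] marginal p P (k + x) (_root_.shiftedRate p k v) ν t :=
    (ae_marginal_shiftedRate hv k).mono fun ω hω => (hω t ⟨t.2, ht⟩).symm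
  exact ⟨(h t ht).1.congr e, (condExp_congr_ae e.symm).trans (h t ht).2⟩

lemma IsStationaryRate.shiftedRate (hv : IsSqIntegrable μ p.T v)
    (h : IsStationaryRate μ 𝓕 p P x v ν) (k : ℝ) :
    IsStationaryRate μ 𝓕 p P (k + x) (shiftedRate p k v) ν := fun w hw => by
  rw [← h w hw]
  refine integral_congr_ae ?_
  have h1 : ∀ᵐ z ∂(timeProd μ p.T), ∀ t ∈ Icc 0 p.T,
      marginal p P (k + x) (_root_.shiftedRate p k v) ν t z.2 = marginal p P x v ν t z.2 :=
    Measure.quasiMeasurePreserving_snd.ae (ae_marginal_shiftedRate hv k)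
  have h2 : ∀ᵐ z ∂(timeProd μ p.T), z.1 ∈ Icc 0 p.T :=
    Measure.quasiMeasurePreserving_fst.ae (ae_restrict_mem measurableSet_Icc)
  filter_upwards [h1, h2] with z hz1 hz2
  rw [hz1 _ hz2]

namespace IsAggregatedSolution

lemma isStationaryRate (hP : IsH2Semimartingale μ 𝓕 p.T P L A)
    (h : IsAggregatedSolution μ 𝓕 p P xbar X Y ν) : IsStationaryRate μ 𝓕 p P xbar ν ν :=
  h.isConditionallyStationary.isStationary (hP.isSqIntegrable_P p.T_pos)
    (hP.memLp_P p.T_pos ⟨p.T_pos.le, le_rfl⟩) h.admissible.isSqIntegrable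
    h.admissible.isSqIntegrable

/-- The aggregated system has at most one solution. -/
theorem unique (hP : IsH2Semimartingale μ 𝓕 p.T P L A)
    (h : IsAggregatedSolution μ 𝓕 p P xbar X Y ν)
    (h' : IsAggregatedSolution μ 𝓕 p P xbar X' Y' ν') :
    (∀ᵐ ω ∂μ, ∀ t ∈ Icc 0 p.T, X t ω = X' t ω ∧ Y t ω = Y' t ω) ∧
      ∀ t ∈ Icc 0 p.T, ν t =ᵐ[μ] ν' t := by
  have hae : ∀ᵐ z ∂(timeProd μ p.T), ν z.1 z.2 = ν' z.1 z.2 :=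
    ae_eq_of_isStationary_self (hP.isSqIntegrable_P p.T_pos)
      (hP.memLp_P p.T_pos ⟨p.T_pos.le, le_rfl⟩) h.admissible h'.admissible
      h.admissible.isSqIntegrable h'.admissible.isSqIntegrable (h.isStationaryRate hP)
      (h'.isStationaryRate hP) (Eventually.of_forall fun _ => rfl)
      (Eventually.of_forall fun _ => rfl)
  have hI := ae_integral_eq_of_ae_eq hae
  have hD := ae_distortion_eq_of_ae_eq hae
  refine ⟨?_, fun t ht => ?_⟩
  · filter_upwards [hI, hD, h.forward_X, h'.forward_X, h.ae_eq_distortion, h'.ae_eq_distortion]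
      with ω h1 h2 h3 h4 h5 h6 t ht
    exact ⟨by rw [h3 t ht, h4 t ht, h1 t ht], by rw [h5 t ht, h6 t ht, h2 t ht]⟩
  set s : ℝ≥0 := ⟨t, ht.1⟩
  obtain ⟨hi, hc⟩ := h.isConditionallyStationary s ht.2
  obtain ⟨hi', hc'⟩ := h'.isConditionallyStationary s ht.2
  -- The rates agree almost everywhere, so all integral terms coincide. The difference of marginals
  -- at time t is -2λ (ν_t - ν'_t): it is `𝓕 t`-measurable with zero conditional mean, hence zero
  -- almost surely.
  have e : (fun ω => marginal p P xbar ν ν t ω - marginal p P xbar ν' ν' t ω)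
      =ᵐ[μ] fun ω => -(2 * p.lam) * (ν t ω - ν' t ω) := by
    filter_upwards [hI, hD] with ω h1 h2
    have e1 : ∫ r in t..p.T, (xbar - ∫ u in (0 : ℝ)..r, ν u ω)
        = ∫ r in t..p.T, (xbar - ∫ u in (0 : ℝ)..r, ν' u ω) := by
      refine intervalIntegral.integral_congr fun r hr => ?_
      rw [uIcc_of_le ht.2] at hr
      rw [h1 r ⟨ht.1.trans hr.1, hr.2⟩]
    simp only [marginal, marginalPath, executionPrice]
    rw [e1, h2 t ht, h1 p.T ⟨p.T_pos.le, le_rfl⟩]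
    ring
  have hm : StronglyMeasurable[𝓕 s] fun ω => -(2 * p.lam) * (ν t ω - ν' t ω) :=
    ((h.admissible.progressive.stronglyAdapted s).sub
      (h'.admissible.progressive.stronglyAdapted s)).const_mul _
  have hint : Integrable (fun ω => -(2 * p.lam) * (ν t ω - ν' t ω)) μ := (hi.sub hi').congr e
  have h0 : μ[fun ω => -(2 * p.lam) * (ν t ω - ν' t ω)|𝓕 s] =ᵐ[μ] 0 := by
    refine (condExp_congr_ae e.symm).trans ((condExp_sub hi hi' (𝓕 s)).trans ?_)
    filter_upwards [hc, hc'] with ω h1 h2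
    rw [Pi.sub_apply, h1, h2, sub_self]
    rfl
  rw [condExp_of_stronglyMeasurable (𝓕.le s) hm hint] at h0
  filter_upwards [h0] with ω hω
  have hl := p.lam_pos.ne'
  have h3 : ν t ω - ν' t ω = 0 := by
    simpa [hl] using hω
  linarith

end IsAggregatedSolution

lemma sum_shiftedRate_div (x : ℕ → ℝ) (a t : ℝ) (ω : Ω) {N : ℕ} (hN : N ≠ 0) :
    (∑ i ∈ Finset.range N, shiftedRate p (x i - a) v t ω) / N
      = shiftedRate p ((∑ i ∈ Finset.range N, x i) / N - a) v t ω := by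
  have hN' : (N : ℝ) ≠ 0 := Nat.cast_ne_zero.2 hN
  simp only [shiftedRate]
  rw [Finset.sum_add_distrib, ← Finset.sum_mul, Finset.sum_sub_distrib]
  simp only [Finset.sum_const, Finset.card_range, nsmul_eq_mul]
  field_simp

lemma tendsto_sum_shiftedRate_div {x : ℕ → ℝ}
    (hx : Tendsto (fun N : ℕ => (∑ i ∈ Finset.range N, x i) / N) atTop (𝓝 xbar))
    (a t : ℝ) (ω : Ω) :
    Tendsto (fun N : ℕ => (∑ i ∈ Finset.range N, shiftedRate p (x i - a) v t ω) / N) atTop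
      (𝓝 (shiftedRate p (xbar - a) v t ω)) := by
  refine Tendsto.congr' ?_ (((hx.sub_const a).mul_const (liquidationRate p t)).add_const (v t ω))
  filter_upwards [eventually_ne_atTop 0] with N hN
  rw [sum_shiftedRate_div x a t ω hN, shiftedRate]

/-- The equilibrium induced by a solution of the aggregated system. -/
theorem IsAggregatedSolution.isMeanFieldNash (hP : IsH2Semimartingale μ 𝓕 p.T P L A) {x : ℕ → ℝ}
    (hx : Tendsto (fun N : ℕ => (∑ i ∈ Finset.range N, x i) / N) atTop (𝓝 xbar))
    (h : IsAggregatedSolution μ 𝓕 p P xbar X Y ν) :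
    IsMeanFieldNash μ 𝓕 p P x (fun i => shiftedRate p (x i - xbar) ν) := by
  have hadm := fun i => h.admissible.shiftedRate (x i - xbar)
  refine ⟨hadm, ν, h.admissible, fun i => ?_, Eventually.of_forall fun z => ?_⟩
  · have hs := (h.isStationaryRate hP).shiftedRate h.admissible.isSqIntegrable (x i - xbar)
    rw [sub_add_cancel] at hs
    exact (isOptimal_iff_isStationary (hP.isSqIntegrable_P p.T_pos)
      (hP.memLp_P p.T_pos ⟨p.T_pos.le, le_rfl⟩) (hadm i) h.admissible).2 hs
  · simpa [shiftedRate] using tendsto_sum_shiftedRate_div (p := p) (v := ν) hx xbar z.1 z.2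

/-- The equilibrium of the game is unique. -/
theorem IsMeanFieldNash.ae_eq_shiftedRate (hP : IsH2Semimartingale μ 𝓕 p.T P L A) {x : ℕ → ℝ}
    (hx : Tendsto (fun N : ℕ => (∑ i ∈ Finset.range N, x i) / N) atTop (𝓝 xbar))
    (h : IsAggregatedSolution μ 𝓕 p P xbar X Y ν) {w : ℕ → ℝ → Ω → ℝ}
    (hw : IsMeanFieldNash μ 𝓕 p P x w) (i : ℕ) :
    ∀ᵐ z ∂(timeProd μ p.T), w i z.1 z.2 = shiftedRate p (x i - xbar) ν z.1 z.2 := by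
  have hPS := hP.isSqIntegrable_P p.T_pos
  have hPT := hP.memLp_P p.T_pos ⟨p.T_pos.le, le_rfl⟩
  obtain ⟨ν', hν', hopt, hlim⟩ := hw.equilibrium
  have hstat : ∀ i, IsStationaryRate μ 𝓕 p P (x i) (w i) ν' := fun i =>
    (isOptimal_iff_isStationary hPS hPT (hw.admissible i) hν').1 (hopt i)
  have hw0 := hw.admissible 0
  -- All agents face the same flow, so shifting the optimal rate of agent 0 gives a best response
  -- for agent i, and best responses are unique.
  have hsame : ∀ i, ∀ᵐ z ∂(timeProd μ p.T),
      w i z.1 z.2 = shiftedRate p (x i - x 0) (w 0) z.1 z.2 := fun i => by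
    have hs := (hstat 0).shiftedRate hw0.isSqIntegrable (x i - x 0)
    rw [sub_add_cancel] at hs
    exact ae_eq_of_isStationary_same_flow hPS hPT (hw.admissible i) (hw0.shiftedRate _)
      hν'.isSqIntegrable (hstat i) hs
  -- The best response of an agent starting from the mean position. It is the limit of the averages,
  -- hence the flow itself, and solves the same self-consistent problem as `ν`.
  set u := shiftedRate p (xbar - x 0) (w 0) with hu
  have hflow : ∀ᵐ z ∂(timeProd μ p.T), ν' z.1 z.2 = u z.1 z.2 := by
    filter_upwards [hlim, ae_all_iff.2 hsame] with z h1 h2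
    refine tendsto_nhds_unique h1 ?_
    simp only [h2]
    exact tendsto_sum_shiftedRate_div hx _ _ _
  have hus := (hstat 0).shiftedRate hw0.isSqIntegrable (xbar - x 0)
  rw [sub_add_cancel] at hus
  have huν : ∀ᵐ z ∂(timeProd μ p.T), u z.1 z.2 = ν z.1 z.2 :=
    ae_eq_of_isStationary_self hPS hPT (hw0.shiftedRate _) h.admissible hν'.isSqIntegrable
      h.admissible.isSqIntegrable hus (h.isStationaryRate hP) hflow
      (Eventually.of_forall fun _ => rfl)
  filter_upwards [hsame i, huν] with z h1 h2
  rw [h1]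
  simp only [shiftedRate, hu] at h2 ⊢
  linear_combination h2

end Equilibrium

theorem theorem3p6 {Ω : Type*} [mΩ : MeasurableSpace Ω] (μ : Measure Ω) [IsProbabilityMeasure μ]
    (𝓕 : Filtration ℝ≥0 mΩ) [𝓕.IsRightContinuous]
    (hcomplete : ∀ s : Set Ω, μ s = 0 → MeasurableSet[𝓕 0] s)
    (p : ImpactParams) (P L A : ℝ → Ω → ℝ) (hP : IsH2Semimartingale μ 𝓕 p.T P L A)
    (x : ℕ → ℝ) (xbar : ℝ)
    (hx : Tendsto (fun N : ℕ => (∑ i ∈ Finset.range N, x i) / N) atTop (𝓝 xbar)) :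
    -- the aggregated system has a solution, and only one
    (∃ X Y ν : ℝ → Ω → ℝ, IsAggregatedSolution μ 𝓕 p P xbar X Y ν) ∧
    (∀ X Y ν X' Y' ν' : ℝ → Ω → ℝ, IsAggregatedSolution μ 𝓕 p P xbar X Y ν →
      IsAggregatedSolution μ 𝓕 p P xbar X' Y' ν' →
        (∀ᵐ ω ∂μ, ∀ t ∈ Icc 0 p.T, X t ω = X' t ω ∧ Y t ω = Y' t ω) ∧
        ∀ t ∈ Icc 0 p.T, ν t =ᵐ[μ] ν' t) ∧
    -- the game has a unique equilibrium, and it is given in feedback form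
    ∀ X Y ν : ℝ → Ω → ℝ, IsAggregatedSolution μ 𝓕 p P xbar X Y ν →
      ∃ v : ℕ → ℝ → Ω → ℝ, IsMeanFieldNash μ 𝓕 p P x v ∧
        (∀ v' : ℕ → ℝ → Ω → ℝ, IsMeanFieldNash μ 𝓕 p P x v' →
          ∀ i, ∀ᵐ z ∂(timeProd μ p.T), v' i z.1 z.2 = v i z.1 z.2) ∧
        ∀ i, ∀ t : ℝ≥0, 0 < t → (t : ℝ) < p.T →
          Integrable (feedbackTerm p A Y t) μ ∧
          v i t =ᵐ[μ] fun ω =>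
            deriv (feedbackR p) (p.T - t) / feedbackR p (p.T - t) * inventory (x i) (v i) t ω
              - 1 / (2 * p.lam) * (μ[feedbackTerm p A Y t | 𝓕 t]) ω := by
  have hPS := hP.isSqIntegrable_P p.T_pos
  have hPT := hP.memLp_P p.T_pos ⟨p.T_pos.le, le_rfl⟩
  refine ⟨?_, fun X Y ν X' Y' ν' h h' => h.unique hP h', fun X Y ν h => ?_⟩
  · obtain ⟨ν, hν, hs⟩ := exists_isStationaryRate (𝓕 := 𝓕) (xbar := xbar) hPS hPT
    exact exists_isAggregatedSolution_of_isStationaryRate hP hν hs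
  refine ⟨fun i => shiftedRate p (x i - xbar) ν, h.isMeanFieldNash hP hx,
    fun v' hv' i => hv'.ae_eq_shiftedRate hP hx h i, fun i t _ ht => ?_⟩
  -- The shift preserves the conditional condition at every time, not just almost everywhere, so the
  -- feedback formula holds at each t for this version.
  have hs := h.isConditionallyStationary.shiftedRate h.admissible.isSqIntegrable (x i - xbar)
  rw [sub_add_cancel] at hs
  exact hs.feedback hP (h.admissible.shiftedRate _) h.admissible.isSqIntegrable
    h.ae_eq_distortion ht.le
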